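/- Conventions. Let $\mathsf{PAL}=\{x_n\cdots x_1x_1\cdots x_n : n\in\mathbb N,\ x_1,\dots,x_n\in\{0,1\}\}$ be the language of (even-length) palindromes. A nondeterministic one-tape Turing machine $A$ runs in time $O(n^{1.1})$ if there is a constant $C$ such that on every input of length $n$ every computation path has at most $C n^{1.1}+C$ steps; $A(x)=1$ if some computation path on $x$ accepts, and $A(x)=0$ otherwise. For $\mathcal D\in\{\mathsf P^{\mathsf{NP}},\mathsf P,\mathsf{LOGSPACE}\}$, a $\mathcal D$-refuter for $\mathsf{PAL}$ against $A$ is an algorithm $R$ that on input $1^n$ prints a string $R(1^n)\in\{0,1\}^n$ for every $n$, such that $A(R(1^n))\neq \mathsf{PAL}(R(1^n))$ for infinitely many $n$, where $R$ is, respectively, a deterministic polynomial-time algorithm with an oracle in $\mathsf{NP}$, a deterministic polynomial-time algorithm, or a deterministic algorithm using $O(\log n)$ work space (with a read-only input tape and a write-only output tape). A $\mathcal D$-constructive separation of $\mathsf{PAL}$ from nondeterministic $O(n^{1.1})$-time one-tape Turing machines means that for every such machine $A$ there is a $\mathcal D$-refuter for $\mathsf{PAL}$ against $A$. Write $\mathsf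 E=\mathsf{DTIME}[2^{O(n)}]$, let $\mathsf E^{\mathsf{NP}}$ be the class of languages decidable in deterministic time $2^{O(n)}$ with an oracle in $\mathsf{NP}$, and let $\mathsf{SIZE}[s(n)]$ be the class of languages decided by a family of fan-in-two Boolean circuits with $O(s(n))$ gates on inputs of length $n$. Theorem. The following hold. 1. If there is a $\mathsf P^{\mathsf{NP}}$-constructive separation of $\mathsf{PAL}$ from nondeterministic $O(n^{1.1})$-time one-tape Turing machines, then $\mathsf E^{\mathsf{NP}}\not\subset\mathsf{SIZE}[2^{\delta n}]$ for some constant $\delta>0$. 2. If there is a $\mathsf P$-constructive separation of $\mathsf{PAL}$ from nondeterministic $O(n^{1.1})$-time one-tape Turing machines, then $\mathsf E\not\subset\mathsf{SIZE}[2^{\delta n}]$ for some constant $\delta>0$. 3. If there is a $\mathsf{LOGSPACE}$-constructive separation of $\mathsf{PAL}$ from nondeterministic $O(n^{1.1})$-time one-tape Turing machines, then $\mathsf{PSPACE}\not\subset\mathsf{SIZE}[2^{\delta n}]$ for some constant $\delta>0$. -/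

import Mathlib

open Filter

namespace ConstructiveSeparation

/-- `StepsIn r t a b`: there is a computation of exactly `t` steps of `r` from `a` to `b`. -/
inductive StepsIn {α : Type} (r : α → α → Prop) : ℕ → α → α → Prop
  | zero (a : α) : StepsIn r 0 a a
  | succ {t : ℕ} {a b c : α} : StepsIn r t a b → r b c → StepsIn r (t + 1) a c

/-- A head movement. -/
inductive Move
  | left
  | stay
  | right

/-- The displacement of a head on a two-way infinite tape. -/
def Move.toInt : Move → ℤ
  | .left => -1
  | .stay => 0
  | .right => 1

/-! ### Nondeterministic one-tape Turing machines -/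

/-- A nondeterministic Turing machine with a single two-way infinite read/write tape, on which
the input is written. The tape alphabet `Γ` contains the two bits and, as `sym none`,
the blank. -/
structure NTM where
  Q : Type
  Γ : Type
  [finQ : Finite Q]
  [finΓ : Finite Γ]
  sym : Option Bool ↪ Γ
  start : Q
  accept : Set Q
  /-- The possible actions (new state, written symbol, head movement); the machine halts
  where there is none. -/
  δ : Q → Γ → Set (Q × Γ × Move)

namespace NTM

structure Cfg (M : NTM) where
  state : M.Q
  head : ℤ
  tape : ℤ → M.Γ

/-- The input occupies the cells `0, …, |x| - 1`, all other cells are blank, and the head is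
on cell `0`. -/
def init (M : NTM) (x : List Bool) : M.Cfg where
  state := M.start
  head := 0
  tape i := M.sym (if i < 0 then none else x[i.toNat]?)

def Step (M : NTM) (c d : M.Cfg) : Prop :=
  ∃ a ∈ M.δ c.state (c.tape c.head),
    d = { state := a.1
          head := c.head + a.2.2.toInt
          tape := Function.update c.tape c.head a.2.1 }

/-- Some computation path on `x` enters an accepting state. -/
def Accepts (M : NTM) (x : List Bool) : Prop :=
  ∃ t c, StepsIn M.Step t (M.init x) c ∧ c.state ∈ M.accept

/-- On every input `x`, every computation path has at most `T |x|` steps. -/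
def RunsInTime (M : NTM) (T : ℕ → ℝ) : Prop :=
  ∀ x t c, StepsIn M.Step t (M.init x) c → (t : ℝ) ≤ T x.length

/-- The machines that run in time `O(n ^ e)`. -/
def timeOPow (e : ℝ) : Set NTM :=
  {M | ∃ C : ℝ, M.RunsInTime fun n => C * (n : ℝ) ^ e + C}

end NTM

/-- The class NP. -/
def NP : Set (Language Bool) :=
  {L | ∃ (M : NTM) (c : ℕ), M.RunsInTime (fun n => ((c * n ^ c + c : ℕ) : ℝ)) ∧
    ∀ x, M.Accepts x ↔ x ∈ L}

/-! ### Deterministic oracle machines -/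

/-- The symbols on the read-only input tape: the input, between two end markers. -/
inductive InSym
  | leftEnd
  | bit (b : Bool)
  | rightEnd

/-- What a step does with the write-only query tape: nothing, append a bit, or ask the oracle
about the word on it (which is then erased). -/
inductive QueryAct
  | skip
  | push (b : Bool)
  | ask

/-- The action of a deterministic machine in one step. -/
structure Act (Q Γ : Type) (k : ℕ) where
  next : Q
  inMove : Move
  write : Fin k → Γ
  workMove : Fin k → Move
  /-- The bit, if any, that is appended to the write-only output tape. -/
  out : Option Bool
  query : QueryAct

/-- A deterministic oracle Turing machine with a read-only input tape, `k` two-way infinite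
work tapes, a write-only output tape and a write-only query tape. -/
structure DTM where
  Q : Type
  Γ : Type
  [finQ : Finite Q]
  [finΓ : Finite Γ]
  k : ℕ
  blank : Γ
  start : Q
  accept : Set Q
  /-- The action in a state, given the scanned input symbol, the scanned work symbols and the
  most recent answer of the oracle; `none` means that the machine halts. -/
  δ : Q → InSym → (Fin k → Γ) → Bool → Option (Act Q Γ k)

namespace DTM

structure Cfg (M : DTM) where
  state : M.Q
  inHead : ℕ
  head : Fin M.k → ℤ
  tape : Fin M.k → ℤ → M.Γ
  output : List Bool
  query : List Bool
  answer : Bool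

/-- The left end marker is in cell `0`, the input in the cells `1, …, |x|`, and the right end
marker in cell `|x| + 1`. -/
def inSym (x : List Bool) : ℕ → InSym
  | 0 => .leftEnd
  | p + 1 => match x[p]? with
    | some b => .bit b
    | none => .rightEnd

/-- The input head stays between the end markers of an input of length `n`. -/
def moveIn (n p : ℕ) : Move → ℕ
  | .left => p - 1
  | .stay => p
  | .right => min (p + 1) (n + 1)

def init (M : DTM) : M.Cfg where
  state := M.start
  inHead := 0
  head _ := 0
  tape _ _ := M.blank
  output := []
  query := []
  answer := false

/-- The action taken in the configuration `c` on the input `x`. -/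
def act (M : DTM) (x : List Bool) (c : M.Cfg) : Option (Act M.Q M.Γ M.k) :=
  M.δ c.state (inSym x c.inHead) (fun j => c.tape j (c.head j)) c.answer

open Classical in
/-- The configuration after the action `a`, with the oracle `O`. -/
noncomputable def apply (M : DTM) (O : Language Bool) (x : List Bool) (c : M.Cfg)
    (a : Act M.Q M.Γ M.k) : M.Cfg where
  state := a.next
  inHead := moveIn x.length c.inHead a.inMove
  head j := c.head j + (a.workMove j).toInt
  tape j := Function.update (c.tape j) (c.head j) (a.write j)
  output := c.output ++ a.out.toList
  query := match a.query with
    | .skip => c.query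
    | .push b => c.query ++ [b]
    | .ask => []
  answer := match a.query with
    | .ask => decide (c.query ∈ O)
    | _ => c.answer

def Step (M : DTM) (O : Language Bool) (x : List Bool) (c d : M.Cfg) : Prop :=
  ∃ a, M.act x c = some a ∧ d = M.apply O x c a

/-- With the oracle `O`, the machine halts on `x` after exactly `t` steps in the
configuration `c`. -/
def HaltsAt (M : DTM) (O : Language Bool) (x : List Bool) (t : ℕ) (c : M.Cfg) : Prop :=
  StepsIn (M.Step O x) t M.init c ∧ M.act x c = none

/-- During the computation on `x`, the heads visit only cells at distance at most `s` from
the origin of each work tape. -/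
def UsesSpace (M : DTM) (O : Language Bool) (x : List Bool) (s : ℕ) : Prop :=
  ∀ t c, StepsIn (M.Step O x) t M.init c → ∀ j, (c.head j).natAbs ≤ s

/-- The machine is an ordinary Turing machine: it never touches the query tape. -/
def OracleFree (M : DTM) : Prop :=
  ∀ q i w b a, M.δ q i w b = some a → a.query = .skip

end DTM

/-- E with the oracle `O`. -/
def EWith (O : Language Bool) : Set (Language Bool) :=
  {L | ∃ (M : DTM) (c : ℕ), ∀ x : List Bool, ∃ t d, t ≤ c * 2 ^ (c * x.length) ∧
    M.HaltsAt O x t d ∧ (d.state ∈ M.accept ↔ x ∈ L)}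

/-- The class `E^NP`. -/
def ENP : Set (Language Bool) := {L | ∃ O ∈ NP, L ∈ EWith O}

/-- The class E = DTIME[2 ^ O(n)]. The oracle does not matter for an oracle-free machine. -/
def classE : Set (Language Bool) :=
  {L | ∃ (M : DTM) (c : ℕ), M.OracleFree ∧ ∀ x : List Bool, ∃ t d,
    t ≤ c * 2 ^ (c * x.length) ∧ M.HaltsAt ⊥ x t d ∧ (d.state ∈ M.accept ↔ x ∈ L)}

/-- The class PSPACE. -/
def PSPACE : Set (Language Bool) :=
  {L | ∃ (M : DTM) (c : ℕ), M.OracleFree ∧ ∀ x : List Bool,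
    M.UsesSpace ⊥ x (c * x.length ^ c + c) ∧
    ∃ t d, M.HaltsAt ⊥ x t d ∧ (d.state ∈ M.accept ↔ x ∈ L)}

/-! ### Refuters -/

/-- The string `1 ^ n`. -/
def unary (n : ℕ) : List Bool := List.replicate n true

/-- The maps `1 ^ n ↦ R n` computable in polynomial time with an oracle in NP. -/
def algPNP : Set (ℕ → List Bool) :=
  {R | ∃ O ∈ NP, ∃ (M : DTM) (c : ℕ), ∀ n, ∃ t d, t ≤ c * n ^ c + c ∧
    M.HaltsAt O (unary n) t d ∧ d.output = R n}

/-- The maps `1 ^ n ↦ R n` computable in polynomial time. -/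
def algP : Set (ℕ → List Bool) :=
  {R | ∃ (M : DTM) (c : ℕ), M.OracleFree ∧ ∀ n, ∃ t d, t ≤ c * n ^ c + c ∧
    M.HaltsAt ⊥ (unary n) t d ∧ d.output = R n}

/-- The maps `1 ^ n ↦ R n` computable in logarithmic space. -/
def algLOGSPACE : Set (ℕ → List Bool) :=
  {R | ∃ (M : DTM) (c : ℕ), M.OracleFree ∧ ∀ n,
    M.UsesSpace ⊥ (unary n) (c * Nat.log 2 n + c) ∧
    ∃ t d, M.HaltsAt ⊥ (unary n) t d ∧ d.output = R n}

/-- `R` is a refuter for `f` against the machine `A`: `R` prints a string of length `n` for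
every `n`, and for infinitely many `n` the machine `A` errs on it. -/
def IsRefuter (f : Language Bool) (A : NTM) (R : ℕ → List Bool) : Prop :=
  (∀ n, (R n).length = n) ∧ ∃ᶠ n in atTop, ¬ (A.Accepts (R n) ↔ R n ∈ f)

/-- A `D`-constructive separation of `f` from the machines in `C`. -/
def ConstructiveSep (D : Set (ℕ → List Bool)) (f : Language Bool) (C : Set NTM) : Prop :=
  ∀ A ∈ C, ∃ R ∈ D, IsRefuter f A R

/-- The (even-length) palindromes `x_n ⋯ x_1 x_1 ⋯ x_n`. -/
def PAL : Language Bool := {w | ∃ y : List Bool, w = y.reverse ++ y}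

/-! ### Boolean circuits -/

/-- A gate; its arguments are wires, given by their numbers. -/
inductive Gate
  | const (b : Bool)
  | not (i : ℕ)
  | and (i j : ℕ)
  | or (i j : ℕ)

namespace Gate

/-- The arguments of the gate are among the wires `0, …, m - 1`. -/
def ReadsBelow (m : ℕ) : Gate → Prop
  | const _ => True
  | not i => i < m
  | and i j => i < m ∧ j < m
  | or i j => i < m ∧ j < m

/-- The value of a gate, given the values of the previous wires. -/
def eval (w : List Bool) : Gate → Bool
  | const b => b
  | not i => !(w.getD i false)
  | and i j => w.getD i false && w.getD j false
  | or i j => w.getD i false || w.getD j false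

end Gate

/-- A Boolean circuit of fan-in two with `n` inputs, as a list of gates in topological order:
wire `i < n` is the `i`-th input and wire `n + k` is the output of the `k`-th gate. -/
structure Circuit (n : ℕ) where
  gates : List Gate
  wf : ∀ (k : ℕ) (hk : k < gates.length), (gates[k]).ReadsBelow (n + k)
  out : ℕ
  out_lt : out < n + gates.length

namespace Circuit

def size {n : ℕ} (C : Circuit n) : ℕ := C.gates.length

/-- The values of all wires on the input `x`, where `|x| = n`. -/
def wires {n : ℕ} (C : Circuit n) (x : List Bool) : List Bool :=
  C.gates.foldl (fun w g => w ++ [g.eval w]) x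

def eval {n : ℕ} (C : Circuit n) (x : List Bool) : Bool := (C.wires x).getD C.out false

end Circuit

/-- The languages with circuits of size `O(s(n))`. -/
def SIZE (s : ℕ → ℝ) : Set (Language Bool) :=
  {L | ∃ K : ℝ, ∀ n, ∃ C : Circuit n, (C.size : ℝ) ≤ K * s n ∧
    ∀ x : List Bool, x.length = n → (C.eval x = true ↔ x ∈ L)}

end ConstructiveSeparation

open ConstructiveSeparation

/-! One fixed nondeterministic machine, `palNTM (2 ^ 20 - 1)`, defeats every refuter whose output
bits have small circuits. It guesses a program, drags it along the input, and compares each scanned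
bit with the value of the program on a binary counter; at the right end the counter is reset and the
input is compared with the same sequence from right to left. An accepting path shows that the input
and its reversal both equal the printed sequence. Together with a parity check this excludes false
acceptance, whatever was guessed (`mem_PAL_of_accepts`). Conversely, every palindrome printed by a
nonempty program of admissible width is accepted (`accepts_of_results`).

Carrying the program avoids long walks across the input. Its memory is a queue, so that an
instruction costs one sweep back and forth over the program, and a program of width `w` costs `O(w ^
2)` steps per position. The width is capped at about `n ^ (1/20)`, which gives time `O(n ^ 1.1)`
(`palNTM_mem_timeOPow`). The cap is enforced by thinning marks: the marks on the program are halved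
while those on the input are divided by `2 ^ 20` (`thin_phase`). A circuit with `2 * m` inputs and
`s` gates compiles to width `3 * (2 * m + s) * (s + 1)`, because each access to a wire costs one
rotation of the queue (`exists_program`).

For a refuter `R`, consider the language that gives the `i`-th bit of `R n` from `i` and `n + 1`,
written with `m` binary digits each. The machine `bitDTM` decides it by simulating the machine for
`R`, with the input head replaced by binary counters. As `m` can be chosen logarithmic in `n`,
polynomial time becomes exponential time and logarithmic space becomes polynomial space
(`exists_halt_of_poly`, `bitLang_mem_PSPACE`); oracle queries are passed on unchanged. If the class
in question had circuits of size `O(2 ^ (n / 200))`, the bits of `R n` would have circuits of size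
`O(n ^ (1/100))` and hence programs of width `O(n ^ (1/50))`, which is below the cap for large `n`
(`eventually_exists_width`). The machine would then be right on `R n` for all large `n`
(`not_isRefuter`). The three claims differ only in the class of the bit language. -/

namespace ConstructiveSeparation

/-! ### Computations -/

namespace StepsIn

variable {α : Type} {r s : α → α → Prop} {a b c d : α} {t u : ℕ}

theorem mono (hrs : ∀ a b, r a b → s a b) (h : StepsIn r t a b) : StepsIn s t a b := by
  induction h with
  | zero => exact .zero _
  | succ _ h ih => exact .succ ih (hrs _ _ h)

theorem trans (h : StepsIn r t a b) (h' : StepsIn r u b c) : StepsIn r (t + u) a c := by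
  induction h' with
  | zero => exact h
  | succ _ h' ih => exact .succ (ih h) h'

theorem single (h : r a b) : StepsIn r 1 a b := .succ (.zero a) h

theorem exists_head (h : StepsIn r (t + 1) a c) : ∃ b, r a b ∧ StepsIn r t b c := by
  induction t generalizing c with
  | zero =>
    cases h with
    | succ h h' =>
      cases h
      exact ⟨_, h', .zero _⟩
  | succ t ih =>
    cases h with
    | succ h h' =>
      obtain ⟨b, hb, h⟩ := ih h
      exact ⟨b, hb, .succ h h'⟩

end StepsIn

/-- The step from `a` to `b` is the only one possible in `a`, and `b` satisfies `P`. -/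
def DetStep {α : Type} (r : α → α → Prop) (P : α → Prop) (a b : α) : Prop :=
  r a b ∧ (∀ b', r a b' → b' = b) ∧ P b

/-- A computation that starts where a forced computation to a halting configuration does is a
part of the latter. -/
theorem StepsIn.of_detStep {α : Type} {r : α → α → Prop} {P : α → Prop} {a c d : α} {t T : ℕ}
    (h : StepsIn (DetStep r P) T a d) (hd : ∀ e, ¬ r d e) (hc : StepsIn r t a c) :
    t ≤ T ∧ (c = a ∨ P c) ∧ StepsIn (DetStep r P) (T - t) c d := by
  induction hc with
  | zero => exact ⟨Nat.zero_le _, .inl rfl, h⟩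
  | @succ t a b c hb hbc ih =>
    obtain ⟨htT, -, hrest⟩ := ih h
    obtain ⟨k, hk⟩ := Nat.exists_eq_add_of_le htT
    rw [hk, Nat.add_sub_cancel_left] at hrest
    cases k with
    | zero =>
      cases hrest
      exact absurd hbc (hd _)
    | succ k =>
      obtain ⟨b', ⟨-, huniq, hP⟩, hrest⟩ := hrest.exists_head
      obtain rfl := huniq _ hbc
      refine ⟨by omega, .inr hP, ?_⟩
      have : T - (t + 1) = k := by omega
      rwa [this]

/-- A path cannot halt strictly inside the forced computation, since the next forced step is
available there. This turns statements about some path into statements about the forced one. -/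
theorem StepsIn.eq_of_detStep {α : Type} {r : α → α → Prop} {P : α → Prop} {a c d : α} {t T : ℕ}
    (h : StepsIn (DetStep r P) T a d) (hd : ∀ e, ¬ r d e) (hc : StepsIn r t a c)
    (hc' : ∀ e, ¬ r c e) : c = d := by
  obtain ⟨-, -, h⟩ := h.of_detStep hd hc
  generalize T - t = k at h
  cases k with
  | zero =>
    cases h
    rfl
  | succ k =>
    obtain ⟨b, hb, -⟩ := h.exists_head
    exact absurd hb.1 (hc' b)

/-! ### Tapes as pairs of lists -/

/-- The tape with the symbols of `l` to the left of cell `b` (the first of them next to it) and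
those of `r` from cell `b` on; all other cells hold `e`. -/
def tapeOf {Γ : Type} (e : Γ) (b : ℤ) (l r : List Γ) : ℤ → Γ := fun z =>
  if z < b then l.getD (b - 1 - z).toNat e else r.getD (z - b).toNat e

section tapeOf

variable {Γ : Type} (e : Γ) (b : ℤ) (l r : List Γ) (a x : Γ)

theorem tapeOf_right : tapeOf e b l (a :: r) b = a := by simp [tapeOf]

theorem tapeOf_left : tapeOf e b (a :: l) r (b - 1) = a := by simp [tapeOf]

theorem tapeOf_update_right :
    Function.update (tapeOf e b l (a :: r)) b x = tapeOf e b l (x :: r) := by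
  funext z
  rcases eq_or_ne z b with rfl | hz
  · simp [tapeOf]
  · rw [Function.update_of_ne hz]
    unfold tapeOf
    split_ifs with h
    · rfl
    · obtain ⟨k, hk⟩ : ∃ k : ℕ, (z - b).toNat = k + 1 := ⟨(z - b).toNat - 1, by omega⟩
      rw [hk]; rfl

theorem tapeOf_shift : tapeOf e b l (a :: r) = tapeOf e (b + 1) (a :: l) r := by
  funext z
  unfold tapeOf
  rcases lt_trichotomy z b with h | rfl | h
  · rw [if_pos h, if_pos (by omega)]
    have : (b + 1 - 1 - z).toNat = (b - 1 - z).toNat + 1 := by omega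
    rw [this]; rfl
  · simp
  · rw [if_neg (by omega), if_neg (by omega)]
    have : (z - b).toNat = (z - (b + 1)).toNat + 1 := by omega
    rw [this]; rfl

theorem tapeOf_shift' : tapeOf e b (a :: l) r = tapeOf e (b - 1) l (a :: r) := by
  rw [tapeOf_shift, sub_add_cancel]

theorem tapeOf_update_left :
    Function.update (tapeOf e b (a :: l) r) (b - 1) x = tapeOf e b (x :: l) r := by
  rw [tapeOf_shift', tapeOf_update_right, tapeOf_shift']

theorem getD_append_replicate (k i : ℕ) : (r ++ List.replicate k e).getD i e = r.getD i e := by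
  simp only [List.getD_eq_getElem?_getD, List.getElem?_append, List.getElem?_replicate]
  split_ifs with h1 h2
  · rfl
  · simp [List.getElem?_eq_none (not_lt.mp h1)]
  · simp [List.getElem?_eq_none (not_lt.mp h1)]

/-- Cells beyond the lists are blank anyway. Explicit blanks can thus be produced on demand, as
places for the head to turn. -/
theorem tapeOf_pad_right (k : ℕ) :
    tapeOf e b l (r ++ List.replicate k e) = tapeOf e b l r := by
  funext z
  simp only [tapeOf, getD_append_replicate]

theorem tapeOf_pad_left (k : ℕ) :
    tapeOf e b (l ++ List.replicate k e) r = tapeOf e b l r := by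
  funext z
  simp only [tapeOf, getD_append_replicate]

end tapeOf

/-- Applies a letter-to-letter transducer to a word. -/
def scan {σ A B : Type} (f : σ → A → σ × B) : σ → List A → σ × List B
  | s, [] => (s, [])
  | s, a :: u => ((scan f (f s a).1 u).1, (f s a).2 :: (scan f (f s a).1 u).2)

@[simp] theorem scan_length {σ A B : Type} (f : σ → A → σ × B) (s : σ) (u : List A) :
    (scan f s u).2.length = u.length := by
  induction u generalizing s with
  | nil => rfl
  | cons a u ih => simp [scan, ih]

/-! ### Forced runs of one-tape machines, up to translation -/

namespace NTM

/-- A configuration up to translation: the head is on the first cell of the right part of the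
tape (`onR`), or on the first cell of the left part (`onL`). -/
inductive Zip (M : NTM)
  | onR (q : M.Q) (l r : List M.Γ)
  | onL (q : M.Q) (l r : List M.Γ)

/-- The configuration whose left part ends before the cell `b`. -/
def Zip.cfg {M : NTM} (b : ℤ) : M.Zip → M.Cfg
  | onR q l r => ⟨q, b, tapeOf (M.sym none) b l r⟩
  | onL q l r => ⟨q, b - 1, tapeOf (M.sym none) b l r⟩

/-- There is a forced computation of `t` steps between the given configurations. -/
def Runs (M : NTM) (t : ℕ) (z z' : M.Zip) : Prop :=
  ∀ b, ∃ b', StepsIn (DetStep M.Step fun _ => True) t (z.cfg b) (z'.cfg b')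

variable {M : NTM} {t u : ℕ} {z z' z'' : M.Zip} {q q' : M.Q} {l r : List M.Γ} {a x : M.Γ}

theorem Runs.refl (z : M.Zip) : M.Runs 0 z z := fun b => ⟨b, .zero _⟩

theorem Runs.trans (h : M.Runs t z z') (h' : M.Runs u z' z'') : M.Runs (t + u) z z'' := by
  intro b
  obtain ⟨b', hb⟩ := h b
  obtain ⟨b'', hb'⟩ := h' b'
  exact ⟨b'', hb.trans hb'⟩

theorem Runs.of_eq (h : M.Runs t z z') (ht : t = u) : M.Runs u z z' := ht ▸ h

theorem init_eq_cfg (M : NTM) (x : List Bool) :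
    M.init x = (Zip.onR M.start [] (x.map fun b => M.sym (some b))).cfg 0 := by
  simp only [init, Zip.cfg, Cfg.mk.injEq, true_and]
  funext i
  unfold tapeOf
  split_ifs with h
  · simp
  · simp only [sub_zero, List.getD_eq_getElem?_getD, List.getElem?_map]
    cases x[i.toNat]? <;> rfl

/-- A singleton set of actions leaves no choice, so the step is forced. All elementary moves below
are instances. -/
theorem runs_of_step {mv : Move} (b : ℤ) (c : M.Cfg)
    (h : M.δ c.state (c.tape c.head) = {(q', x, mv)})
    (h' : (⟨q', c.head + mv.toInt, Function.update c.tape c.head x⟩ : M.Cfg) = z'.cfg b) :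
    ∃ b', StepsIn (DetStep M.Step fun _ => True) 1 c (z'.cfg b') := by
  refine ⟨b, .single ⟨⟨_, by rw [h]; rfl, h'.symm⟩, ?_, trivial⟩⟩
  rintro d ⟨y, hy, rfl⟩
  rw [h] at hy
  obtain rfl := hy
  exact h'

theorem Runs.right (h : M.δ q a = {(q', x, .right)}) :
    M.Runs 1 (.onR q l (a :: r)) (.onR q' (x :: l) r) := fun b =>
  runs_of_step (b + 1) _ (by simpa only [Zip.cfg, tapeOf_right] using h)
    (by simp only [Zip.cfg, tapeOf_update_right, ← tapeOf_shift, Move.toInt])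

theorem Runs.turnLeft (h : M.δ q a = {(q', x, .left)}) :
    M.Runs 1 (.onR q l (a :: r)) (.onL q' l (x :: r)) := fun b =>
  runs_of_step b _ (by simpa only [Zip.cfg, tapeOf_right] using h)
    (by simp only [Zip.cfg, tapeOf_update_right, Move.toInt]; rfl)

theorem Runs.left (h : M.δ q a = {(q', x, .left)}) :
    M.Runs 1 (.onL q (a :: l) r) (.onL q' l (x :: r)) := fun b =>
  runs_of_step (b - 1) _ (by simpa only [Zip.cfg, tapeOf_left] using h)
    (by simp only [Zip.cfg, tapeOf_update_left, ← tapeOf_shift', Move.toInt]; rfl)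

theorem Runs.turnRight (h : M.δ q a = {(q', x, .right)}) :
    M.Runs 1 (.onL q (a :: l) r) (.onR q' (x :: l) r) := fun b =>
  runs_of_step b _ (by simpa only [Zip.cfg, tapeOf_left] using h)
    (by simp only [Zip.cfg, tapeOf_update_left, Move.toInt, sub_add_cancel])

theorem Runs.stay (h : M.δ q a = {(q', x, .stay)}) :
    M.Runs 1 (.onR q l (a :: r)) (.onR q' l (x :: r)) := fun b =>
  runs_of_step b _ (by simpa only [Zip.cfg, tapeOf_right] using h)
    (by simp only [Zip.cfg, tapeOf_update_right, Move.toInt, add_zero])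

theorem Runs.stayLeft (h : M.δ q a = {(q', x, .stay)}) :
    M.Runs 1 (.onL q (a :: l) r) (.onR q' l (x :: r)) := fun b =>
  runs_of_step (b - 1) _ (by simpa only [Zip.cfg, tapeOf_left] using h)
    (by simp only [Zip.cfg, tapeOf_update_left, ← tapeOf_shift', Move.toInt, add_zero])

theorem Zip.cfg_pad_right (b : ℤ) (k : ℕ) :
    (Zip.onR q l (r ++ List.replicate k (M.sym none))).cfg b = (Zip.onR q l r).cfg b := by
  simp only [Zip.cfg, tapeOf_pad_right]

theorem Zip.cfg_pad_left (b : ℤ) (k : ℕ) :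
    (Zip.onL q (l ++ List.replicate k (M.sym none)) r).cfg b = (Zip.onL q l r).cfg b := by
  simp only [Zip.cfg, tapeOf_pad_left]

/-- A sweep to the right over the word `u`. -/
theorem Runs.sweepRight {σ : Type} (st : σ → M.Q) (f : σ → M.Γ → σ × M.Γ) (u : List M.Γ)
    (h : ∀ a ∈ u, ∀ s, M.δ (st s) a = {(st (f s a).1, (f s a).2, .right)}) (s : σ) :
    M.Runs u.length (.onR (st s) l (u ++ r))
      (.onR (st (scan f s u).1) ((scan f s u).2.reverse ++ l) r) := by
  induction u generalizing s l with
  | nil => exact .refl _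
  | cons a u ih =>
    have h1 := (Runs.right (h a (by simp) s)).trans
      (ih (fun a ha => h a (by simp [ha])) (f s a).1 (l := (f s a).2 :: l))
    simpa [scan, add_comm] using h1

/-- A sweep to the left over the word `u`, given in the order in which it is read. -/
theorem Runs.sweepLeft {σ : Type} (st : σ → M.Q) (f : σ → M.Γ → σ × M.Γ) (u : List M.Γ)
    (h : ∀ a ∈ u, ∀ s, M.δ (st s) a = {(st (f s a).1, (f s a).2, .left)}) (s : σ) :
    M.Runs u.length (.onL (st s) (u ++ l) r)
      (.onL (st (scan f s u).1) l ((scan f s u).2.reverse ++ r)) := by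
  induction u generalizing s r with
  | nil => exact .refl _
  | cons a u ih =>
    have h1 := (Runs.left (h a (by simp) s)).trans
      (ih (fun a ha => h a (by simp [ha])) (f s a).1 (r := (f s a).2 :: r))
    simpa [scan, add_comm] using h1

end NTM

/-! ### A machine that accepts the palindromes of low circuit complexity

The machine guesses a program of width `w` and carries it along the input. The program is run on
a binary counter, which yields a bit that is compared with the scanned input symbol. After a pass
from left to right the counter is reset, and the input is compared with the same sequence of bits
from right to left. -/

namespace PalMachine

/-- An instruction: it acts on the front bit of the queue and the accumulator. -/
abbrev Op : Type := Bool → Bool → Bool × Bool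

/-- The role of a cell in the queue: none, a digit of the counter (`some none`), or a
constant. -/
abbrev Kind : Type := Option (Option Bool)

/-- A cell of the program: its instruction and its role, the digit of the counter, the element
of the queue, and the element of the list of pending instructions. -/
@[ext] structure Reg where
  op : Op
  kind : Kind
  dig : Bool
  data : Bool
  cur : Option Op

/-- A tape symbol: the input symbol, two marks, and possibly a cell of the program. -/
@[ext] structure Cell where
  inp : Option Bool
  m₁ : Bool
  m₂ : Bool
  reg : Option Reg

/-- The states, for a machine with thinning factor `b + 1`. The first argument of the states of
the main phase tells whether the pass is from right to left. -/
inductive State (b : ℕ)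
  | guessFirst
  | guessProg (odd : Bool)
  | guessRest (odd : Bool)
  | thinBack
  | thin (s : (Fin (b + 1) × Fin 2) × Bool × Bool)
  | thinDone
  | home (d : Bool)
  | load (d : Bool) (carry : Bool)
  | loadBack (d : Bool)
  | exec (d acc : Bool)
  | toRot (d acc : Bool) (a : Bool)
  | rot (d acc : Bool) (held : Option Op × Bool)
  | shiftRight (held : Reg)
  | turnHome
  | backHome
  | reset
  | toShift
  | shiftLeft
  | shiftLeftHeld (held : Reg)
  | accept

instance : Finite Reg :=
  Finite.of_injective (fun r : Reg => (r.op, r.kind, r.dig, r.data, r.cur)) fun r s h => by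
    simp only [Prod.mk.injEq] at h
    exact Reg.ext h.1 h.2.1 h.2.2.1 h.2.2.2.1 h.2.2.2.2

instance : Finite Cell :=
  Finite.of_injective (fun r : Cell => (r.inp, r.m₁, r.m₂, r.reg)) fun r s h => by
    simp only [Prod.mk.injEq] at h
    exact Cell.ext h.1 h.2.1 h.2.2.1 h.2.2.2

/-- The cell with the input symbol `a` and nothing else. -/
def plain (a : Option Bool) : Cell := ⟨a, false, false, none⟩

/-- The contents of a cell of the program right after the guess. -/
def fresh (s : Op × Kind) : Reg := ⟨s.1, s.2, false, false, none⟩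

/-- Keeps the last of every `b + 1` marks. -/
def thinMark {b : ℕ} (r : Fin (b + 1)) (m : Bool) : Fin (b + 1) × Bool :=
  if m then (if r = Fin.last b then (0, true) else (r + 1, false)) else (r, false)

/-- Thins out both kinds of marks and records which of them were seen. -/
def thinCell {b : ℕ} (s : (Fin (b + 1) × Fin 2) × Bool × Bool) (c : Cell) :
    ((Fin (b + 1) × Fin 2) × Bool × Bool) × Cell :=
  ((((thinMark s.1.1 c.m₁).1, (thinMark s.1.2 c.m₂).1), (s.2.1 || c.m₁, s.2.2 || c.m₂)),
    { c with m₁ := (thinMark s.1.1 c.m₁).2, m₂ := (thinMark s.1.2 c.m₂).2 })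

def clearMarks (c : Cell) : Cell := { c with m₁ := false, m₂ := false }

/-- The initial value of an element of the queue. -/
def initData : Kind → Bool → Bool
  | some none, d => d
  | some (some v), _ => v
  | none, _ => false

/-- Increments a digit of the counter. -/
def incDigit (carry : Bool) (k : Kind) (d : Bool) : Bool × Bool :=
  if k = some none then (carry && d, xor carry d) else (carry, d)

/-- Loads a cell of the program for the next evaluation, and increments the counter. -/
def loadReg (carry : Bool) (r : Reg) : Bool × Reg :=
  ((incDigit carry r.kind r.dig).1,
    { r with dig := (incDigit carry r.kind r.dig).2
             data := initData r.kind r.dig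
             cur := some r.op })

/-- Rotates the queue and shifts the list of pending instructions. -/
def rotReg (held : Option Op × Bool) (r : Reg) : (Option Op × Bool) × Reg :=
  ((r.cur, if r.kind.isSome then r.data else held.2),
    { r with cur := held.1, data := if r.kind.isSome then held.2 else r.data })

def resetReg (r : Reg) : Reg := { r with dig := false }

/-- The guesses of the machine. -/
def guess {b : ℕ} : State b → Cell → Set (State b × Cell × Move)
  | .guessFirst, c => {a | c.inp.isSome ∧ ∃ s : Op × Kind,
      a = (.guessProg true, ⟨c.inp, true, true, some (fresh s)⟩, .right)}
  | .guessProg p, c => {a | c.inp.isSome ∧ ((∃ s : Op × Kind,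
      a = (.guessProg !p, ⟨c.inp, true, true, some (fresh s)⟩, .right)) ∨
      a = (.guessRest !p, ⟨c.inp, true, false, none⟩, .right)) ∨
      c.inp = none ∧ p = false ∧ a = (.thinBack, c, .left)}
  | .guessRest p, c => {a | c.inp.isSome ∧
      a = (.guessRest !p, ⟨c.inp, true, false, none⟩, .right) ∨
      c.inp = none ∧ p = false ∧ a = (.thinBack, c, .left)}
  | _, _ => ∅

/-- The deterministic part of the machine. -/
def det {b : ℕ} : State b → Cell → Option (State b × Cell × Move)
  | .thinBack, c => if c.inp.isSome then some (.thinBack, c, .left)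
      else some (.thin ((0, 0), false, false), c, .right)
  | .thin s, c => if c.inp.isSome then some (.thin (thinCell s c).1, (thinCell s c).2, .right)
      -- The program marks are tested first: they may disappear in the same round as the input
      -- marks.
      else if s.2.2 = false then some (.thinDone, c, .left)
      else if s.2.1 = false then none
      else some (.thinBack, c, .left)
  | .thinDone, c => if c.inp.isSome then some (.thinDone, clearMarks c, .left)
      else some (.home false, c, .right)
  | .home d, c => match c.inp, d with
      | some _, d => some (.load d true, c, .stay)
      | none, false => some (.reset, c, .stay)
      | none, true => some (.accept, c, .stay)
  | .load d carry, c => match c.reg with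
      | some r => some (.load d (loadReg carry r).1,
          { c with reg := some (loadReg carry r).2 }, .right)
      | none => some (.loadBack d, c, .left)
  | .loadBack d, c => if c.reg.isSome then some (.loadBack d, c, .left)
      else some (.exec d false, c, .right)
  | .exec d acc, c => match c.reg with
      | none => none
      | some r => match r.cur with
        | some f => some (.toRot d (f r.data acc).2 (f r.data acc).1, c, .right)
        -- The list of pending instructions is exhausted, so the accumulator holds the result and is
        -- compared with the input.
        | none => if c.inp = some acc then
            if d then some (.toShift, c, .right)
            else some (.shiftRight r, { c with reg := none }, .right)
          else none
  | .toRot d acc a, c => if c.reg.isSome then some (.toRot d acc a, c, .right)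
      else some (.rot d acc (none, a), c, .left)
  | .rot d acc held, c => match c.reg with
      | some r => some (.rot d acc (rotReg held r).1,
          { c with reg := some (rotReg held r).2 }, .left)
      | none => some (.exec d acc, c, .right)
  | .shiftRight held, c => match c.reg with
      | some r => some (.shiftRight r, { c with reg := some held }, .right)
      | none => some (.turnHome, { c with reg := some held }, .right)
  | .turnHome, c => some (.backHome, c, .left)
  | .backHome, c => if c.reg.isSome then some (.backHome, c, .left)
      else some (.home false, c, .right)
  | .reset, c => match c.reg with
      | some r => some (.reset, { c with reg := some (resetReg r) }, .right)
      | none => some (.shiftLeft, c, .left)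
  | .toShift, c => if c.reg.isSome then some (.toShift, c, .right)
      else some (.shiftLeft, c, .left)
  | .shiftLeft, c => match c.reg with
      | some r => some (.shiftLeftHeld r, { c with reg := none }, .left)
      | none => none
  | .shiftLeftHeld held, c => match c.reg with
      | some r => some (.shiftLeftHeld r, { c with reg := some held }, .left)
      | none => some (.home true, { c with reg := some held }, .stay)
  | _, _ => none

end PalMachine

instance (b : ℕ) : Finite (PalMachine.State b) := by
  open PalMachine.State in
  refine Set.finite_univ_iff.mp (Set.Finite.subset
    ((Set.toFinite {guessFirst, thinBack, thinDone, turnHome, backHome, reset, toShift, shiftLeft,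
      accept}) |>.union (Set.finite_range guessProg)
      |>.union (Set.finite_range guessRest)
      |>.union (Set.finite_range thin)
      |>.union (Set.finite_range home)
      |>.union (Set.finite_range fun p : Bool × Bool => load p.1 p.2)
      |>.union (Set.finite_range loadBack)
      |>.union (Set.finite_range fun p : Bool × Bool => exec p.1 p.2)
      |>.union (Set.finite_range fun p : Bool × Bool × Bool => toRot p.1 p.2.1 p.2.2)
      |>.union (Set.finite_range fun p : Bool × Bool × Option PalMachine.Op × Bool =>
        rot p.1 p.2.1 p.2.2)
      |>.union (Set.finite_range shiftRight)
      |>.union (Set.finite_range shiftLeftHeld)) fun s _ => ?_)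
  cases s <;> simp

open PalMachine

/-- The machine with thinning factor `b + 1`. -/
abbrev palNTM (b : ℕ) : NTM where
  Q := State b
  Γ := Cell
  sym := ⟨plain, fun _ _ h => congrArg Cell.inp h⟩
  start := .guessFirst
  accept := {.accept}
  δ q c := guess q c ∪ {a | det q c = some a}

/-! ### Sweeps of the palindrome machine over the program -/

namespace PalMachine

variable {b : ℕ}

/-- The guessing states are disjoint from the states in which `det` is defined, so every step after
the guess is forced. -/
theorem δ_of_det {q : State b} {c : Cell} {a : State b × Cell × Move} (h : det q c = some a) :
    (palNTM b).δ q c = {a} := by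
  have hg : guess q c = ∅ := by
    cases q <;> first | rfl | simp [det] at h
  change guess q c ∪ {a | det q c = some a} = {a}
  rw [hg, h, Set.empty_union]
  ext x
  simp [eq_comm]

/-- The tape segment with input symbols `s` and program cells `rs`. -/
def cells (s : List (Option Bool)) (rs : List Reg) : List Cell :=
  List.zipWith (fun a r => ⟨a, false, false, some r⟩) s rs

theorem cells_reverse {s : List (Option Bool)} {rs : List Reg} (h : s.length = rs.length) :
    (cells s rs).reverse = cells s.reverse rs.reverse :=
  List.reverse_zipWith h

theorem cells_reverse_reverse {s : List (Option Bool)} {rs : List Reg}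
    (h : s.length = rs.length) : (cells s.reverse rs.reverse).reverse = cells s rs := by
  rw [← cells_reverse h, List.reverse_reverse]

theorem cells_append {s s' : List (Option Bool)} {rs rs' : List Reg} (h : s.length = rs.length) :
    cells (s ++ s') (rs ++ rs') = cells s rs ++ cells s' rs' :=
  List.zipWith_append h

open NTM NTM.Zip

/-- The transducer touches only the program cells; the input symbols underneath stay in place. This
lets the program lie on top of the input. -/
theorem sweepRight {σ : Type} (st : σ → State b) (g : σ → Reg → σ × Reg)
    (h : ∀ s a r, det (st s) ⟨a, false, false, some r⟩ =
      some (st (g s r).1, ⟨a, false, false, some (g s r).2⟩, .right))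
    {s : List (Option Bool)} {rs : List Reg} (hs : s.length = rs.length) (q : σ)
    (l r : List Cell) :
    (palNTM b).Runs rs.length (onR (st q) l (cells s rs ++ r))
      (onR (st (scan g q rs).1) ((cells s (scan g q rs).2).reverse ++ l) r) := by
  induction rs generalizing s q l with
  | nil =>
    obtain rfl := List.length_eq_zero_iff.mp hs
    exact .refl _
  | cons r₀ rs ih =>
    obtain _ | ⟨a, s⟩ := s
    · simp at hs
    have h1 := (Runs.right (l := l) (r := cells s rs ++ r) (δ_of_det (h q a r₀))).trans
      (ih (by simpa using hs) (g q r₀).1 (⟨a, false, false, some (g q r₀).2⟩ :: l))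
    simpa [scan, cells, add_comm] using h1

theorem sweepLeft {σ : Type} (st : σ → State b) (g : σ → Reg → σ × Reg)
    (h : ∀ s a r, det (st s) ⟨a, false, false, some r⟩ =
      some (st (g s r).1, ⟨a, false, false, some (g s r).2⟩, .left))
    {s : List (Option Bool)} {rs : List Reg} (hs : s.length = rs.length) (q : σ)
    (l r : List Cell) :
    (palNTM b).Runs rs.length (onL (st q) ((cells s rs).reverse ++ l) r)
      (onL (st (scan g q rs.reverse).1) l (cells s (scan g q rs.reverse).2.reverse ++ r)) := by
  -- The induction follows the order in which the head meets the cells; reversing both lists then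
  -- gives the tape order.
  have key : ∀ (rs : List Reg) (s : List (Option Bool)) (q : σ) (r : List Cell),
      s.length = rs.length → (palNTM b).Runs rs.length (onL (st q) (cells s rs ++ l) r)
      (onL (st (scan g q rs).1) l ((cells s (scan g q rs).2).reverse ++ r)) := by
    intro rs
    induction rs with
    | nil =>
      intro s q r hs
      obtain rfl := List.length_eq_zero_iff.mp hs
      exact .refl _
    | cons r₀ rs ih =>
      intro s q r hs
      obtain _ | ⟨a, s⟩ := s
      · simp at hs
      have h1 := (Runs.left (l := cells s rs ++ l) (r := r) (δ_of_det (h q a r₀))).trans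
        (ih s (g q r₀).1 (⟨a, false, false, some (g q r₀).2⟩ :: r) (by simpa using hs))
      simpa [scan, cells, add_comm] using h1
  have h1 := key rs.reverse s.reverse q r (by simpa using hs)
  rw [← cells_reverse hs, List.length_reverse, cells_reverse (s := s.reverse) (by simpa using hs),
    List.reverse_reverse] at h1
  exact h1

theorem scan_id {A : Type} (u : List A) :
    scan (fun (_ : Unit) a => ((), a)) () u = ((), u) := by
  induction u with
  | nil => rfl
  | cons a u ih => simp [scan, ih]

theorem scan_map {A B : Type} (f : A → B) (u : List A) :
    scan (fun (_ : Unit) a => ((), f a)) () u = ((), u.map f) := by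
  induction u with
  | nil => rfl
  | cons a u ih => simp [scan, ih]

theorem passRight {q : State b}
    (h : ∀ a r, det q ⟨a, false, false, some r⟩ = some (q, ⟨a, false, false, some r⟩, .right))
    {s : List (Option Bool)} {rs : List Reg} (hs : s.length = rs.length) (l r : List Cell) :
    (palNTM b).Runs rs.length (onR q l (cells s rs ++ r))
      (onR q ((cells s rs).reverse ++ l) r) := by
  simpa [scan_id] using sweepRight (fun _ : Unit => q) (fun _ r => ((), r))
    (fun _ a r => h a r) hs () l r

theorem passLeft {q : State b}
    (h : ∀ a r, det q ⟨a, false, false, some r⟩ = some (q, ⟨a, false, false, some r⟩, .left))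
    {s : List (Option Bool)} {rs : List Reg} (hs : s.length = rs.length) (l r : List Cell) :
    (palNTM b).Runs rs.length (onL q ((cells s rs).reverse ++ l) r)
      (onL q l (cells s rs ++ r)) := by
  simpa [scan_id] using sweepLeft (fun _ : Unit => q) (fun _ r => ((), r))
    (fun _ a r => h a r) hs () l r

/-! #### One evaluation of the program -/

def loadAll (rs : List Reg) : List Reg := (scan loadReg true rs).2

def rotAll (held : Option Op × Bool) (rs : List Reg) : List Reg :=
  (scan rotReg held rs.reverse).2.reverse

@[simp] theorem loadAll_length (rs : List Reg) : (loadAll rs).length = rs.length := by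
  simp [loadAll]

@[simp] theorem rotAll_length (held : Option Op × Bool) (rs : List Reg) :
    (rotAll held rs).length = rs.length := by
  simp [rotAll]

/-- The front of the queue. -/
def front : List Reg → Bool
  | [] => false
  | r :: _ => r.data

/-- Executes a list of instructions. -/
def execOps : List Op → List Reg → Bool → List Reg × Bool
  | [], rs, acc => (rs, acc)
  | f :: P, rs, acc => execOps P (rotAll (none, (f (front rs) acc).1) rs) (f (front rs) acc).2

@[simp] theorem execOps_length (P : List Op) (rs : List Reg) (acc : Bool) :
    (execOps P rs acc).1.length = rs.length := by
  induction P generalizing rs acc with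
  | nil => rfl
  | cons f P ih => simp [execOps, ih]

/-- The cells of the program after an evaluation. -/
def next (rs : List Reg) : List Reg := (execOps (rs.map Reg.op) (loadAll rs) false).1

/-- The result of an evaluation. -/
def result (rs : List Reg) : Bool := (execOps (rs.map Reg.op) (loadAll rs) false).2

@[simp] theorem next_length (rs : List Reg) : (next rs).length = rs.length := by
  simp [next]

theorem runs_load (d : Bool) {s : List (Option Bool)} {rs : List Reg} (hs : s.length = rs.length)
    (a c : Option Bool) (l r : List Cell) :
    (palNTM b).Runs (2 * rs.length + 2)
      (onR (.load d true) (plain a :: l) (cells s rs ++ plain c :: r))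
      (onR (.exec d false) (plain a :: l) (cells s (loadAll rs) ++ plain c :: r)) := by
  have h1 := sweepRight (b := b) (fun q => .load d q) loadReg (fun s a r => rfl) hs true
    (plain a :: l) (plain c :: r)
  have h2 := Runs.turnLeft (M := palNTM b) (l := (cells s (loadAll rs)).reverse ++ plain a :: l)
    (r := r) (δ_of_det (q := .load d (scan loadReg true rs).1) (c := plain c) rfl)
  have h3 := passLeft (b := b) (q := .loadBack d) (fun a r => rfl)
    (s := s) (rs := loadAll rs) (by simpa using hs) (plain a :: l) (plain c :: r)
  have h4 := Runs.turnRight (M := palNTM b) (l := l)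
    (r := cells s (loadAll rs) ++ plain c :: r)
    (δ_of_det (q := .loadBack d) (c := plain a) rfl)
  have := ((h1.trans h2).trans h3).trans h4
  rw [loadAll_length] at this
  exact this.of_eq (by ring)

/-- The leftmost cell shows both the next instruction and the front of the queue, so nothing has to
be addressed. The returned bit travels to the right end, and the sweep back hands every pending
instruction, and every element of the queue, on to the left; the executed instruction and the
consumed bit drop out. -/
theorem runs_exec_step (d acc : Bool) {s : List (Option Bool)} {rs : List Reg} {r₀ : Reg}
    {f : Op} (hf : r₀.cur = some f) (hs : s.length = (r₀ :: rs).length)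
    (a c : Option Bool) (l r : List Cell) :
    (palNTM b).Runs (2 * (r₀ :: rs).length + 2)
      (onR (.exec d acc) (plain a :: l) (cells s (r₀ :: rs) ++ plain c :: r))
      (onR (.exec d (f r₀.data acc).2) (plain a :: l)
        (cells s (rotAll (none, (f r₀.data acc).1) (r₀ :: rs)) ++ plain c :: r)) := by
  obtain _ | ⟨e, s⟩ := s
  · simp at hs
  have h1 := Runs.right (M := palNTM b) (l := plain a :: l) (r := cells s rs ++ plain c :: r)
    (δ_of_det (q := .exec d acc) (c := ⟨e, false, false, some r₀⟩)
      (a := (.toRot d (f r₀.data acc).2 (f r₀.data acc).1, ⟨e, false, false, some r₀⟩, .right))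
      (by simp [det, hf]))
  have h2 := passRight (b := b) (q := .toRot d (f r₀.data acc).2 (f r₀.data acc).1)
    (fun a r => rfl) (s := s) (rs := rs) (by simpa using hs)
    (⟨e, false, false, some r₀⟩ :: plain a :: l) (plain c :: r)
  have h3 := Runs.turnLeft (M := palNTM b)
    (l := (cells (e :: s) (r₀ :: rs)).reverse ++ plain a :: l)
    (r := r) (δ_of_det (q := .toRot d (f r₀.data acc).2 (f r₀.data acc).1) (c := plain c) rfl)
  have h4 := sweepLeft (b := b) (fun q => .rot d (f r₀.data acc).2 q) rotReg (fun s a r => rfl)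
    hs (none, (f r₀.data acc).1) (plain a :: l) (plain c :: r)
  have h5 := Runs.turnRight (M := palNTM b) (l := l)
    (r := cells (e :: s) (rotAll (none, (f r₀.data acc).1) (r₀ :: rs)) ++ plain c :: r)
    (δ_of_det (q := .rot d (f r₀.data acc).2
      (scan rotReg (none, (f r₀.data acc).1) (r₀ :: rs).reverse).1) (c := plain a) rfl)
  have h12 := h1.trans h2
  have e1 : (cells s rs).reverse ++ (⟨e, false, false, some r₀⟩ :: plain a :: l) =
      (cells (e :: s) (r₀ :: rs)).reverse ++ plain a :: l := by
    simp [cells]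
  rw [e1] at h12
  have := ((h12.trans h3).trans h4).trans h5
  refine this.of_eq ?_
  simp only [List.length_cons]
  ring

/-- A conservation law: what is put down, followed by what is still held, equals what was held,
followed by what was there. Reading it from the other end shows that the list is shifted by one
place. -/
theorem scan_rotReg_cur (h : Option Op × Bool) (v : List Reg) :
    (scan rotReg h v).2.map Reg.cur ++ [(scan rotReg h v).1.1] = h.1 :: v.map Reg.cur := by
  induction v generalizing h with
  | nil => rfl
  | cons r v ih => simp [scan, ih, rotReg]

theorem rotAll_cur (h : Option Op × Bool) (r : Reg) (rs : List Reg) :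
    (rotAll h (r :: rs)).map Reg.cur = rs.map Reg.cur ++ [h.1] := by
  have h1 := congrArg (fun l => l.reverse.tail) (scan_rotReg_cur h (r :: rs).reverse)
  simpa [rotAll, List.map_reverse] using h1

/-- Each instruction adds one `none` at the right end of the pending list. When only `none` is left,
the state `exec` compares instead of executing, so no counter for the instructions is needed. -/
theorem runs_execOps (d : Bool) {s : List (Option Bool)} (a c : Option Bool) (l r : List Cell)
    (P : List Op) (acc : Bool) (rs : List Reg) (k : ℕ)
    (hs : s.length = rs.length) (hcur : rs.map Reg.cur = P.map some ++ List.replicate k none) :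
    (palNTM b).Runs (P.length * (2 * rs.length + 2))
      (onR (.exec d acc) (plain a :: l) (cells s rs ++ plain c :: r))
      (onR (.exec d (execOps P rs acc).2) (plain a :: l)
        (cells s (execOps P rs acc).1 ++ plain c :: r)) ∧
    (execOps P rs acc).1.map Reg.cur = List.replicate rs.length none := by
  induction P generalizing acc rs k with
  | nil =>
    refine ⟨(Runs.refl _).of_eq (by simp), ?_⟩
    have := congrArg List.length hcur
    simp only [List.map_nil, List.nil_append, List.length_map, List.length_replicate] at this
    simpa [execOps, this] using hcur
  | cons f P ih =>
    obtain _ | ⟨r₀, rs⟩ := rs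
    · simp at hcur
    simp only [List.map_cons, List.cons_append, List.cons.injEq] at hcur
    have h1 := runs_exec_step (b := b) d acc hcur.1 hs a c l r
    obtain ⟨h2, h3⟩ := ih (f r₀.data acc).2 (rotAll (none, (f r₀.data acc).1) (r₀ :: rs)) (k + 1)
      (by simpa using hs) (by
        rw [rotAll_cur, hcur.2, List.append_assoc, ← List.replicate_succ'])
    refine ⟨?_, ?_⟩
    · have := h1.trans h2
      rw [rotAll_length] at this
      refine this.of_eq ?_
      simp only [List.length_cons]
      ring
    · simpa [execOps, front] using h3

theorem loadAll_cur (rs : List Reg) : (loadAll rs).map Reg.cur = (rs.map Reg.op).map some := by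
  have : ∀ c, (scan loadReg c rs).2.map Reg.cur = (rs.map Reg.op).map some := by
    induction rs with
    | nil => intro c; rfl
    | cons r rs ih => intro c; simp only [scan, List.map_cons, ih]; rfl
  exact this true

/-- The program is at the position `|pre|`, where `pre` is the reversed part of the tape to its
left, and `X` the part of the tape from there on. -/
def homeZip (d : Bool) (pre X : List (Option Bool)) (rs : List Reg) : (palNTM b).Zip :=
  onR (.home d : State b) (pre.map plain)
    (cells (X.take rs.length) rs ++ (X.drop rs.length).map plain)

/-- The same, at the end of the evaluation. -/
def evalZip (d acc : Bool) (pre X : List (Option Bool)) (rs : List Reg) : (palNTM b).Zip :=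
  onR (.exec d acc : State b) (pre.map plain)
    (cells (X.take rs.length) rs ++ (X.drop rs.length).map plain)

/-- The sweeps turn on the plain cell `a` to the left and on the plain cell that `hX` provides to
the right of the program. The quadratic term is one pair of sweeps for each instruction. -/
theorem runs_eval (d v : Bool) (a : Option Bool) (pre X : List (Option Bool)) {rs : List Reg}
    (hrs : rs ≠ []) (hX : rs.length ≤ X.length) :
    (palNTM b).Runs (1 + (2 * rs.length + 2) + rs.length * (2 * rs.length + 2))
      (homeZip d (a :: pre) (some v :: X) rs)
      (evalZip d (result rs) (a :: pre) (some v :: X) (next rs)) ∧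
    (next rs).map Reg.cur = List.replicate rs.length none := by
  obtain ⟨c, r, hc⟩ : ∃ c r, (some v :: X).drop rs.length = c :: r := by
    cases h : (some v :: X).drop rs.length with
    | nil =>
      have := List.drop_eq_nil_iff.mp h
      simp only [List.length_cons] at this
      omega
    | cons c r => exact ⟨c, r, rfl⟩
  have hs : ((some v :: X).take rs.length).length = rs.length := by
    rw [List.length_take, List.length_cons]
    omega
  unfold homeZip evalZip
  rw [next_length, hc]
  generalize hS : (some v :: X).take rs.length = s at hs ⊢
  have h1 : (palNTM b).Runs 1
      (onR (.home d) ((a :: pre).map plain) (cells s rs ++ (c :: r).map plain))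
      (onR (.load d true) ((a :: pre).map plain) (cells s rs ++ (c :: r).map plain)) := by
    obtain ⟨r₀, rs, rfl⟩ := List.exists_cons_of_ne_nil hrs
    obtain ⟨s, rfl⟩ : ∃ s', s = some v :: s' := ⟨_, by rw [← hS, List.length_cons]; rfl⟩
    exact Runs.stay (δ_of_det rfl)
  have h2 := runs_load (b := b) d hs a c (pre.map plain) (r.map plain)
  obtain ⟨h3, h4⟩ := runs_execOps (b := b) d (s := s) a c (pre.map plain) (r.map plain)
    (rs.map Reg.op) false (loadAll rs) 0 (by simpa using hs) (by simpa using loadAll_cur rs)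
  rw [loadAll_length] at h4
  refine ⟨?_, h4⟩
  rw [List.length_map, loadAll_length] at h3
  exact (h1.trans h2).trans h3

/-! #### Moving the program -/

theorem runs_shiftRight (c : Option Bool) (r : List Cell) (rs : List Reg) :
    ∀ (s : List (Option Bool)) (held : Reg) (l : List Cell), s.length = rs.length →
    (palNTM b).Runs (rs.length + 1) (onR (.shiftRight held) l (cells s rs ++ plain c :: r))
      (onR .turnHome ((cells (s ++ [c]) (held :: rs)).reverse ++ l) r) := by
  induction rs with
  | nil =>
    intro s held l hs
    obtain rfl := List.length_eq_zero_iff.mp hs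
    exact Runs.right (δ_of_det rfl)
  | cons r₀ rs ih =>
    intro s held l hs
    obtain _ | ⟨a, s⟩ := s
    · simp at hs
    have h1 := (Runs.right (M := palNTM b) (l := l) (r := cells s rs ++ plain c :: r)
      (δ_of_det (q := .shiftRight held) (c := ⟨a, false, false, some r₀⟩) rfl)).trans
      (ih s r₀ (⟨a, false, false, some held⟩ :: l) (by simpa using hs))
    simpa [cells, add_comm] using h1

theorem runs_shiftLeft (c : Option Bool) (l : List Cell) (rs : List Reg) :
    ∀ (s : List (Option Bool)) (held : Reg) (r : List Cell), s.length = rs.length →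
    (palNTM b).Runs (rs.length + 1) (onL (.shiftLeftHeld held) (cells s rs ++ plain c :: l) r)
      (onR (.home true) l ((cells (s ++ [c]) (held :: rs)).reverse ++ r)) := by
  induction rs with
  | nil =>
    intro s held r hs
    obtain rfl := List.length_eq_zero_iff.mp hs
    exact Runs.stayLeft (δ_of_det rfl)
  | cons r₀ rs ih =>
    intro s held r hs
    obtain _ | ⟨a, s⟩ := s
    · simp at hs
    have h1 := (Runs.left (M := palNTM b) (l := cells s rs ++ plain c :: l) (r := r)
      (δ_of_det (q := .shiftLeftHeld held) (c := ⟨a, false, false, some r₀⟩) rfl)).trans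
      (ih s r₀ (⟨a, false, false, some held⟩ :: r) (by simpa using hs))
    simpa [cells, add_comm] using h1

/-- From the cell to the right of the program, the program is moved to the left. -/
theorem runs_moveLeft (c : Option Bool) (l r : List Cell) {s : List (Option Bool)} {rs : List Reg}
    (e : Option Bool) (hs : (s ++ [e]).length = rs.length) :
    (palNTM b).Runs (rs.length + 1)
      (onL .shiftLeft ((cells (s ++ [e]) rs).reverse ++ plain c :: l) r)
      (onR (.home true) l (cells (c :: s) rs ++ plain e :: r)) := by
  obtain ⟨rs, r₀, rfl⟩ : ∃ rs' r₀, rs = rs' ++ [r₀] := by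
    rcases List.eq_nil_or_concat' rs with rfl | ⟨rs', r₀, h⟩
    · simp at hs
    · exact ⟨rs', r₀, h⟩
  have hs' : s.length = rs.length := by simpa using hs
  rw [cells_append hs', List.reverse_append, cells_reverse hs']
  have h1 := Runs.left (M := palNTM b) (l := cells s.reverse rs.reverse ++ plain c :: l) (r := r)
    (δ_of_det (q := .shiftLeft) (c := ⟨e, false, false, some r₀⟩) rfl)
  have h2 := runs_shiftLeft (b := b) c l rs.reverse s.reverse r₀ (plain e :: r) (by simpa using hs')
  have e1 : (cells (s.reverse ++ [c]) (r₀ :: rs.reverse)).reverse =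
      cells (c :: s) (rs ++ [r₀]) := by
    have := cells_reverse_reverse (s := c :: s) (rs := rs ++ [r₀]) (by simpa using hs')
    simpa using this
  rw [e1] at h2
  have := h1.trans h2
  refine this.of_eq ?_
  simp only [List.length_append, List.length_reverse, List.length_singleton]
  ring

/-- The program moves by handing each register through the finite control to the right neighbour.
The bound on `X` is strict because the head overshoots the moved program by one cell before it
returns. -/
theorem runs_forward {v : Bool} (a : Option Bool) (pre X : List (Option Bool)) {rs : List Reg}
    (hrs : rs ≠ []) (hX : rs.length < X.length)
    (hcur : rs.map Reg.cur = List.replicate rs.length none) :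
    (palNTM b).Runs (2 * rs.length + 3) (evalZip false v (a :: pre) (some v :: X) rs)
      (homeZip false (some v :: a :: pre) X rs) := by
  obtain ⟨r₀, rs, rfl⟩ := List.exists_cons_of_ne_nil hrs
  simp only [List.map_cons, List.length_cons, List.replicate_succ, List.cons.injEq] at hcur
  obtain ⟨hcur, -⟩ := hcur
  unfold homeZip evalZip
  simp only [List.length_cons] at hX ⊢
  rw [List.take_succ_cons, List.drop_succ_cons]
  obtain ⟨c, e, r, hc⟩ : ∃ c e r, X.drop rs.length = c :: e :: r := by
    cases h : X.drop rs.length with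
    | nil =>
      have := List.drop_eq_nil_iff.mp h
      omega
    | cons c r =>
      cases r with
      | nil =>
        have := congrArg List.length h
        simp only [List.length_drop, List.length_singleton] at this
        omega
      | cons e r => exact ⟨c, e, r, rfl⟩
  have ht : X.take (rs.length + 1) = X.take rs.length ++ [c] := by
    rw [List.take_add, hc]; rfl
  have hd : X.drop (rs.length + 1) = e :: r := by
    rw [← List.drop_drop, hc]; rfl
  have hs : (X.take rs.length).length = rs.length := by
    rw [List.length_take]; omega
  rw [ht, hd, hc]
  generalize X.take rs.length = s at hs ⊢
  have h1 := Runs.right (M := palNTM b) (l := (a :: pre).map plain)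
    (r := cells s rs ++ (c :: e :: r).map plain)
    (δ_of_det (q := .exec false v) (c := ⟨some v, false, false, some r₀⟩)
      (a := (.shiftRight r₀, plain (some v), .right)) (by simp [det, hcur, plain]))
  have h2 := runs_shiftRight (b := b) c ((e :: r).map plain) rs s r₀
    (plain (some v) :: (a :: pre).map plain) hs
  have h3 := Runs.turnLeft (M := palNTM b)
    (l := (cells (s ++ [c]) (r₀ :: rs)).reverse ++ plain (some v) :: (a :: pre).map plain)
    (r := r.map plain) (δ_of_det (q := .turnHome) (c := plain e) rfl)
  have h4 := passLeft (b := b) (q := .backHome) (fun a r => rfl) (s := s ++ [c]) (rs := r₀ :: rs)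
    (by simpa using hs) (plain (some v) :: (a :: pre).map plain) ((e :: r).map plain)
  have h5 := Runs.turnRight (M := palNTM b) (l := (a :: pre).map plain)
    (r := cells (s ++ [c]) (r₀ :: rs) ++ (e :: r).map plain)
    (δ_of_det (q := .backHome) (c := plain (some v)) rfl)
  have := (((h1.trans h2).trans h3).trans h4).trans h5
  refine this.of_eq ?_
  simp only [List.length_cons]
  ring

theorem take_drop_shape (X : List (Option Bool)) {k : ℕ} (hX : k + 1 < X.length) :
    ∃ s e c r, X.take (k + 1) = s ++ [e] ∧ X.drop (k + 1) = c :: r ∧ s = X.take k ∧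
      X.drop k = e :: c :: r := by
  refine ⟨X.take k, X[k], X[k + 1], X.drop (k + 2), ?_, ?_, rfl, ?_⟩
  · rw [List.take_succ_eq_append_getElem]
  · rw [List.drop_eq_getElem_cons]
  · rw [List.drop_eq_getElem_cons, List.drop_eq_getElem_cons]

theorem runs_backward {v : Bool} (a : Option Bool) (pre X : List (Option Bool)) {rs : List Reg}
    (hrs : rs ≠ []) (hX : rs.length ≤ X.length)
    (hcur : rs.map Reg.cur = List.replicate rs.length none) :
    (palNTM b).Runs (2 * rs.length + 2) (evalZip true v (a :: pre) (some v :: X) rs)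
      (homeZip true pre (a :: some v :: X) rs) := by
  obtain ⟨r₀, rs, rfl⟩ := List.exists_cons_of_ne_nil hrs
  simp only [List.map_cons, List.length_cons, List.replicate_succ, List.cons.injEq] at hcur
  obtain ⟨hcur, -⟩ := hcur
  unfold homeZip evalZip
  simp only [List.length_cons] at hX ⊢
  obtain ⟨s, e, c, r, h1, h2, h3, h4⟩ := take_drop_shape (some v :: X) (k := rs.length)
    (by simp only [List.length_cons]; omega)
  rw [h1, h2, List.take_succ_cons (a := a), List.drop_succ_cons (a := a), ← h3, h4]
  have hs : (s ++ [e]).length = rs.length + 1 := by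
    rw [← h1, List.length_take, List.length_cons]; omega
  obtain ⟨s', hs'⟩ : ∃ s', s ++ [e] = some v :: s' := ⟨X.take rs.length, by rw [← h1]; rfl⟩
  have g1 := Runs.right (M := palNTM b) (l := (a :: pre).map plain)
    (r := cells s' rs ++ (c :: r).map plain)
    (δ_of_det (q := .exec true v) (c := ⟨some v, false, false, some r₀⟩)
      (a := (.toShift, ⟨some v, false, false, some r₀⟩, .right)) (by simp [det, hcur]))
  have g2 := passRight (b := b) (q := .toShift) (fun a r => rfl) (s := s') (rs := rs)
    (by rw [hs'] at hs; simpa using hs) (⟨some v, false, false, some r₀⟩ :: (a :: pre).map plain)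
    ((c :: r).map plain)
  have g3 := Runs.turnLeft (M := palNTM b)
    (l := (cells (s ++ [e]) (r₀ :: rs)).reverse ++ (a :: pre).map plain)
    (r := r.map plain) (δ_of_det (q := .toShift) (c := plain c) rfl)
  have g4 := runs_moveLeft (b := b) a (pre.map plain) ((c :: r).map plain) e (s := s)
    (rs := r₀ :: rs) hs
  have g12 := g1.trans g2
  have e1 : (cells s' rs).reverse ++ (⟨some v, false, false, some r₀⟩ :: (a :: pre).map plain) =
      (cells (s ++ [e]) (r₀ :: rs)).reverse ++ (a :: pre).map plain := by
    rw [hs']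
    simp [cells]
  have e2 : cells (s ++ [e]) (r₀ :: rs) = ⟨some v, false, false, some r₀⟩ :: cells s' rs := by
    rw [hs']; rfl
  rw [e1] at g12
  have := (g12.trans g3).trans g4
  rw [e2]
  refine this.of_eq ?_
  simp only [List.length_cons]
  ring

/-- The blank behind the input triggers the turn. The return pass starts on the last input symbol
`a` with all digits of the counter cleared. -/
theorem runs_turn (a : Option Bool) (pre X : List (Option Bool)) {rs : List Reg}
    (hrs : rs ≠ []) (hX : rs.length ≤ X.length) :
    (palNTM b).Runs (2 * rs.length + 3) (homeZip false (a :: pre) (none :: X) rs)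
      (homeZip true pre (a :: none :: X) (rs.map resetReg)) := by
  unfold homeZip
  rw [List.length_map]
  obtain ⟨k, hk⟩ := Nat.exists_eq_add_of_lt (List.length_pos_iff.mpr hrs)
  rw [zero_add] at hk
  rw [hk]
  obtain ⟨s, e, c, r, h1, h2, h3, h4⟩ := take_drop_shape (none :: X) (k := k)
    (by simp only [List.length_cons]; omega)
  have hs : (s ++ [e]).length = rs.length := by
    rw [← h1, List.length_take, List.length_cons]; omega
  have h0 : (palNTM b).Runs 1
      (onR (.home false) ((a :: pre).map plain) (cells (s ++ [e]) rs ++ (c :: r).map plain))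
      (onR .reset ((a :: pre).map plain) (cells (s ++ [e]) rs ++ (c :: r).map plain)) := by
    obtain ⟨r₀, rs, rfl⟩ := List.exists_cons_of_ne_nil hrs
    obtain ⟨s', hs'⟩ : ∃ s', s ++ [e] = none :: s' := ⟨X.take k, by rw [← h1]; rfl⟩
    rw [hs']
    exact Runs.stay (δ_of_det rfl)
  have g1 := sweepRight (b := b) (fun _ : Unit => .reset) (fun _ r => ((), resetReg r))
    (fun _ a r => rfl) hs () ((a :: pre).map plain) ((c :: r).map plain)
  rw [scan_map] at g1
  have g3 := Runs.turnLeft (M := palNTM b)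
    (l := (cells (s ++ [e]) (rs.map resetReg)).reverse ++ (a :: pre).map plain)
    (r := r.map plain) (δ_of_det (q := .reset) (c := plain c) rfl)
  have g4 := runs_moveLeft (b := b) a (pre.map plain) ((c :: r).map plain) e (s := s)
    (rs := rs.map resetReg) (by simpa using hs)
  rw [h1, h2, List.take_succ_cons (a := a), List.drop_succ_cons (a := a), ← h3, h4]
  have := ((h0.trans g1).trans g3).trans g4
  refine this.of_eq ?_
  simp only [List.length_map]
  omega

end PalMachine

/-! ### Verdicts reached by forced runs -/

namespace NTM

/-- From `z`, the machine is forced to halt within `T` steps, and it accepts iff `p` holds. -/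
def Settles (M : NTM) (T : ℕ) (z : M.Zip) (p : Prop) : Prop :=
  ∃ t ≤ T, ∃ z', M.Runs t z z' ∧ (∀ b e, ¬ M.Step (z'.cfg b) e) ∧
    ∀ b, (z'.cfg b).state ∈ M.accept ↔ p

theorem Runs.settles {M : NTM} {t T U : ℕ} {z z' : M.Zip} {p q : Prop} (h : M.Runs t z z')
    (h' : M.Settles T z' p) (hT : t + T ≤ U) (hpq : p ↔ q) : M.Settles U z q := by
  obtain ⟨u, hu, z'', hr, hh, ha⟩ := h'
  exact ⟨t + u, by omega, z'', h.trans hr, hh, fun b => (ha b).trans hpq⟩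

end NTM

/-! ### The two passes over the input -/

namespace PalMachine

open NTM NTM.Zip

variable {b : ℕ}

/-- The successive results of the program. -/
def results : ℕ → List Reg → List Bool
  | 0, _ => []
  | n + 1, rs => result rs :: results n (next rs)

theorem settles_onR {q : State b} {c : Cell} (l r : List Cell) (hg : guess q c = ∅)
    (hd : det q c = none) :
    (palNTM b).Settles 0 (onR q l (c :: r)) (q ∈ (palNTM b).accept) := by
  refine ⟨0, le_rfl, _, .refl _, ?_, fun b => Iff.rfl⟩
  rintro b' e ⟨a, ha, -⟩
  simp only [Zip.cfg, tapeOf_right] at ha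
  change a ∈ guess q c ∪ {a | det q c = some a} at ha
  simp [hg, hd] at ha

theorem settles_mismatch (d : Bool) {v acc : Bool} (hv : acc ≠ v) (pre X : List (Option Bool))
    {rs : List Reg} (hrs : rs ≠ []) (hcur : rs.map Reg.cur = List.replicate rs.length none) :
    (palNTM b).Settles 0 (evalZip d acc pre (some v :: X) rs) False := by
  obtain ⟨r₀, rs, rfl⟩ := List.exists_cons_of_ne_nil hrs
  simp only [List.map_cons, List.length_cons, List.replicate_succ, List.cons.injEq] at hcur
  have := settles_onR (b := b) (q := .exec d acc) (c := ⟨some v, false, false, some r₀⟩)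
    (pre.map plain) (cells (X.take rs.length) rs ++ (X.drop rs.length).map plain) rfl
    (by simp [det, hcur.1, hv.symm])
  exact (Runs.refl _).settles this le_rfl (by simp)

/-- A bound for the time that is spent at one position. -/
def blockTime (w : ℕ) : ℕ := 1 + (2 * w + 2) + w * (2 * w + 2) + (2 * w + 3)

theorem next_ne_nil {rs : List Reg} (hrs : rs ≠ []) : next rs ≠ [] := by
  rw [← List.length_pos_iff] at hrs ⊢
  simpa using hrs

/-- The list `y` holds the unread symbols to the left, the nearest first, and the blank in front of
the input is reached only if every comparison has succeeded. The summand `1` pays for the step into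
the accepting state. -/
theorem settles_backward (y : List Bool) (v : Bool) (X : List (Option Bool)) (rs : List Reg)
    (hrs : rs ≠ []) (hX : rs.length ≤ X.length) :
    (palNTM b).Settles ((y.length + 1) * blockTime rs.length + 1)
      (homeZip true (y.map some ++ [none]) (some v :: X) rs)
      (v :: y = results (y.length + 1) rs) := by
  induction y generalizing v X rs with
  | nil =>
    obtain ⟨h1, h2⟩ := runs_eval (b := b) true v none [] X hrs hX
    rcases eq_or_ne (result rs) v with hv | hv
    · rw [hv] at h1
      have h3 := runs_backward (b := b) (v := v) none [] X (next_ne_nil hrs) (by simpa using hX)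
        (by simpa using h2)
      rw [next_length] at h3
      obtain ⟨r₀, rs', hr⟩ := List.exists_cons_of_ne_nil (next_ne_nil hrs)
      have h4 : (palNTM b).Runs 1 (homeZip true [] (none :: some v :: X) (next rs))
          (onR .accept [] (cells ((none :: some v :: X).take (next rs).length) (next rs) ++
            ((none :: some v :: X).drop (next rs).length).map plain)) := by
        unfold homeZip
        rw [hr]
        exact Runs.stay (δ_of_det rfl)
      rw [hr] at h1 h3 h4
      refine ((h1.trans h3).trans h4).settles
        (settles_onR (b := b) (q := .accept) _ _ rfl rfl) ?_ ?_
      · simp only [blockTime, List.length_nil]; omega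
      · simp [results, hv]
    · refine h1.settles (settles_mismatch true hv _ _ (next_ne_nil hrs) (by simpa using h2)) ?_ ?_
      · simp only [blockTime, List.length_nil]; omega
      · simp [results, hv.symm]
  | cons v' y ih =>
    obtain ⟨h1, h2⟩ := runs_eval (b := b) true v (some v') (y.map some ++ [none]) X hrs hX
    rcases eq_or_ne (result rs) v with hv | hv
    · rw [hv] at h1
      have h3 := runs_backward (b := b) (v := v) (some v') (y.map some ++ [none]) X
        (next_ne_nil hrs) (by simpa using hX) (by simpa using h2)
      have h4 := ih v' (some v :: X) (next rs) (next_ne_nil hrs) (by simp; omega)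
      rw [next_length] at h3 h4
      refine (h1.trans h3).settles h4 ?_ ?_
      · simp only [blockTime, List.length_cons]; ring_nf; omega
      · simp [results, hv]
    · refine h1.settles (settles_mismatch true hv _ _ (next_ne_nil hrs) (by simpa using h2)) ?_ ?_
      · simp only [blockTime, List.length_cons]; ring_nf; omega
      · simp [results, hv.symm]

/-- Here `z` is unread and `y` has been read, in reverse order, so `z.reverse ++ y` is the reversed
input throughout the induction: it is what the return pass must find. Unread symbols are charged
twice, once for each direction, and read ones once. -/
theorem settles_forward (z y : List Bool) (rs : List Reg) (k : ℕ)
    (hrs : rs ≠ []) (hk : rs.length < k) (hzy : z.length + y.length ≠ 0) :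
    (palNTM b).Settles ((2 * z.length + y.length) * blockTime rs.length + (2 * rs.length + 4))
      (homeZip false (y.map some ++ [none]) (z.map some ++ List.replicate k none) rs)
      (z = results z.length rs ∧ z.reverse ++ y =
        results (z.length + y.length) ((next^[z.length] rs).map resetReg)) := by
  induction z generalizing y rs with
  | nil =>
    obtain _ | ⟨v, y⟩ := y
    · simp at hzy
    obtain ⟨k, rfl⟩ : ∃ k', k = k' + 1 := ⟨k - 1, by omega⟩
    have h1 := runs_turn (b := b) (some v) (y.map some ++ [none]) (List.replicate k none)
      hrs (by simp; omega)
    have h2 := settles_backward (b := b) y v (none :: List.replicate k none) (rs.map resetReg)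
      (by simpa using hrs) (by simp; omega)
    rw [List.length_map] at h2
    refine h1.settles h2 ?_ ?_
    · simp only [List.length_cons, List.length_nil]; ring_nf; omega
    · simp [results]
  | cons v z ih =>
    obtain ⟨a, pre, hpre⟩ : ∃ a pre, y.map some ++ [none] = a :: pre := by
      cases y with
      | nil => exact ⟨_, _, rfl⟩
      | cons v y => exact ⟨_, _, rfl⟩
    have hl : rs.length < (z.map some ++ List.replicate k none).length := by simp; omega
    obtain ⟨h1, h2⟩ := runs_eval (b := b) false v a pre (z.map some ++ List.replicate k none)
      hrs hl.le
    rw [hpre]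
    rcases eq_or_ne (result rs) v with hv | hv
    · rw [hv] at h1
      have h3 := runs_forward (b := b) (v := v) a pre (z.map some ++ List.replicate k none)
        (next_ne_nil hrs) (by simpa using hl) (by simpa using h2)
      have h4 := ih (v :: y) (next rs) (next_ne_nil hrs) (by simpa using hk) (by simp)
      rw [next_length] at h3 h4
      rw [List.map_cons, List.cons_append, hpre] at h4
      refine (h1.trans h3).settles h4 ?_ ?_
      · simp only [blockTime, List.length_cons]; ring_nf; omega
      · simp [results, hv, add_assoc, add_comm 1]
    · refine h1.settles (settles_mismatch false hv _ _ (next_ne_nil hrs) (by simpa using h2)) ?_ ?_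
      · simp only [blockTime, List.length_cons]; ring_nf; omega
      · simp [results, hv.symm]

/-! #### The counter is all that changes -/

/-- The part of a cell that matters between two evaluations. -/
def core (r : Reg) : Op × Kind × Bool := (r.op, r.kind, r.dig)

theorem loadReg_congr {r r' : Reg} (h : core r = core r') (c : Bool) :
    loadReg c r = loadReg c r' := by
  obtain ⟨o, k, d, e, u⟩ := r
  obtain ⟨o', k', d', e', u'⟩ := r'
  simp only [core, Prod.mk.injEq] at h
  obtain ⟨rfl, rfl, rfl⟩ := h
  rfl

theorem loadAll_congr {rs rs' : List Reg} (h : rs.map core = rs'.map core) :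
    loadAll rs = loadAll rs' := by
  have : ∀ c, scan loadReg c rs = scan loadReg c rs' := by
    induction rs generalizing rs' with
    | nil =>
      obtain rfl : rs' = [] := by simpa using h.symm
      exact fun _ => rfl
    | cons r rs ih =>
      obtain _ | ⟨r', rs'⟩ := rs'
      · simp at h
      simp only [List.map_cons, List.cons.injEq] at h
      intro c
      simp only [scan, loadReg_congr h.1, ih h.2]
  rw [loadAll, loadAll, this]

theorem rotAll_map {A : Type} (f : Reg → A) (hf : ∀ h r, f (rotReg h r).2 = f r)
    (h : Option Op × Bool) (rs : List Reg) : (rotAll h rs).map f = rs.map f := by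
  have : ∀ v h, (scan rotReg h v).2.map f = v.map f := by
    intro v
    induction v with
    | nil => exact fun _ => rfl
    | cons r v ih => intro h; simp only [scan, List.map_cons, ih, hf]
  rw [rotAll, List.map_reverse, this, List.map_reverse, List.reverse_reverse]

theorem execOps_map {A : Type} (f : Reg → A) (hf : ∀ h r, f (rotReg h r).2 = f r)
    (P : List Op) (rs : List Reg) (acc : Bool) : (execOps P rs acc).1.map f = rs.map f := by
  induction P generalizing rs acc with
  | nil => rfl
  | cons o P ih => rw [execOps, ih, rotAll_map f hf]

theorem op_congr {rs rs' : List Reg} (h : rs.map core = rs'.map core) :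
    rs.map Reg.op = rs'.map Reg.op := by
  have := congrArg (List.map Prod.fst) h
  simpa [core, Function.comp_def] using this

theorem next_congr {rs rs' : List Reg} (h : rs.map core = rs'.map core) : next rs = next rs' := by
  rw [next, next, loadAll_congr h, op_congr h]

theorem result_congr {rs rs' : List Reg} (h : rs.map core = rs'.map core) :
    result rs = result rs' := by
  rw [result, result, loadAll_congr h, op_congr h]

theorem results_congr (n : ℕ) {rs rs' : List Reg} (h : rs.map core = rs'.map core) :
    results n rs = results n rs' := by
  cases n with
  | zero => rfl
  | succ n => rw [results, results, result_congr h, next_congr h]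

theorem scan_loadReg_map {A : Type} (f : Reg → A) (hf : ∀ c r, f (loadReg c r).2 = f r)
    (c : Bool) (rs : List Reg) : (scan loadReg c rs).2.map f = rs.map f := by
  induction rs generalizing c with
  | nil => rfl
  | cons r rs ih => simp only [scan, List.map_cons, ih, hf]

/-- Evaluations change neither instructions nor roles, and the scratch data are overwritten by the
next load. Clearing the digits therefore restores the guessed program, and both passes compare with
the same sequence. -/
theorem reset_iterate_core (n : ℕ) (S : List (Op × Kind)) :
    ((next^[n] (S.map fresh)).map resetReg).map core = (S.map fresh).map core := by
  have h1 : ∀ rs, (next rs).map (fun r => (r.op, r.kind)) = rs.map fun r => (r.op, r.kind) := by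
    intro rs
    rw [next, execOps_map _ (fun _ _ => rfl), loadAll, scan_loadReg_map _ (fun _ _ => rfl)]
  have h2 : (next^[n] (S.map fresh)).map (fun r => (r.op, r.kind)) = S := by
    induction n with
    | zero => simp [fresh, Function.comp_def]
    | succ n ih => rw [Function.iterate_succ_apply', h1, ih]
  calc ((next^[n] (S.map fresh)).map resetReg).map core
      = ((next^[n] (S.map fresh)).map fun r => (r.op, r.kind)).map fun s => (s.1, s.2, false) := by
        simp [core, resetReg, Function.comp_def]
    _ = (S.map fresh).map core := by
        rw [h2]; simp [core, fresh, Function.comp_def]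

theorem settles_main (x : List Bool) (S : List (Op × Kind)) (hx : x ≠ []) (hS : S ≠ []) :
    (palNTM b).Settles (2 * x.length * blockTime S.length + (2 * S.length + 4))
      (homeZip false [none] (x.map some ++ List.replicate (S.length + 2) none) (S.map fresh))
      (x = results x.length (S.map fresh) ∧ x.reverse = results x.length (S.map fresh)) := by
  have h := settles_forward (b := b) x [] (S.map fresh) (S.length + 2) (by simpa using hS)
    (by simp) (by simpa using hx)
  refine (Runs.refl _).settles h (by simp) ?_
  rw [List.append_nil, List.length_nil, add_zero,
    results_congr x.length (reset_iterate_core x.length S)]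

/-! #### Thinning out the marks -/

/-- The state `r` counts the marks dropped since the last one that was kept, so it enters the
quotient as a credit. -/
theorem count_thinMark (r : Fin (b + 1)) (ms : List Bool) :
    (scan thinMark r ms).2.count true = (r + ms.count true) / (b + 1) := by
  induction ms generalizing r with
  | nil => simp [scan, Nat.div_eq_of_lt r.isLt]
  | cons m ms ih =>
    simp only [scan]
    cases m with
    | false => simp [thinMark, ih]
    | true =>
      rcases eq_or_ne r (Fin.last b) with rfl | hr
      · simp only [thinMark, if_true, List.count_cons_self, ih, Fin.val_last, Fin.val_zero]
        rw [show b + (ms.count true + 1) = (0 + ms.count true) + (b + 1) by ring,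
          Nat.add_div_right _ (Nat.succ_pos b)]
      · have h1 : ((r + 1 : Fin (b + 1)) : ℕ) = r + 1 :=
          Fin.val_add_one_of_lt (Fin.lt_last_iff_ne_last.mpr hr)
        simp only [thinMark, if_true, hr, if_false, List.count_cons_self]
        rw [List.count_cons_of_ne (by simp), ih, h1]
        congr 1
        ring

theorem thin_m₁ (s : (Fin (b + 1) × Fin 2) × Bool × Bool) (u : List Cell) :
    (scan thinCell s u).2.map Cell.m₁ = (scan thinMark s.1.1 (u.map Cell.m₁)).2 := by
  induction u generalizing s with
  | nil => rfl
  | cons c u ih => simp only [scan, List.map_cons, ih]; rfl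

theorem thin_m₂ (s : (Fin (b + 1) × Fin 2) × Bool × Bool) (u : List Cell) :
    (scan thinCell s u).2.map Cell.m₂ = (scan thinMark s.1.2 (u.map Cell.m₂)).2 := by
  induction u generalizing s with
  | nil => rfl
  | cons c u ih => simp only [scan, List.map_cons, ih]; rfl

theorem thin_seen (s : (Fin (b + 1) × Fin 2) × Bool × Bool) (u : List Cell) :
    (scan thinCell s u).1.2 = (s.2.1 || decide (0 < (u.map Cell.m₁).count true),
      s.2.2 || decide (0 < (u.map Cell.m₂).count true)) := by
  induction u generalizing s with
  | nil => simp [scan]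
  | cons c u ih =>
    simp only [scan, ih, thinCell, List.map_cons, Prod.mk.injEq]
    constructor
    · cases h : c.m₁ <;> simp
    · cases h : c.m₂ <;> simp

theorem thin_map {A : Type} (f : Cell → A) (hf : ∀ (s : (Fin (b + 1) × Fin 2) × Bool × Bool) c,
    f (thinCell s c).2 = f c) (s : (Fin (b + 1) × Fin 2) × Bool × Bool) (u : List Cell) :
    (scan thinCell s u).2.map f = u.map f := by
  induction u generalizing s with
  | nil => rfl
  | cons c u ih => simp only [scan, List.map_cons, ih, hf]

/-- The start of a round in which the marks of the word `u` are thinned out. -/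
def thinZip (u : List Cell) : (palNTM b).Zip :=
  onR (.thin ((0, 0), false, false) : State b) [plain none] (u ++ [plain none])

/-- The marks have been removed. -/
def startZip (u : List Cell) : (palNTM b).Zip :=
  onR (.home false : State b) [plain none] (u.map clearMarks ++ [plain none])

theorem runs_thinBack {u : List Cell} (hu : ∀ c ∈ u, c.inp.isSome) :
    (palNTM b).Runs (u.length + 1) (onL .thinBack (u.reverse ++ [plain none]) [plain none])
      (thinZip u) := by
  have h1 := Runs.sweepLeft (M := palNTM b) (l := [plain none]) (r := [plain none])
    (fun _ : Unit => .thinBack) (fun _ c => ((), c)) u.reverse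
    (fun c hc _ => δ_of_det (by simp [det, hu c (by simpa using hc)])) ()
  rw [scan_id, List.reverse_reverse, List.length_reverse] at h1
  exact h1.trans (Runs.turnRight (δ_of_det rfl))

theorem runs_thin_sweep {u : List Cell} (hu : ∀ c ∈ u, c.inp.isSome) :
    (palNTM b).Runs u.length (thinZip u)
      (onR (.thin (scan thinCell ((0, 0), false, false) u).1)
        ((scan (thinCell (b := b)) ((0, 0), false, false) u).2.reverse ++ [plain none])
        [plain none]) :=
  Runs.sweepRight (M := palNTM b) State.thin thinCell u
    (fun c hc s => δ_of_det (by simp [det, hu c hc])) _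

theorem digits_length_of_pos (hb : 0 < b) {c : ℕ} (hc : 0 < c) :
    ((b + 1).digits c).length = ((b + 1).digits (c / (b + 1))).length + 1 := by
  rw [Nat.digits_def' (by omega) hc, List.length_cons]

/-- A round divides the number of input marks by `b + 1` and that of program marks by `2`, rounding
down. The former vanishes after as many rounds as it has digits in base `b + 1`, say `h`; the latter
has vanished by then iff it was below `2 ^ h`. A round costs one sweep each way, and at most `h + 1`
rounds are played. The induction is on a bound `N` for the program marks. -/
theorem thin_phase (hb : 0 < b) (N : ℕ) (u : List Cell) (hu : ∀ c ∈ u, c.inp.isSome)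
    (hN : (u.map Cell.m₂).count true ≤ N) :
    ((u.map Cell.m₂).count true < 2 ^ ((b + 1).digits ((u.map Cell.m₁).count true)).length →
      ∃ t ≤ (((b + 1).digits ((u.map Cell.m₁).count true)).length + 1) * (2 * u.length + 2),
        (palNTM b).Runs t (thinZip u) (startZip u)) ∧
    (¬ (u.map Cell.m₂).count true < 2 ^ ((b + 1).digits ((u.map Cell.m₁).count true)).length →
      (palNTM b).Settles
        ((((b + 1).digits ((u.map Cell.m₁).count true)).length + 1) * (2 * u.length + 2))
        (thinZip u) False) := by
  induction N generalizing u with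
  | zero =>
    have h2 : (u.map Cell.m₂).count true = 0 := by omega
    rw [h2]
    refine ⟨fun _ => ?_, fun h => absurd (by positivity) h⟩
    have h1 := runs_thin_sweep (b := b) hu
    set u' := (scan (thinCell (b := b)) ((0, 0), false, false) u).2 with hu'
    have hs := thin_seen (b := b) ((0, 0), false, false) u
    rw [h2] at hs
    have hinp : ∀ c ∈ u', c.inp.isSome := by
      have e := thin_map (b := b) (fun c => c.inp.isSome) (fun _ _ => rfl) ((0, 0), false, false) u
      intro c hc
      have := List.mem_map_of_mem (f := fun c : Cell => c.inp.isSome) hc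
      rw [hu', e] at this
      obtain ⟨c', hc', h⟩ := List.mem_map.mp this
      rw [← h]
      exact hu c' hc'
    have g1 : (palNTM b).Runs 1
        (onR (.thin (scan thinCell ((0, 0), false, false) u).1) (u'.reverse ++ [plain none])
          [plain none]) (onL .thinDone (u'.reverse ++ [plain none]) [plain none]) :=
      Runs.turnLeft (δ_of_det (by simp [det, hs, plain]))
    have g2 := Runs.sweepLeft (M := palNTM b) (l := [plain none]) (r := [plain none])
      (fun _ : Unit => .thinDone) (fun _ c => ((), clearMarks c)) u'.reverse
      (fun c hc _ => δ_of_det (by simp [det, hinp c (by simpa using hc)])) ()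
    have g3 : (palNTM b).Runs 1 (onL .thinDone [plain none] (u'.map clearMarks ++ [plain none]))
        (onR (.home false) [plain none] (u'.map clearMarks ++ [plain none])) :=
      Runs.turnRight (δ_of_det rfl)
    rw [scan_map, List.map_reverse, List.reverse_reverse] at g2
    have e : u'.map clearMarks = u.map clearMarks := thin_map clearMarks (fun _ _ => rfl) _ _
    have := ((h1.trans g1).trans g2).trans g3
    rw [e] at this
    refine ⟨_, ?_, this⟩
    rw [List.length_reverse, hu', scan_length, add_one_mul]
    omega
  | succ N ih =>
    rcases Nat.eq_zero_or_pos ((u.map Cell.m₂).count true) with h2 | h2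
    · exact ih u hu (by omega)
    have h1 := runs_thin_sweep (b := b) hu
    set u' := (scan (thinCell (b := b)) ((0, 0), false, false) u).2 with hu'
    have hs := thin_seen (b := b) ((0, 0), false, false) u
    rcases Nat.eq_zero_or_pos ((u.map Cell.m₁).count true) with hc | hc
    · rw [hc]
      refine ⟨fun h => absurd h (by simp only [Nat.digits_zero, List.length_nil, pow_zero]; omega),
        fun _ => ?_⟩
      have := settles_onR (b := b) (q := .thin (scan thinCell ((0, 0), false, false) u).1)
        (c := plain none) (u'.reverse ++ [plain none]) [] rfl (by simp [det, hs, plain, hc, h2])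
      refine h1.settles this ?_ (by simp)
      simp
      omega
    have hinp : ∀ c ∈ u', c.inp.isSome := by
      have e := thin_map (b := b) (fun c => c.inp.isSome) (fun _ _ => rfl) ((0, 0), false, false) u
      intro c hc
      have := List.mem_map_of_mem (f := fun c : Cell => c.inp.isSome) hc
      rw [hu', e] at this
      obtain ⟨c', hc', h⟩ := List.mem_map.mp this
      rw [← h]
      exact hu c' hc'
    have c1 : (u'.map Cell.m₁).count true = (u.map Cell.m₁).count true / (b + 1) := by
      rw [hu', thin_m₁, count_thinMark]; simp
    have c2 : (u'.map Cell.m₂).count true = (u.map Cell.m₂).count true / 2 := by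
      rw [hu', thin_m₂, count_thinMark (b := 1)]; simp
    have g1 : (palNTM b).Runs 1
        (onR (.thin (scan thinCell ((0, 0), false, false) u).1) (u'.reverse ++ [plain none])
          [plain none]) (onL .thinBack (u'.reverse ++ [plain none]) [plain none]) :=
      Runs.turnLeft (δ_of_det (by simp [det, hs, plain, hc, h2]))
    have hrun := (h1.trans g1).trans (runs_thinBack hinp)
    have hlen : u'.length = u.length := by rw [hu', scan_length]
    obtain ⟨ih1, ih2⟩ := ih u' hinp (by rw [c2]; omega)
    rw [c1, c2, hlen] at ih1 ih2
    have estart : (startZip u' : (palNTM b).Zip) = startZip u := by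
      have e : u'.map clearMarks = u.map clearMarks := thin_map clearMarks (fun _ _ => rfl) _ _
      rw [startZip, startZip, e]
    rw [estart] at ih1
    -- Dividing by the base removes one digit, and halving the width matches the lost factor of the
    -- power of two.
    rw [digits_length_of_pos hb hc, pow_succ, ← Nat.div_lt_iff_lt_mul two_pos]
    constructor
    · intro h
      obtain ⟨t, ht, hr⟩ := ih1 h
      refine ⟨_, ?_, hrun.trans hr⟩
      rw [hlen, add_one_mul]
      omega
    · intro h
      refine hrun.settles (ih2 h) ?_ Iff.rfl
      rw [hlen, add_one_mul (_ + 1)]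
      omega

/-! #### The guess -/

/-- The tape after the guess of the program `S` on the part `y` of the input. -/
def guessCells : List Bool → List (Op × Kind) → List Cell
  | [], _ => []
  | v :: y, [] => ⟨some v, true, false, none⟩ :: guessCells y []
  | v :: y, s :: S => ⟨some v, true, true, some (fresh s)⟩ :: guessCells y S

theorem guessCells_length (y : List Bool) (S : List (Op × Kind)) :
    (guessCells y S).length = y.length := by
  induction y generalizing S with
  | nil => rfl
  | cons v y ih => cases S <;> simp [guessCells, ih]

theorem guessCells_inp (y : List Bool) (S : List (Op × Kind)) :
    ∀ c ∈ guessCells y S, c.inp.isSome := by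
  induction y generalizing S with
  | nil => simp [guessCells]
  | cons v y ih => cases S <;> simpa [guessCells] using ih _

theorem guessCells_m₁ (y : List Bool) (S : List (Op × Kind)) :
    ((guessCells y S).map Cell.m₁).count true = y.length := by
  induction y generalizing S with
  | nil => rfl
  | cons v y ih => cases S <;> simp [guessCells, ih]

theorem guessCells_m₂ (y : List Bool) (S : List (Op × Kind)) (h : S.length ≤ y.length) :
    ((guessCells y S).map Cell.m₂).count true = S.length := by
  induction y generalizing S with
  | nil =>
    obtain rfl : S = [] := by simpa using h
    rfl
  | cons v y ih =>
    cases S with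
    | nil => simpa [guessCells] using ih [] (by simp)
    | cons s S => simpa [guessCells] using ih S (by simpa using h)

theorem guessCells_concat (y : List Bool) (S : List (Op × Kind)) (v : Bool)
    (h : S.length ≤ y.length) :
    guessCells (y ++ [v]) S = guessCells y S ++ [⟨some v, true, false, none⟩] := by
  induction y generalizing S with
  | nil =>
    obtain rfl : S = [] := by simpa using h
    rfl
  | cons v' y ih =>
    cases S with
    | nil => simpa [guessCells] using ih [] (by simp)
    | cons s S => simpa [guessCells] using ih S (by simpa using h)

theorem guessCells_concat_concat (y : List Bool) (S : List (Op × Kind)) (v : Bool) (s : Op × Kind)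
    (h : S.length = y.length) :
    guessCells (y ++ [v]) (S ++ [s]) =
      guessCells y S ++ [⟨some v, true, true, some (fresh s)⟩] := by
  induction y generalizing S with
  | nil =>
    obtain rfl : S = [] := by simpa using h
    rfl
  | cons v' y ih =>
    cases S with
    | nil => simp at h
    | cons s S => simpa [guessCells] using ih S (by simpa using h)

theorem guessCells_clear (y : List Bool) (S : List (Op × Kind)) (N : List (Option Bool))
    (h : S.length ≤ y.length) :
    (guessCells y S).map clearMarks ++ N.map plain =
      cells ((y.map some ++ N).take S.length) (S.map fresh) ++
        ((y.map some ++ N).drop S.length).map plain := by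
  induction y generalizing S with
  | nil =>
    obtain rfl : S = [] := by simpa using h
    rfl
  | cons v y ih =>
    cases S with
    | nil => simpa [guessCells, clearMarks, plain, cells] using ih [] (by simp)
    | cons s S => simpa [guessCells, clearMarks, plain, cells] using ih S (by simpa using h)

/-- The configuration after the guess of the program `S` on the input `x`. -/
def guessedZip (x : List Bool) (S : List (Op × Kind)) : (palNTM b).Zip :=
  onL (.thinBack : State b) (guessCells x S).reverse [plain none]

/-- Both sides differ by trailing blanks only. The `S.length + 2` blanks give the program room when
it is dragged past the last symbol. -/
theorem startZip_cfg (x : List Bool) (S : List (Op × Kind)) (h : S.length ≤ x.length) (z : ℤ) :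
    (startZip (guessCells x S) : (palNTM b).Zip).cfg z = (homeZip false [none]
      (x.map some ++ List.replicate (S.length + 2) none) (S.map fresh)).cfg z := by
  unfold startZip homeZip
  have h1 := guessCells_clear x S (List.replicate (S.length + 2) none) h
  rw [List.length_map, ← h1, List.map_replicate]
  rw [show [plain none] = List.replicate 1 ((palNTM b).sym none) from rfl, Zip.cfg_pad_right]
  exact (Zip.cfg_pad_right z _).symm

theorem guessedZip_cfg (x : List Bool) (S : List (Op × Kind)) (z : ℤ) :
    (guessedZip x S : (palNTM b).Zip).cfg z =
      (onL (.thinBack : State b) ((guessCells x S).reverse ++ [plain none]) [plain none] :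
        (palNTM b).Zip).cfg z :=
  (Zip.cfg_pad_left (M := palNTM b) z 1).symm

theorem runs_congr {M : NTM} {t : ℕ} {z₁ z₂ z₁' z₂' : M.Zip} (h : M.Runs t z₁ z₂)
    (h₁ : ∀ z, z₁'.cfg z = z₁.cfg z) (h₂ : ∀ z, z₂.cfg z = z₂'.cfg z) : M.Runs t z₁' z₂' := by
  intro z
  obtain ⟨z', hz⟩ := h z
  exact ⟨z', by rwa [h₁, ← h₂]⟩

/-- A bound for the time that is spent after the guess, where `D` bounds the width. -/
def totalTime (n D : ℕ) : ℕ := n + 1 + D * (2 * n + 2) + (2 * n * blockTime (D - 1) + (2 * D + 2))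

theorem blockTime_mono {w w' : ℕ} (h : w ≤ w') : blockTime w ≤ blockTime w' := by
  unfold blockTime
  gcongr

/-- After the guess, the machine accepts iff the program is not too wide, and prints the input
from left to right as well as from right to left. -/
theorem settles_guessed (hb : 0 < b) (x : List Bool) (S : List (Op × Kind)) (hS : S ≠ [])
    (hSx : S.length ≤ x.length) :
    (palNTM b).Settles (totalTime x.length (2 ^ ((b + 1).digits x.length).length))
      (guessedZip x S)
      (S.length < 2 ^ ((b + 1).digits x.length).length ∧
        x = results x.length (S.map fresh) ∧ x.reverse = results x.length (S.map fresh)) := by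
  have hx : x ≠ [] := by
    rintro rfl
    exact hS (by simpa using hSx)
  have h1 := runs_congr (runs_thinBack (b := b) (guessCells_inp x S)) (guessedZip_cfg x S)
    fun _ => rfl
  obtain ⟨h2, h3⟩ := thin_phase hb _ (guessCells x S) (guessCells_inp x S) le_rfl
  rw [guessCells_m₁, guessCells_m₂ _ _ hSx, guessCells_length] at h2 h3
  rw [guessCells_length] at h1
  set h := ((b + 1).digits x.length).length with hh
  -- The number of rounds of thinning is absorbed by the cap on the width.
  have hD : h + 1 ≤ 2 ^ h := Nat.lt_two_pow_self
  have hmul : (h + 1) * (2 * x.length + 2) ≤ 2 ^ h * (2 * x.length + 2) :=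
    Nat.mul_le_mul_right _ hD
  by_cases hp : S.length < 2 ^ h
  · obtain ⟨t, ht, hr⟩ := h2 hp
    have h4 := runs_congr hr (fun _ => rfl) (startZip_cfg x S hSx)
    refine (h1.trans h4).settles (settles_main x S hx hS) ?_ (by simp [hp])
    have : 2 * x.length * blockTime S.length ≤ 2 * x.length * blockTime (2 ^ h - 1) :=
      Nat.mul_le_mul_left _ (blockTime_mono (by omega))
    unfold totalTime
    omega
  · refine h1.settles (h3 hp) ?_ (by simp [hp])
    unfold totalTime
    omega

/-- The configurations of the guess phase. -/
def Guessing (x : List Bool) (t : ℕ) (c : (palNTM b).Cfg) : Prop :=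
  ∃ (y z : List Bool) (S : List (Op × Kind)) (q : State b), x = y ++ z ∧ y.length = t ∧
    c = (onR q (guessCells y S).reverse (z.map (fun v => plain (some v)) ++ [plain none]) :
      (palNTM b).Zip).cfg t ∧
    (y = [] ∧ S = [] ∧ q = .guessFirst ∨
      S ≠ [] ∧ S.length = y.length ∧ q = .guessProg (decide (y.length % 2 = 1)) ∨
      S ≠ [] ∧ S.length ≤ y.length ∧ q = .guessRest (decide (y.length % 2 = 1)))

theorem decide_odd_succ (n : ℕ) :
    (!decide (n % 2 = 1)) = decide ((n + 1) % 2 = 1) := by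
  rcases Nat.mod_two_eq_zero_or_one n with h | h <;> simp [Nat.add_mod, h]

theorem step_onR {q : State b} {l r : List Cell} {c : Cell} {z : ℤ} {d : (palNTM b).Cfg} :
    (palNTM b).Step ((onR q l (c :: r) : (palNTM b).Zip).cfg z) d ↔
      ∃ q' x mv, ((q', x, mv) ∈ guess q c ∨ det q c = some (q', x, mv)) ∧
        d = ⟨q', z + mv.toInt, tapeOf (plain none) z l (x :: r)⟩ := by
  unfold NTM.Step
  simp only [Zip.cfg, tapeOf_right, tapeOf_update_right]
  constructor
  · rintro ⟨⟨q', x, mv⟩, h, rfl⟩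
    exact ⟨q', x, mv, h, rfl⟩
  · rintro ⟨q', x, mv, h, rfl⟩
    exact ⟨(q', x, mv), h, rfl⟩

theorem guessing_init (x : List Bool) : Guessing (b := b) x 0 ((palNTM b).init x) := by
  refine ⟨[], x, [], .guessFirst, rfl, rfl, ?_, .inl ⟨rfl, rfl, rfl⟩⟩
  rw [NTM.init_eq_cfg]
  exact (Zip.cfg_pad_right (M := palNTM b) 0 1).symm

/-- Every step of the guess reads one more symbol, until the blank is met. The bit in the state is
the parity of the number of symbols read, so inputs of odd length get stuck there. -/
theorem guessing_step {x : List Bool} {t : ℕ} {c d : (palNTM b).Cfg} (h : Guessing x t c)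
    (hs : (palNTM b).Step c d) : (t < x.length ∧ Guessing x (t + 1) d) ∨
      t = x.length ∧ ∃ S : List (Op × Kind), S ≠ [] ∧ S.length ≤ x.length ∧ x.length % 2 = 0 ∧
        d = (guessedZip x S : (palNTM b).Zip).cfg x.length := by
  obtain ⟨y, z, S, q, rfl, rfl, rfl, hq⟩ := h
  obtain _ | ⟨v, z⟩ := z
  · right
    refine ⟨by simp, ?_⟩
    rw [List.map_nil, List.nil_append, step_onR] at hs
    obtain ⟨q', x, mv, hs, rfl⟩ := hs
    rw [List.append_nil]
    rcases hq with ⟨-, -, rfl⟩ | ⟨hS, hl, rfl⟩ | ⟨hS, hl, rfl⟩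
    · simp [guess, det, plain] at hs
    · simp [guess, det, plain] at hs
      obtain ⟨hm, rfl, rfl, rfl⟩ := hs
      exact ⟨S, hS, hl.le, hm, rfl⟩
    · simp [guess, det, plain] at hs
      obtain ⟨hm, rfl, rfl, rfl⟩ := hs
      exact ⟨S, hS, hl, hm, rfl⟩
  · left
    refine ⟨by simp, ?_⟩
    rw [List.map_cons, List.cons_append, step_onR] at hs
    obtain ⟨q', x, mv, hs, rfl⟩ := hs
    rcases hq with ⟨rfl, rfl, rfl⟩ | ⟨hS, hl, rfl⟩ | ⟨hS, hl, rfl⟩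
    · simp [guess, det, plain] at hs
      obtain ⟨rfl, ⟨o, k, rfl⟩, rfl⟩ := hs
      refine ⟨[v], z, [(o, k)], _, rfl, rfl, ?_, .inr (.inl ⟨by simp, rfl, rfl⟩)⟩
      simp only [Zip.cfg, Move.toInt, tapeOf_shift]
      rfl
    · simp [guess, det, plain] at hs
      rcases hs with ⟨rfl, ⟨o, k, rfl⟩, rfl⟩ | ⟨rfl, rfl, rfl⟩
      · refine ⟨y ++ [v], z, S ++ [(o, k)], _, by simp, by simp, ?_,
          .inr (.inl ⟨by simp, by simp [hl], rfl⟩)⟩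
        rw [guessCells_concat_concat _ _ _ _ hl, List.length_append, List.length_singleton,
          ← decide_odd_succ]
        simp only [Zip.cfg, Move.toInt, tapeOf_shift, List.reverse_append]
        simp
        rfl
      · refine ⟨y ++ [v], z, S, _, by simp, by simp, ?_,
          .inr (.inr ⟨hS, by simp [hl], rfl⟩)⟩
        rw [guessCells_concat _ _ _ hl.le, List.length_append, List.length_singleton,
          ← decide_odd_succ]
        simp only [Zip.cfg, Move.toInt, tapeOf_shift, List.reverse_append]
        simp
        rfl
    · simp [guess, det, plain] at hs
      obtain ⟨rfl, rfl, rfl⟩ := hs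
      refine ⟨y ++ [v], z, S, _, by simp, by simp, ?_,
        .inr (.inr ⟨hS, by simp; omega, rfl⟩)⟩
      rw [guessCells_concat _ _ _ hl, List.length_append, List.length_singleton,
          ← decide_odd_succ]
      simp only [Zip.cfg, Move.toInt, tapeOf_shift, List.reverse_append]
      simp
      rfl

/-! ### Soundness, completeness and running time of the palindrome machine -/

theorem paths {x : List Bool} {t : ℕ} {c : (palNTM b).Cfg}
    (h : StepsIn (palNTM b).Step t ((palNTM b).init x) c) :
    (t ≤ x.length ∧ Guessing x t c) ∨ ∃ S : List (Op × Kind), S ≠ [] ∧ S.length ≤ x.length ∧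
      x.length % 2 = 0 ∧ ∃ t', t = x.length + 1 + t' ∧
        StepsIn (palNTM b).Step t' ((guessedZip x S : (palNTM b).Zip).cfg x.length) c := by
  generalize hi : (palNTM b).init x = i at h
  induction h with
  | zero =>
    subst hi
    exact .inl ⟨Nat.zero_le _, guessing_init x⟩
  | succ _ hs ih =>
    rcases ih hi with ⟨-, hg⟩ | ⟨S, hS, hl, hp, t', rfl, hr⟩
    · rcases guessing_step hg hs with ⟨ht, hg'⟩ | ⟨rfl, S, hS, hl, hp, rfl⟩
      · exact .inl ⟨ht, hg'⟩
      · exact .inr ⟨S, hS, hl, hp, 0, rfl, .zero _⟩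
    · exact .inr ⟨S, hS, hl, hp, t' + 1, rfl, hr.succ hs⟩

/-- A path is a guess of at most `n + 1` steps followed by an initial segment of a forced
computation, whose length is bounded uniformly in the guess. -/
theorem time_le (hb : 0 < b) {x : List Bool} {t : ℕ} {c : (palNTM b).Cfg}
    (h : StepsIn (palNTM b).Step t ((palNTM b).init x) c) :
    t ≤ x.length ∨ x.length ≠ 0 ∧
      t ≤ x.length + 1 + totalTime x.length (2 ^ ((b + 1).digits x.length).length) := by
  rcases paths h with ⟨ht, -⟩ | ⟨S, hS, hl, -, t', rfl, hr⟩
  · exact .inl ht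
  · right
    have := List.length_pos_iff.mpr hS
    obtain ⟨T, hT, z, hz, hh, -⟩ := settles_guessed hb x S hS hl
    obtain ⟨b', hz⟩ := hz x.length
    have := (hz.of_detStep (hh b') hr).1
    exact ⟨by omega, by omega⟩

theorem not_accept_of_guessing {x : List Bool} {t : ℕ} {c : (palNTM b).Cfg}
    (h : Guessing x t c) : c.state ∉ (palNTM b).accept := by
  obtain ⟨y, z, S, q, -, -, rfl, ⟨-, -, rfl⟩ | ⟨-, -, rfl⟩ | ⟨-, -, rfl⟩⟩ := h <;>
  · intro h
    change _ = _ at h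
    simp [Zip.cfg] at h

/-- Accepting configurations halt, so an accepting path ends exactly where the forced computation
does. -/
theorem not_step_of_accept {c e : (palNTM b).Cfg} (h : c.state ∈ (palNTM b).accept) :
    ¬ (palNTM b).Step c e := by
  rintro ⟨a, ha, -⟩
  change c.state = .accept at h
  rw [h] at ha
  rcases ha with ha | ha <;> cases ha

/-- The machine accepts only palindromes. -/
theorem mem_PAL_of_accepts (hb : 0 < b) {x : List Bool} (h : (palNTM b).Accepts x) : x ∈ PAL := by
  obtain ⟨t, c, hc, hacc⟩ := h
  rcases paths hc with ⟨-, hg⟩ | ⟨S, hS, hl, hp, t', rfl, hr⟩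
  · exact absurd hacc (not_accept_of_guessing hg)
  obtain ⟨T, hT, z, hz, hh, ha⟩ := settles_guessed hb x S hS hl
  obtain ⟨b', hz⟩ := hz x.length
  obtain rfl := hz.eq_of_detStep (hh b') hr fun e => not_step_of_accept hacc
  obtain ⟨-, h1, h2⟩ := (ha b').mp hacc
  -- Both passes found the same printed sequence.
  have hrev : x.reverse = x := h2.trans h1.symm
  -- The parity check during the guess makes the two halves equally long.
  refine ⟨x.drop (x.length / 2), ?_⟩
  have h3 : (x.drop (x.length / 2)).reverse = x.take (x.length / 2) := by
    rw [List.reverse_drop, hrev]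
    congr 1
    omega
  rw [h3, List.take_append_drop]

/-- The path that writes the entries of `S` one by one under the first `S.length` symbols and
afterwards only sets input marks. -/
theorem exists_guess (x : List Bool) (S : List (Op × Kind)) (hS : S ≠ []) (t : ℕ)
    (ht : t ≤ x.length) :
    ∃ q : State b, (t = 0 ∧ q = .guessFirst ∨
        0 < t ∧ t ≤ S.length ∧ q = .guessProg (decide (t % 2 = 1)) ∨
        S.length < t ∧ q = .guessRest (decide (t % 2 = 1))) ∧
      StepsIn (palNTM b).Step t ((palNTM b).init x)
        ((onR q (guessCells (x.take t) (S.take t)).reverse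
          ((x.drop t).map (fun v => plain (some v)) ++ [plain none]) : (palNTM b).Zip).cfg t) := by
  induction t with
  | zero =>
    refine ⟨_, .inl ⟨rfl, rfl⟩, ?_⟩
    have e : (palNTM b).init x = (onR (.guessFirst : State b) []
        (x.map (fun v => plain (some v)) ++ [plain none]) : (palNTM b).Zip).cfg 0 := by
      rw [NTM.init_eq_cfg]
      exact (Zip.cfg_pad_right (M := palNTM b) 0 1).symm
    rw [e]
    exact .zero _
  | succ t ih =>
    obtain ⟨q, hq, hrun⟩ := ih (by omega)
    have hdrop : x.drop t = x[t] :: x.drop (t + 1) := List.drop_eq_getElem_cons (by omega)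
    have htake : x.take (t + 1) = x.take t ++ [x[t]] := by rw [List.take_succ_eq_append_getElem]
    rw [hdrop, List.map_cons, List.cons_append] at hrun
    have hlt : (x.take t).length = t := by rw [List.length_take]; omega
    rcases Nat.lt_or_ge t S.length with htS | htS
    · have hStake : S.take (t + 1) = S.take t ++ [S[t]] := by
        rw [List.take_succ_eq_append_getElem]
      refine ⟨_, .inr (.inl ⟨by omega, by omega, rfl⟩), hrun.succ (step_onR.mpr
        ⟨.guessProg (decide ((t + 1) % 2 = 1)), ⟨some x[t], true, true, some (fresh S[t])⟩, .right,
          .inl ?_, ?_⟩)⟩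
      · rw [← decide_odd_succ]
        rcases hq with ⟨rfl, rfl⟩ | ⟨-, -, rfl⟩ | ⟨h, -⟩
        · exact ⟨rfl, S[0], rfl⟩
        · exact .inl ⟨rfl, .inl ⟨S[t], rfl⟩⟩
        · omega
      · rw [htake, hStake, guessCells_concat_concat _ _ _ _ (by simp; omega)]
        simp only [Zip.cfg, Move.toInt, tapeOf_shift, List.reverse_append]
        rfl
    · have hStake : S.take (t + 1) = S.take t := by
        rw [List.take_of_length_le htS, List.take_of_length_le (by omega)]
      refine ⟨_, .inr (.inr ⟨by omega, rfl⟩), hrun.succ (step_onR.mpr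
        ⟨.guessRest (decide ((t + 1) % 2 = 1)), ⟨some x[t], true, false, none⟩, .right,
          .inl ?_, ?_⟩)⟩
      · have := List.length_pos_iff.mpr hS
        rw [← decide_odd_succ]
        rcases hq with ⟨rfl, rfl⟩ | ⟨-, -, rfl⟩ | ⟨-, rfl⟩
        · omega
        · exact .inl ⟨rfl, .inr rfl⟩
        · exact .inl ⟨rfl, rfl⟩
      · rw [htake, hStake, guessCells_concat _ _ _ (by simp; omega)]
        simp only [Zip.cfg, Move.toInt, tapeOf_shift, List.reverse_append]
        rfl

/-- The machine accepts the palindromes that are printed by a narrow program. -/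
theorem accepts_of_results (hb : 0 < b) {x : List Bool} (hx : x ∈ PAL) (S : List (Op × Kind))
    (hS : S ≠ []) (hl : S.length ≤ x.length) (hw : S.length < 2 ^ ((b + 1).digits x.length).length)
    (hres : results x.length (S.map fresh) = x) : (palNTM b).Accepts x := by
  obtain ⟨y, hy⟩ := hx
  have hrev : x.reverse = x := by simp [hy]
  have heven : x.length % 2 = 0 := by simp [hy]; omega
  obtain ⟨q, hq, hrun⟩ := exists_guess (b := b) x S hS x.length le_rfl
  rw [List.take_length, List.take_of_length_le hl, List.drop_length, List.map_nil,
    List.nil_append] at hrun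
  have hstep : (palNTM b).Step ((onR q (guessCells x S).reverse [plain none] :
      (palNTM b).Zip).cfg x.length) ((guessedZip x S : (palNTM b).Zip).cfg x.length) := by
    refine step_onR.mpr ⟨.thinBack, plain none, .left, .inl ?_, rfl⟩
    have hpos := List.length_pos_iff.mpr hS
    rcases hq with ⟨h, -⟩ | ⟨-, -, rfl⟩ | ⟨-, rfl⟩
    · omega
    · exact .inr ⟨rfl, by simp [heven], rfl⟩
    · exact .inr ⟨rfl, by simp [heven], rfl⟩
  obtain ⟨T, -, z, hz, -, ha⟩ := settles_guessed hb x S hS hl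
  obtain ⟨b', hz⟩ := hz x.length
  exact ⟨_, _, (hrun.succ hstep).trans (hz.mono fun _ _ h => h.1),
    (ha b').mpr ⟨hw, hres.symm, by rw [hrev, hres]⟩⟩

theorem totalTime_le {n D : ℕ} (hn : n ≠ 0) (hD : 2 ≤ D) :
    n + 1 + totalTime n D ≤ 24 * n * D ^ 2 := by
  obtain ⟨D, rfl⟩ : ∃ E, D = E + 2 := ⟨D - 2, by omega⟩
  obtain ⟨n, rfl⟩ : ∃ E, n = E + 1 := ⟨n - 1, by omega⟩
  rw [totalTime, show D + 2 - 1 = D + 1 by omega, blockTime]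
  nlinarith [Nat.zero_le (n * D), Nat.zero_le (n * D ^ 2), Nat.zero_le (D ^ 2)]

/-- If `n` has `k + 1` digits in base `2 ^ 20`, then `(2 ^ k) ^ 20 ≤ n`, so the square of the cap `2
^ (k + 1)` is at most `4 * n ^ 0.1`. The time is at most `24 * n` times this square, whence the
constant `96`. -/
theorem palNTM_mem_timeOPow : palNTM (2 ^ 20 - 1) ∈ NTM.timeOPow 1.1 := by
  refine ⟨96, fun x t c h => ?_⟩
  rcases time_le (by norm_num) h with ht | ⟨hn, ht⟩
  · rcases Nat.eq_zero_or_pos x.length with hn | hn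
    · obtain rfl : t = 0 := by omega
      rw [hn]
      simp only [Nat.cast_zero]
      positivity
    · have h1 : (1 : ℝ) ≤ x.length := by exact_mod_cast hn
      have h2 : (x.length : ℝ) ≤ (x.length : ℝ) ^ (1.1 : ℝ) :=
        Real.self_le_rpow_of_one_le h1 (by norm_num)
      have h3 : (t : ℝ) ≤ x.length := by exact_mod_cast ht
      linarith
  · set n := x.length
    have hB : 2 ^ 20 - 1 + 1 = 2 ^ 20 := by norm_num
    rw [hB, Nat.length_digits _ _ (by norm_num) hn] at ht
    set k := Nat.log (2 ^ 20) n
    have hk : (2 ^ 20) ^ k ≤ n := Nat.pow_log_le_self _ hn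
    have h1 := ht.trans (totalTime_le hn (by
      calc 2 = 2 ^ 1 := by norm_num
        _ ≤ 2 ^ (k + 1) := Nat.pow_le_pow_right (by norm_num) (by omega)))
    have hn1 : (0 : ℝ) < n := by exact_mod_cast Nat.pos_of_ne_zero hn
    have h2 : ((2 : ℝ) ^ k) ^ 2 ≤ (n : ℝ) ^ (0.1 : ℝ) := by
      have h3 : (((2 : ℝ) ^ k) ^ 2) ^ (10 : ℕ) ≤ n := by
        calc (((2 : ℝ) ^ k) ^ 2) ^ (10 : ℕ) = (((2 ^ 20) ^ k : ℕ) : ℝ) := by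
              push_cast
              rw [show (1048576 : ℝ) = 2 ^ 20 by norm_num, ← pow_mul, ← pow_mul, ← pow_mul]
              congr 1
              ring
          _ ≤ n := by exact_mod_cast hk
      calc ((2 : ℝ) ^ k) ^ 2 = ((((2 : ℝ) ^ k) ^ 2) ^ (10 : ℕ)) ^ (0.1 : ℝ) := by
            rw [← Real.rpow_natCast _ 10, ← Real.rpow_mul (by positivity)]
            norm_num
        _ ≤ (n : ℝ) ^ (0.1 : ℝ) := Real.rpow_le_rpow (by positivity) h3 (by norm_num)
    have h4 : (n : ℝ) ^ (1.1 : ℝ) = n * (n : ℝ) ^ (0.1 : ℝ) := by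
      rw [show (1.1 : ℝ) = 1 + 0.1 by norm_num, Real.rpow_add hn1, Real.rpow_one]
    have h5 : (t : ℝ) ≤ 24 * n * (2 ^ (k + 1)) ^ 2 := by exact_mod_cast h1
    calc (t : ℝ) ≤ 24 * n * (2 ^ (k + 1)) ^ 2 := h5
      _ = 96 * (n * ((2 : ℝ) ^ k) ^ 2) := by ring
      _ ≤ 96 * (n * (n : ℝ) ^ (0.1 : ℝ)) := by gcongr
      _ ≤ 96 * (n : ℝ) ^ (1.1 : ℝ) + 96 := by rw [h4]; linarith

end PalMachine

/-- The `m` low bits of `k` and `q`, interleaved. -/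
def interleave : ℕ → ℕ → ℕ → List Bool
  | 0, _, _ => []
  | m + 1, k, q => decide (k % 2 = 1) :: decide (q % 2 = 1) :: interleave m (k / 2) (q / 2)

@[simp] theorem interleave_length (m k q : ℕ) : (interleave m k q).length = 2 * m := by
  induction m generalizing k q with
  | zero => rfl
  | succ m ih => simp only [interleave, List.length_cons, ih]; ring

namespace PalMachine

/-! #### Programs as straight-line programs on a queue -/

/-- Executes instructions on a queue and an accumulator. -/
def queueRun : List Op → List Bool → Bool → List Bool × Bool
  | [], q, acc => (q, acc)
  | _ :: _, [], acc => ([], acc)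
  | f :: P, a :: q, acc => queueRun P (q ++ [(f a acc).1]) (f a acc).2

/-- The queue that is stored in the cells of a program. -/
def queue (rs : List Reg) : List Bool :=
  rs.filterMap fun r => if r.kind.isSome then some r.data else none

/-- The same conservation law for the data; cells without a role in the queue are skipped over. -/
theorem scan_rotReg_queue (h : Option Op × Bool) (v : List Reg) :
    queue (scan rotReg h v).2 ++ [(scan rotReg h v).1.2] = h.2 :: queue v := by
  induction v generalizing h with
  | nil => rfl
  | cons r v ih =>
    have ih := ih (rotReg h r).1
    unfold queue at ih ⊢
    cases hk : r.kind with
    | none => simpa [scan, rotReg, hk] using ih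
    | some k => simpa [scan, rotReg, hk] using ih

theorem queue_reverse (rs : List Reg) : queue rs.reverse = (queue rs).reverse :=
  List.filterMap_reverse

theorem queue_rotAll (h : Option Op × Bool) {rs : List Reg} {a : Bool} {q : List Bool}
    (hq : queue rs = a :: q) : queue (rotAll h rs) = q ++ [h.2] := by
  have h1 := congrArg (fun l => l.reverse.tail) (scan_rotReg_queue h rs.reverse)
  rw [queue_reverse, hq] at h1
  rw [rotAll, queue_reverse]
  simpa using h1

/-- The machine always reads the leftmost cell, so that cell has to belong to the queue; this is the
purpose of `hk`. -/
theorem execOps_eq_queueRun (P : List Op) (rs : List Reg) (acc : Bool) {k : Option Bool}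
    {ks : List Kind} (hk : rs.map Reg.kind = some k :: ks) :
    (execOps P rs acc).2 = (queueRun P (queue rs) acc).2 := by
  induction P generalizing rs acc with
  | nil => rfl
  | cons f P ih =>
    obtain _ | ⟨r, rs⟩ := rs
    · simp at hk
    have hr : r.kind = some k := by
      simp only [List.map_cons, List.cons.injEq] at hk
      exact hk.1
    have hq : queue (r :: rs) = r.data :: queue rs := by
      simp [queue, hr]
    rw [execOps, ih _ _ (by rw [rotAll_map _ (fun _ _ => rfl), hk]), queue_rotAll _ hq, hq]
    rfl

/-- The initial queue. -/
def initQueue (l : List (Kind × Bool)) : List Bool :=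
  l.filterMap fun p => if p.1.isSome then some (initData p.1 p.2) else none

/-- Increments the counter. -/
def incAll (c : Bool) (l : List (Kind × Bool)) : List (Kind × Bool) :=
  (scan (fun c (p : Kind × Bool) => ((incDigit c p.1 p.2).1, (p.1, (incDigit c p.1 p.2).2)))
    c l).2

theorem queue_loadAll (rs : List Reg) :
    queue (loadAll rs) = initQueue (rs.map fun r => (r.kind, r.dig)) := by
  have : ∀ c, queue (scan loadReg c rs).2 = initQueue (rs.map fun r => (r.kind, r.dig)) := by
    induction rs with
    | nil => exact fun _ => rfl
    | cons r rs ih =>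
      intro c
      have ih := ih (loadReg c r).1
      unfold queue initQueue at ih ⊢
      cases hk : r.kind with
      | none => simpa [scan, loadReg, hk] using ih
      | some k => simpa [scan, loadReg, hk] using ih
  exact this true

theorem next_counter (rs : List Reg) : (next rs).map (fun r => (r.kind, r.dig)) =
    incAll true (rs.map fun r => (r.kind, r.dig)) := by
  rw [next, execOps_map _ (fun _ _ => rfl)]
  have : ∀ c, (scan loadReg c rs).2.map (fun r => (r.kind, r.dig)) =
      incAll c (rs.map fun r => (r.kind, r.dig)) := by
    unfold incAll
    induction rs with
    | nil => exact fun _ => rfl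
    | cons r rs ih =>
      intro c
      simp only [scan, List.map_cons, ih]
      rfl
  exact this true

theorem next_op (rs : List Reg) : (next rs).map Reg.op = rs.map Reg.op := by
  rw [next, execOps_map _ (fun _ _ => rfl), loadAll, scan_loadReg_map _ (fun _ _ => rfl)]

theorem result_eq (rs : List Reg) {k : Option Bool} {ks : List Kind}
    (hk : rs.map Reg.kind = some k :: ks) :
    result rs =
      (queueRun (rs.map Reg.op) (initQueue (rs.map fun r => (r.kind, r.dig))) false).2 := by
  rw [result, execOps_eq_queueRun _ _ _ (k := k) (ks := ks), queue_loadAll]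
  rw [loadAll, scan_loadReg_map _ (fun _ _ => rfl), hk]

/-! #### The counter -/

/-- The counter of `m` digits with value `k`, interleaved with the bits of the constant `q`. -/
def counter : ℕ → ℕ → ℕ → List (Kind × Bool)
  | 0, _, _ => []
  | m + 1, k, q => (some none, decide (k % 2 = 1)) :: (some (some (decide (q % 2 = 1))), false) ::
      counter m (k / 2) (q / 2)

theorem initQueue_counter (m k q : ℕ) : initQueue (counter m k q) = interleave m k q := by
  induction m generalizing k q with
  | zero => rfl
  | succ m ih =>
    have := ih (k / 2) (q / 2)
    unfold initQueue at this ⊢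
    simpa [counter, interleave, initData] using this

theorem incAll_of_forall (c : Bool) {l : List (Kind × Bool)} (h : ∀ p ∈ l, p.1 ≠ some none) :
    incAll c l = l := by
  unfold incAll
  induction l with
  | nil => rfl
  | cons p l ih =>
    have hp := h p (by simp)
    have := ih fun p hp => h p (by simp [hp])
    have e : incDigit c p.1 p.2 = (c, p.2) := by simp [incDigit, hp]
    simp [scan, e, this]

/-- Ripple carry, where the interleaved constants hand the carry on and `l` contains no digit. No
bound on `k` is needed, since `counter` records only its residue modulo `2 ^ m`. -/
theorem incAll_counter (c : Bool) (m k q : ℕ) {l : List (Kind × Bool)}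
    (h : ∀ p ∈ l, p.1 ≠ some none) :
    incAll c (counter m k q ++ l) = counter m (k + c.toNat) q ++ l := by
  induction m generalizing k q c with
  | zero => exact incAll_of_forall c h
  | succ m ih =>
    have h1 := ih (c && decide (k % 2 = 1)) (k / 2) (q / 2)
    have e1 : k / 2 + (c && decide (k % 2 = 1)).toNat = (k + c.toNat) / 2 := by
      rcases Nat.mod_two_eq_zero_or_one k with hk | hk <;> cases c <;> simp [hk] <;> omega
    have e2 : xor c (decide (k % 2 = 1)) = decide ((k + c.toNat) % 2 = 1) := by
      rcases Nat.mod_two_eq_zero_or_one k with hk | hk <;> cases c <;> simp [hk, Nat.add_mod]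
    unfold incAll at h1 ⊢
    have e3 : ∀ c d, incDigit c (some none) d = (c && d, xor c d) := by simp [incDigit]
    have e4 : ∀ c v d, incDigit c (some (some v)) d = (c, d) := by simp [incDigit]
    simp [counter, scan, e2, e3, e4, ← e1, h1]

theorem counter_zero_map (m q : ℕ) :
    (counter m 0 q).map (fun p => (p.1, false)) = counter m 0 q := by
  induction m generalizing q with
  | zero => rfl
  | succ m ih => simpa [counter] using ih (q / 2)

/-! #### Compiling circuits -/

/-- The instruction that does nothing. -/
def nop : Op := fun a c => (a, c)

/-- A full rotation of a queue of length `W`, with the instruction `f` at the position `i`. -/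
def cycle (W i : ℕ) (f : Op) : List Op :=
  List.replicate i nop ++ f :: List.replicate (W - i - 1) nop

theorem cycle_length {W i : ℕ} (h : i < W) (f : Op) : (cycle W i f).length = W := by
  simp [cycle]; omega

theorem queueRun_nops (P : List Op) (q t : List Bool) (acc : Bool) :
    queueRun (List.replicate q.length nop ++ P) (q ++ t) acc = queueRun P (t ++ q) acc := by
  induction q generalizing t with
  | nil => simp
  | cons a q ih =>
    have := ih (t ++ [a])
    simpa [List.replicate_succ, queueRun, nop] using this

theorem queueRun_nops_snd (r : ℕ) (q : List Bool) (acc : Bool) :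
    (queueRun (List.replicate r nop) q acc).2 = acc := by
  induction r generalizing q with
  | zero => rfl
  | succ r ih =>
    cases q with
    | nil => rfl
    | cons a q => exact ih _

/-- Idle instructions bring the addressed bit to the front, and further ones restore the order
afterwards: random access costs one full rotation. -/
theorem queueRun_cycle (P : List Op) (f : Op) (q t : List Bool) (a acc : Bool) {W i : ℕ}
    (hi : i = q.length) (hW : W = q.length + 1 + t.length) :
    queueRun (cycle W i f ++ P) (q ++ a :: t) acc =
      queueRun P (q ++ (f a acc).1 :: t) (f a acc).2 := by
  subst hi hW
  rw [cycle, List.append_assoc, queueRun_nops, List.cons_append, List.cons_append, queueRun,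
    show q.length + 1 + t.length - q.length - 1 = t.length by omega, List.append_assoc,
    queueRun_nops]
  simp

theorem queueRun_read (P : List Op) {f : Op} (hf : ∀ a c, (f a c).1 = a) {v t : List Bool}
    {i W : ℕ} (hi : i < v.length) (hW : W = v.length + t.length) (acc : Bool) :
    queueRun (cycle W i f ++ P) (v ++ t) acc =
      queueRun P (v ++ t) (f (v.getD i false) acc).2 := by
  have hv : v = v.take i ++ v[i] :: v.drop (i + 1) := by
    rw [← List.drop_eq_getElem_cons, List.take_append_drop]
  have hg : v.getD i false = v[i] := by simp [List.getD_eq_getElem?_getD, hi]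
  have e : v ++ t = v.take i ++ v[i] :: (v.drop (i + 1) ++ t) := by
    rw [← List.cons_append, ← List.append_assoc, ← hv]
  rw [hg, e, queueRun_cycle _ _ _ _ _ _ (by simp; omega) (by simp; omega), hf]

/-- The instructions for a gate whose value is stored at the position `k`. -/
def gateOps (W k : ℕ) : Gate → List Op
  | .const v => cycle W k fun _ c => (v, c)
  | .not i => cycle W i (fun a _ => (a, a)) ++ cycle W k fun _ c => (!c, c)
  | .and i j => cycle W i (fun a _ => (a, a)) ++ cycle W j (fun a c => (a, c && a)) ++
      cycle W k fun _ c => (c, c)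
  | .or i j => cycle W i (fun a _ => (a, a)) ++ cycle W j (fun a c => (a, c || a)) ++
      cycle W k fun _ c => (c, c)

theorem gateOps_length_le {W k : ℕ} {g : Gate} (hk : k < W) (hg : g.ReadsBelow k) :
    (gateOps W k g).length ≤ 3 * W := by
  cases g with
  | const v => simp only [gateOps, cycle_length hk]; omega
  | not i =>
    have hi : i < W := lt_trans hg hk
    simp only [gateOps, List.length_append, cycle_length hk, cycle_length hi]; omega
  | and i j =>
    have hi : i < W := lt_trans hg.1 hk
    have hj : j < W := lt_trans hg.2 hk
    simp only [gateOps, List.length_append, cycle_length hk, cycle_length hi, cycle_length hj]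
    omega
  | or i j =>
    have hi : i < W := lt_trans hg.1 hk
    have hj : j < W := lt_trans hg.2 hk
    simp only [gateOps, List.length_append, cycle_length hk, cycle_length hi, cycle_length hj]
    omega

/-- The final accumulator may be left unspecified because the value stored by a gate does not depend
on the accumulator at its start. -/
theorem queueRun_gateOps (P : List Op) {g : Gate} {v t : List Bool} (hg : g.ReadsBelow v.length)
    {W : ℕ} (hW : W = v.length + 1 + t.length) (acc : Bool) :
    ∃ acc', queueRun (gateOps W v.length g ++ P) (v ++ false :: t) acc =
      queueRun P (v ++ g.eval v :: t) acc' := by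
  have hW' : W = v.length + (false :: t).length := by simp only [List.length_cons]; omega
  cases g with
  | const b => exact ⟨_, queueRun_cycle _ _ _ _ _ _ rfl hW⟩
  | not i =>
    rw [gateOps, List.append_assoc, queueRun_read _ (fun _ _ => rfl) hg hW',
      queueRun_cycle _ _ _ _ _ _ rfl hW]
    exact ⟨_, rfl⟩
  | and i j =>
    rw [gateOps, List.append_assoc, List.append_assoc, queueRun_read _ (fun _ _ => rfl) hg.1 hW',
      queueRun_read _ (fun _ _ => rfl) hg.2 hW', queueRun_cycle _ _ _ _ _ _ rfl hW]
    exact ⟨_, rfl⟩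
  | or i j =>
    rw [gateOps, List.append_assoc, List.append_assoc, queueRun_read _ (fun _ _ => rfl) hg.1 hW',
      queueRun_read _ (fun _ _ => rfl) hg.2 hW', queueRun_cycle _ _ _ _ _ _ rfl hW]
    exact ⟨_, rfl⟩

/-- The instructions for a list of gates. -/
def gatesOps (W : ℕ) : ℕ → List Gate → List Op
  | _, [] => []
  | k, g :: gs => gateOps W k g ++ gatesOps W (k + 1) gs

theorem gatesOps_length_le {W : ℕ} (gs : List Gate) (k : ℕ) (hW : k + gs.length ≤ W)
    (hg : ∀ (i : ℕ) (hi : i < gs.length), (gs[i]).ReadsBelow (k + i)) :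
    (gatesOps W k gs).length ≤ 3 * W * gs.length := by
  induction gs generalizing k with
  | nil => simp [gatesOps]
  | cons g gs ih =>
    simp only [List.length_cons] at hW
    have h1 : (gateOps W k g).length ≤ 3 * W := gateOps_length_le (by omega) (hg 0 (by simp))
    have h2 := ih (k + 1) (by omega) fun i hi => by
      have := hg (i + 1) (by simpa using hi)
      rwa [show k + 1 + i = k + (i + 1) by ring]
    simp only [gatesOps, List.length_append, List.length_cons, mul_add]
    omega

/-- The queue consists of the wires computed so far and a placeholder `false` for each remaining
gate; the next gate replaces the first placeholder. -/
theorem queueRun_gatesOps (P : List Op) {W : ℕ} (gs : List Gate) (v : List Bool) (acc : Bool)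
    (hg : ∀ (i : ℕ) (hi : i < gs.length), (gs[i]).ReadsBelow (v.length + i))
    (hW : W = v.length + gs.length) :
    ∃ acc', queueRun (gatesOps W v.length gs ++ P) (v ++ List.replicate gs.length false) acc =
      queueRun P (gs.foldl (fun w g => w ++ [g.eval w]) v) acc' := by
  induction gs generalizing v acc with
  | nil => exact ⟨acc, by simp [gatesOps]⟩
  | cons g gs ih =>
    obtain ⟨acc₁, h1⟩ := queueRun_gateOps (gatesOps W (v.length + 1) gs ++ P) (g := g) (v := v)
      (t := List.replicate gs.length false) (hg 0 (by simp)) (W := W)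
      (by rw [hW]; simp only [List.length_cons, List.length_replicate]; ring) acc
    obtain ⟨acc₂, h2⟩ := ih (v ++ [g.eval v]) acc₁ (fun i hi => by
      have := hg (i + 1) (by simpa using hi)
      simpa [add_assoc, add_comm 1 i] using this) (by rw [hW]; simp; ring)
    refine ⟨acc₂, ?_⟩
    rw [List.length_append, List.length_singleton] at h2
    rw [gatesOps, List.length_cons, List.replicate_succ, List.append_assoc, h1, List.foldl_cons,
      ← h2]
    simp

/-- The instructions for a circuit. -/
def circuitOps {n : ℕ} (C : Circuit n) : List Op :=
  gatesOps (n + C.size) n C.gates ++ cycle (n + C.size) C.out fun a _ => (a, a)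

theorem circuitOps_length_le {n : ℕ} (C : Circuit n) :
    (circuitOps C).length ≤ 3 * (n + C.size) * (C.size + 1) := by
  have h1 := gatesOps_length_le C.gates n (W := n + C.size) le_rfl C.wf
  rw [circuitOps, List.length_append, cycle_length (show C.out < n + C.size from C.out_lt)]
  change (gatesOps (n + C.size) n C.gates).length ≤ 3 * (n + C.size) * C.size at h1
  rw [mul_add]
  omega

theorem foldl_eval_length (gs : List Gate) (v : List Bool) :
    (gs.foldl (fun w g => w ++ [g.eval w]) v).length = v.length + gs.length := by
  induction gs generalizing v with
  | nil => rfl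
  | cons g gs ih => rw [List.foldl_cons, ih]; simp; ring

theorem queueRun_circuitOps {n : ℕ} (C : Circuit n) {x : List Bool} (hx : x.length = n) (r : ℕ) :
    (queueRun (circuitOps C ++ List.replicate r nop)
      (x ++ List.replicate C.size false) false).2 = C.eval x := by
  subst hx
  obtain ⟨acc, h⟩ := queueRun_gatesOps (cycle (x.length + C.size) C.out (fun a _ => (a, a)) ++
    List.replicate r nop) (W := x.length + C.size) C.gates x false C.wf rfl
  have h2 := queueRun_read (List.replicate r nop) (f := fun a _ => (a, a)) (fun _ _ => rfl)
    (v := C.wires x) (t := []) (i := C.out) (W := x.length + C.size)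
    (by rw [Circuit.wires, foldl_eval_length]; exact C.out_lt)
    (by rw [Circuit.wires, foldl_eval_length]; rfl) acc
  rw [List.append_nil] at h2
  rw [circuitOps, List.append_assoc]
  change (queueRun _ (x ++ List.replicate C.gates.length false) false).2 = _
  rw [h]
  change (queueRun _ (C.wires x) acc).2 = _
  rw [h2, queueRun_nops_snd]
  rfl

/-- The program of width `w` for a circuit whose inputs are interleaved. -/
theorem exists_program {m : ℕ} (C : Circuit (2 * m)) (q w : ℕ)
    (hw : 3 * (2 * m + C.size) * (C.size + 1) ≤ w) :
    ∃ S : List (Op × Kind), S.length = w ∧ S ≠ [] ∧ ∀ N,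
      results N (S.map fresh) = (List.range N).map fun k => C.eval (interleave m k q) := by
  -- The output wire shows that there is at least one wire, so the program will not be empty.
  have hW : 0 < 2 * m + C.size := (Nat.zero_le _).trans_lt C.out_lt
  have hWw : 2 * m + C.size ≤ w := by nlinarith
  have hlen : (circuitOps C).length ≤ w := (circuitOps_length_le C).trans hw
  -- The gates get constants `false` as placeholders; the cells beyond them carry instructions only.
  set tail : List (Kind × Bool) := List.replicate C.size (some (some false), false) ++
    List.replicate (w - (2 * m + C.size)) (none, false) with htail
  have htl : ∀ p ∈ tail, p.1 ≠ some none := by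
    intro p hp
    rcases List.mem_append.mp hp with hp | hp <;> rw [List.eq_of_mem_replicate hp] <;> simp
  have hcl : ∀ k, (counter m k q).length = 2 * m := by
    intro k
    clear * -
    induction m generalizing k q with
    | zero => rfl
    | succ m ih => simp only [counter, List.length_cons, ih]; ring
  have hinit : ∀ k, initQueue (counter m k q ++ tail) =
      interleave m k q ++ List.replicate C.size false := by
    intro k
    have h1 : initQueue tail = List.replicate C.size false := by
      simp [initQueue, htail, initData]
    rw [← h1, ← initQueue_counter]
    simp [initQueue]
  obtain ⟨S, hS1, hS2⟩ : ∃ S : List (Op × Kind),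
      S.map Prod.fst = circuitOps C ++ List.replicate (w - (circuitOps C).length) nop ∧
      S.map Prod.snd = (counter m 0 q ++ tail).map Prod.fst := by
    refine ⟨(circuitOps C ++ List.replicate (w - (circuitOps C).length) nop).zip
      ((counter m 0 q ++ tail).map Prod.fst), List.map_fst_zip ?_, List.map_snd_zip ?_⟩ <;>
    · simp [hcl, htail]; omega
  have hSlen : S.length = w := by
    have := congrArg List.length hS1
    simp only [List.length_map, List.length_append, List.length_replicate] at this
    omega
  refine ⟨S, hSlen, ?_, ?_⟩
  · rw [← List.length_pos_iff]
    omega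
  have hkind : ∀ k, ∃ a ks, (counter m k q ++ tail).map Prod.fst = some a :: ks := by
    intro k
    rcases Nat.eq_zero_or_pos m with rfl | hm
    · obtain ⟨s, hs⟩ : ∃ s, C.size = s + 1 := ⟨C.size - 1, by omega⟩
      rw [htail, hs]
      exact ⟨_, _, rfl⟩
    · obtain ⟨m, rfl⟩ : ∃ s, m = s + 1 := ⟨m - 1, by omega⟩
      exact ⟨_, _, rfl⟩
  -- Stated for a counter that starts at any `k` and for arbitrary scratch data, so that the
  -- induction applies to `next rs`.
  have key : ∀ N k (rs : List Reg), rs.map Reg.op = S.map Prod.fst →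
      rs.map (fun r => (r.kind, r.dig)) = counter m k q ++ tail →
      results N rs = (List.range' k N).map fun k => C.eval (interleave m k q) := by
    intro N
    induction N with
    | zero => exact fun _ _ _ _ => rfl
    | succ N ih =>
      intro k rs h1 h2
      obtain ⟨a, ks, hk⟩ := hkind k
      have h3 : rs.map Reg.kind = some a :: ks := by
        rw [← hk, ← h2, List.map_map]
        rfl
      rw [results, List.range'_succ, List.map_cons, result_eq rs h3, h1, h2, hS1, hinit,
        queueRun_circuitOps C (interleave_length m k q),
        ih (k + 1) (next rs) (by rw [next_op, h1])
          (by rw [next_counter, h2, incAll_counter _ _ _ _ htl]; rfl)]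
  intro N
  rw [List.range_eq_range']
  refine key N 0 (S.map fresh) (by simp [fresh, Function.comp_def]) ?_
  have h4 : (S.map fresh).map (fun r => (r.kind, r.dig)) =
      (S.map Prod.snd).map fun k => (k, false) := by
    simp [fresh, Function.comp_def]
  rw [h4, hS2, List.map_map, List.map_append]
  congr 1
  · exact counter_zero_map m q
  · simp [htail]

end PalMachine

/-! ### Printing a single bit

From a deterministic machine that prints a string `R n` on the input `1 ^ n`, we construct one that
reads `i` and `n + 1` in binary, interleaved, and decides whether the `i`-th bit of `R n` is
`1`. It simulates the former machine; the position of its input head, the distance of the latter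
from the right end marker and the number of bits that are still to be printed are stored in three
binary counters, on the three tracks of an additional tape. -/

namespace BitMachine

/-- The digits of the three counters. -/
abbrev Digits : Type := Bool × Bool × Bool

inductive State (Q : Type)
  | start
  | loadFst
  | loadSnd (v : Bool)
  | back (s : Q) (z : Digits)
  | sim (s : Q) (z : Digits)
  | update (s : Q) (left : Bool) (c : Digits)
  | done (v : Bool)

instance {Q : Type} [Finite Q] : Finite (State Q) := by
  refine Set.finite_univ_iff.mp (Set.Finite.subset
    ((Set.toFinite {State.start, State.loadFst}) |>.union (Set.finite_range State.loadSnd)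
      |>.union (Set.finite_range fun p : Q × Digits => State.back p.1 p.2)
      |>.union (Set.finite_range fun p : Q × Digits => State.sim p.1 p.2)
      |>.union (Set.finite_range fun p : Q × Bool × Digits => State.update p.1 p.2.1 p.2.2)
      |>.union (Set.finite_range State.done)) fun s _ => ?_)
  cases s <;> simp

/-- Adds the carry to a digit, or subtracts the borrow from it. -/
def stepDigit (dec : Bool) (c d : Bool) : Bool × Bool := (c && xor dec d, xor c d)

/-- One of the first two counters is incremented, the other two are decremented. -/
def stepDigits (left : Bool) (c d : Digits) : Digits × Digits :=
  (((stepDigit left c.1 d.1).1, (stepDigit (!left) c.2.1 d.2.1).1, (stepDigit true c.2.2 d.2.2).1),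
    ((stepDigit left c.1 d.1).2, (stepDigit (!left) c.2.1 d.2.1).2, (stepDigit true c.2.2 d.2.2).2))

/-- Updates the information which counters vanish. -/
def zeroStep (z d : Digits) : Digits := (z.1 && !d.1, z.2.1 && !d.2.1, z.2.2 && !d.2.2)

/-- The scanned input symbol of the simulated machine. -/
def simSym (z : Digits) : InSym :=
  if z.1 then .leftEnd else if z.2.1 then .rightEnd else .bit true

/-- Whether the input head of the simulated machine moves. -/
def moves (z : Digits) : Move → Bool
  | .left => !z.1
  | .stay => false
  | .right => !z.2.1

def isLeft : Move → Bool
  | .left => true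
  | _ => false

variable (M : DTM)

def mkAct (next : State M.Q) (inMove : Move) (g : Fin M.k → M.Γ) (gm : Fin M.k → Move)
    (x : Option Digits) (mv : Move) (qu : QueryAct) :
    Act (State M.Q) (M.Γ × Option Digits) (M.k + 1) where
  next := next
  inMove := inMove
  write := Fin.snoc (α := fun _ => M.Γ × Option Digits) (fun j => (g j, none)) (M.blank, x)
  workMove := Fin.snoc (α := fun _ => Move) gm mv
  out := none
  query := qu

/-- An action on the tape of the counters only. -/
def keep (next : State M.Q) (inMove : Move) (g : Fin M.k → M.Γ) (x : Option Digits) (mv : Move) :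
    Act (State M.Q) (M.Γ × Option Digits) (M.k + 1) :=
  mkAct M next inMove g (fun _ => .stay) x mv .skip

/-- Each pair of input bits becomes one cell of the counter tape, with the bits of `i` on the third
track and those of `n + 1` on the second. The first track starts at `0`: the simulated input head is
on the left end marker, at distance `n + 1` from the right one, which is why `n + 1` and not `n` is
supplied. If the first two counters vanish together, the word encodes no `n` and the machine halts
without accepting. The sweep `back` finds out which counters vanish, and `sim` needs to know nothing
else about them. -/
def trans (q : State M.Q) (i : InSym) (x : Option Digits) (g : Fin M.k → M.Γ) (ans : Bool) :
    Option (Act (State M.Q) (M.Γ × Option Digits) (M.k + 1)) :=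
  match q with
  | .start => some (keep M .loadFst .right g x .stay)
  | .loadFst => match i with
      | .bit v => some (keep M (.loadSnd v) .right g x .stay)
      | _ => some (keep M (.back M.start (true, true, true)) .stay g x .left)
  | .loadSnd v => match i with
      | .bit v' => some (keep M .loadFst .right g (some (false, v', v)) .right)
      | _ => some (keep M (.back M.start (true, true, true)) .stay g x .left)
  | .back s z => match x with
      | some d => some (keep M (.back s (zeroStep z d)) .stay g x .left)
      | none => some (keep M (.sim s z) .stay g x .right)
  | .sim s z => if z.1 && z.2.1 then none else
      match M.δ s (simSym z) g ans with
      | none => none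
      | some a => match a.out, z.2.2 with
        | some v, true => some (keep M (.done v) .stay g x .stay)
        | o, _ => some (mkAct M (.update a.next (isLeft a.inMove)
            (moves z a.inMove, moves z a.inMove, o.isSome)) .stay a.write a.workMove x .stay
            a.query)
  | .update s l c => match x with
      | some d => some (keep M (.update s l (stepDigits l c d).1) .stay g
          (some (stepDigits l c d).2) .right)
      | none => some (keep M (.back s (true, true, true)) .stay g x .left)
  | .done _ => none

end BitMachine

open BitMachine

/-- The machine that decides a single bit of the output of `M`. -/
def bitDTM (M : DTM) : DTM :=
  haveI := M.finQ
  haveI := M.finΓ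
  { Q := BitMachine.State M.Q
    Γ := M.Γ × Option Digits
    k := M.k + 1
    blank := (M.blank, none)
    start := .start
    accept := {.done true}
    δ := fun q i w ans => trans M q i (w (Fin.last _)).2 (fun j => (w j.castSucc).1) ans }

namespace BitMachine

theorem bitDTM_oracleFree {M : DTM} (h : M.OracleFree) : (bitDTM M).OracleFree := by
  intro q i w ans a ha
  change trans M q i (w (Fin.last _)).2 (fun j => (w j.castSucc).1) ans = some a at ha
  generalize (w (Fin.last _)).2 = x at ha
  generalize (fun j => (w (Fin.castSucc j)).1) = g at ha
  cases q <;> simp only [trans] at ha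
  case start => cases ha; rfl
  case loadFst => split at ha <;> cases ha <;> rfl
  case loadSnd => split at ha <;> cases ha <;> rfl
  case back => split at ha <;> cases ha <;> rfl
  case update => split at ha <;> cases ha <;> rfl
  case done => cases ha
  case sim =>
    split at ha
    · cases ha
    split at ha
    · cases ha
    next a' ha' =>
    split at ha
    · cases ha; rfl
    · cases ha; exact h _ _ _ _ _ ha'

/-! ### Simulating configurations and their steps -/

variable {M : DTM} {O : Language Bool} {y : List Bool}

/-- The configuration that simulates the configuration `c`, with the head at the cell `h` of the
additional tape `ct`. -/
def simCfg (q : State M.Q) (ih : ℕ) (c : M.Cfg) (h : ℤ) (ct : ℤ → Option Digits) :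
    (bitDTM M).Cfg where
  state := q
  inHead := ih
  head := Fin.snoc (α := fun _ => ℤ) c.head h
  tape := Fin.snoc (α := fun _ => ℤ → M.Γ × Option Digits)
    (fun j z => (c.tape j z, none)) fun z => (M.blank, ct z)
  output := []
  query := c.query
  answer := c.answer

theorem act_simCfg (q : State M.Q) (ih : ℕ) (c : M.Cfg) (h : ℤ) (ct : ℤ → Option Digits) :
    (bitDTM M).act y (simCfg q ih c h ct) =
      trans M q (DTM.inSym y ih) (ct h) (fun j => c.tape j (c.head j)) c.answer := by
  change trans M q (DTM.inSym y ih) _ _ c.answer = _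
  congr 1
  · simp [simCfg, Fin.snoc_last (n := M.k)]
  · funext j
    simp [simCfg, Fin.snoc_castSucc (n := M.k)]

theorem cfg_ext {M : DTM} {c d : M.Cfg} (h₁ : c.state = d.state) (h₂ : c.inHead = d.inHead)
    (h₃ : ∀ j, c.head j = d.head j) (h₄ : ∀ j, c.tape j = d.tape j) (h₅ : c.output = d.output)
    (h₆ : c.query = d.query) (h₇ : c.answer = d.answer) : c = d := by
  obtain ⟨s, i, h, t, o, q, a⟩ := c
  obtain ⟨s', i', h', t', o', q', a'⟩ := d
  obtain rfl : h = h' := funext h₃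
  obtain rfl : t = t' := funext h₄
  simp_all

open Classical in
theorem apply_simCfg (q q' : State M.Q) (ih : ℕ) (c c' : M.Cfg) (h : ℤ) (ct : ℤ → Option Digits)
    (mi : Move) (g : Fin M.k → M.Γ) (gm : Fin M.k → Move) (x : Option Digits) (mv : Move)
    (qu : QueryAct) (hhead : ∀ j, c'.head j = c.head j + (gm j).toInt)
    (htape : ∀ j, c'.tape j = Function.update (c.tape j) (c.head j) (g j))
    (hquery : c'.query = match qu with
      | .skip => c.query
      | .push b => c.query ++ [b]
      | .ask => [])
    (hans : c'.answer = match (generalizing := false) qu with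
      | .ask => decide (c.query ∈ O)
      | _ => c.answer) :
    (bitDTM M).apply O y (simCfg q ih c h ct) (mkAct M q' mi g gm x mv qu) =
      simCfg q' (DTM.moveIn y.length ih mi) c' (h + mv.toInt) (Function.update ct h x) := by
  refine cfg_ext rfl rfl (fun j => ?_) (fun j => ?_) rfl hquery.symm hans.symm
  · refine Fin.lastCases ?_ (fun j => ?_) j
    · simp [DTM.apply, simCfg, mkAct, Fin.snoc_last (n := M.k)]
    · simp [DTM.apply, simCfg, mkAct, Fin.snoc_castSucc (n := M.k), hhead]
  · refine Fin.lastCases ?_ (fun j => ?_) j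
    · simp only [DTM.apply, simCfg, mkAct, Fin.snoc_last (n := M.k)]
      funext z
      rcases eq_or_ne z h with rfl | hz
      · exact (Function.update_self ..).trans (by simp; rfl)
      · exact (Function.update_of_ne hz ..).trans (by simp [hz]; rfl)
    · simp only [DTM.apply, simCfg, mkAct, Fin.snoc_castSucc (n := M.k), htape]
      funext z
      rcases eq_or_ne z (c.head j) with rfl | hz
      · exact (Function.update_self ..).trans (by simp; rfl)
      · exact (Function.update_of_ne hz ..).trans (by simp [hz]; rfl)

/-- All heads are at distance at most `S` from the origin. -/
def Near (S : ℕ) {M : DTM} (c : M.Cfg) : Prop := ∀ j, (c.head j).natAbs ≤ S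

theorem near_simCfg {S : ℕ} {q : State M.Q} {ih : ℕ} {c : M.Cfg} {h : ℤ}
    {ct : ℤ → Option Digits} (hc : Near S c) (hh : h.natAbs ≤ S) :
    Near S (simCfg q ih c h ct) := by
  intro j
  refine Fin.lastCases ?_ (fun j => ?_) j
  · simpa [simCfg, Fin.snoc_last (n := M.k)] using hh
  · simpa [simCfg, Fin.snoc_castSucc (n := M.k)] using hc j

theorem detStep_of_act {M : DTM} {c d : M.Cfg} {a : Act M.Q M.Γ M.k} {P : M.Cfg → Prop}
    (ha : M.act y c = some a) (hd : d = M.apply O y c a) (hP : P d) :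
    DetStep (M.Step O y) P c d := by
  refine ⟨⟨a, ha, hd⟩, ?_, hP⟩
  rintro d' ⟨a', ha', rfl⟩
  rw [ha, Option.some.injEq] at ha'
  rw [hd, ha']

theorem not_step_of_act {M : DTM} {c d : M.Cfg} (ha : M.act y c = none) :
    ¬ M.Step O y c d := by
  rintro ⟨a, ha', -⟩
  rw [ha] at ha'
  cases ha'

/-- A forced computation during which the heads stay near the origin. -/
abbrev RunsNear (O : Language Bool) (y : List Bool) (S : ℕ) (M : DTM) (t : ℕ) (c d : M.Cfg) :
    Prop :=
  StepsIn (DetStep (M.Step O y) (Near S)) t c d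

theorem runs_keep {S : ℕ} {q q' : State M.Q} {ih ih' : ℕ} {c : M.Cfg} {h h' : ℤ}
    {ct ct' : ℤ → Option Digits} {mi mv : Move} {x : Option Digits}
    (hδ : trans M q (DTM.inSym y ih) (ct h) (fun j => c.tape j (c.head j)) c.answer =
      some (keep M q' mi (fun j => c.tape j (c.head j)) x mv))
    (hih : DTM.moveIn y.length ih mi = ih') (hh : h + mv.toInt = h')
    (hct : Function.update ct h x = ct') (hc : Near S c) (hS : h'.natAbs ≤ S) :
    RunsNear O y S (bitDTM M) 1 (simCfg q ih c h ct) (simCfg q' ih' c h' ct') := by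
  subst hih hh hct
  refine .single (detStep_of_act ((act_simCfg ..).trans hδ) ?_ (near_simCfg hc hS))
  exact (apply_simCfg q q' ih c c h ct mi _ _ x mv .skip (by simp [Move.toInt]) (by simp) rfl
    rfl).symm

/-! #### The tape of the counters -/

/-- The additional tape with the digits `u`. -/
def digitTape (u : List Digits) : ℤ → Option Digits := fun z =>
  if z < 0 then none else u[z.toNat]?

theorem digitTape_length (u v : List Digits) (d : Digits) :
    digitTape (u ++ d :: v) u.length = some d := by
  simp [digitTape]

theorem digitTape_end (u : List Digits) : digitTape u u.length = none := by
  simp [digitTape]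

theorem update_digitTape (u v : List Digits) (d d' : Digits) :
    Function.update (digitTape (u ++ d :: v)) u.length (some d') = digitTape (u ++ d' :: v) := by
  funext z
  rcases eq_or_ne z u.length with rfl | hz
  · simp [digitTape]
  · rw [Function.update_of_ne hz]
    unfold digitTape
    split_ifs with h
    · rfl
    · have hz' : z.toNat ≠ u.length := by omega
      rcases Nat.lt_or_ge z.toNat u.length with h1 | h1
      · rw [List.getElem?_append_left h1, List.getElem?_append_left h1]
      · rw [List.getElem?_append_right h1, List.getElem?_append_right h1]
        obtain ⟨k, hk⟩ : ∃ k, z.toNat - u.length = k + 1 := ⟨z.toNat - u.length - 1, by omega⟩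
        rw [hk]
        rfl

theorem update_digitTape_end (u : List Digits) (d : Digits) :
    Function.update (digitTape u) u.length (some d) = digitTape (u ++ [d]) := by
  funext z
  rcases eq_or_ne z u.length with rfl | hz
  · simp [digitTape]
  · rw [Function.update_of_ne hz]
    unfold digitTape
    split_ifs with h
    · rfl
    · have hz' : z.toNat ≠ u.length := by omega
      rcases Nat.lt_or_ge z.toNat u.length with h1 | h1
      · rw [List.getElem?_append_left h1]
      · rw [List.getElem?_eq_none h1, List.getElem?_eq_none (by simp; omega)]

/-- Which of the counters vanish. -/
def zeros (z : Digits) (u : List Digits) : Digits := u.foldr (fun d z => zeroStep z d) z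

/-- The sweep ends on the blank cell `-1` and returns to cell `0`, by which time every digit has
contributed to the flags. -/
theorem runs_back {S : ℕ} (s : M.Q) (ih : ℕ) {c : M.Cfg} (hc : Near S c) (v : List Digits)
    (u : List Digits) (z : Digits) (hS : u.length < S + 1) :
    RunsNear O y S (bitDTM M) (u.length + 1)
      (simCfg (.back s z) ih c (u.length - 1) (digitTape (u ++ v)))
      (simCfg (.sim s (zeros z u)) ih c 0 (digitTape (u ++ v))) := by
  induction u using List.reverseRecOn generalizing v z with
  | nil =>
    refine runs_keep (x := none) (mi := .stay) (mv := .right) ?_ rfl rfl ?_ hc (by simp)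
    · simp [trans, digitTape, zeros]
    · exact Function.update_eq_iff.mpr ⟨by simp [digitTape], fun _ _ => rfl⟩
  | append_singleton u d ih' =>
    rw [List.length_append, List.length_singleton] at hS ⊢
    have h1 := ih' (d :: v) (zeroStep z d) (by omega)
    have e : ((u.length + 1 : ℕ) : ℤ) - 1 = u.length := by push_cast; ring
    rw [e, List.append_assoc, List.singleton_append]
    have h2 : RunsNear O y S (bitDTM M) 1
        (simCfg (.back s z) ih c u.length (digitTape (u ++ d :: v)))
        (simCfg (.back s (zeroStep z d)) ih c (u.length - 1) (digitTape (u ++ d :: v))) := by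
      refine runs_keep (x := some d) (mi := .stay) (mv := .left) ?_ rfl rfl ?_ hc (by omega)
      · simp only [trans, digitTape_length]
      · rw [update_digitTape]
    have h3 := h2.trans h1
    rw [add_comm 1] at h3
    have e2 : zeros z (u ++ [d]) = zeros (zeroStep z d) u := by simp [zeros]
    rw [e2]
    exact h3

/-- The lowest digits are on the left, so carries and borrows travel with the head. The condition `1
≤ S` covers an empty counter tape, where the head ends on cell `-1`. -/
theorem runs_update {S : ℕ} (s : M.Q) (l : Bool) (ih : ℕ) {c : M.Cfg} (hc : Near S c)
    (v : List Digits) (u : List Digits) (z : Digits) (hS : u.length + v.length ≤ S) (hS1 : 1 ≤ S) :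
    RunsNear O y S (bitDTM M) (v.length + 1)
      (simCfg (.update s l z) ih c u.length (digitTape (u ++ v)))
      (simCfg (.back s (true, true, true)) ih c (((u.length + v.length : ℕ) : ℤ) - 1)
        (digitTape (u ++ (scan (stepDigits l) z v).2))) := by
  induction v generalizing u z with
  | nil =>
    refine runs_keep (x := none) (mi := .stay) (mv := .left) ?_ rfl ?_ ?_ hc ?_
    · simp [trans, digitTape_end]
    · simp [Move.toInt]; ring
    · rw [List.append_nil]
      exact Function.update_eq_iff.mpr ⟨by simp [digitTape], by simp [scan]⟩
    · simp only [List.length_nil] at hS ⊢; omega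
  | cons d v ih' =>
    simp only [List.length_cons] at hS
    have h1 := ih' (u ++ [(stepDigits l z d).2]) (stepDigits l z d).1 (by simp; omega)
    have h2 : RunsNear O y S (bitDTM M) 1
        (simCfg (.update s l z) ih c u.length (digitTape (u ++ d :: v)))
        (simCfg (.update s l (stepDigits l z d).1) ih c (u ++ [(stepDigits l z d).2]).length
          (digitTape (u ++ [(stepDigits l z d).2] ++ v))) := by
      refine runs_keep (x := some (stepDigits l z d).2) (mi := .stay) (mv := .right) ?_ rfl ?_ ?_ hc
        ?_
      · simp only [trans, digitTape_length]
      · simp [Move.toInt]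
      · rw [update_digitTape]; simp
      · simp; omega
    have h3 := h2.trans h1
    rw [add_comm 1] at h3
    have e : (u ++ [(stepDigits l z d).2]).length + v.length = u.length + (d :: v).length := by
      simp; ring
    rw [e, List.append_assoc] at h3
    exact h3

/-- The initial digits of the counters. -/
def decode : List Bool → List Digits
  | v :: v' :: y => (false, v', v) :: decode y
  | _ => []

theorem two_mul_decode_length_le (y : List Bool) : 2 * (decode y).length ≤ y.length := by
  match y with
  | [] => simp [decode]
  | [v] => simp [decode]
  | v :: v' :: y =>
    have := two_mul_decode_length_le y
    simp only [decode, List.length_cons]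
    omega

theorem inSym_append (y₁ y₂ : List Bool) (v : Bool) :
    DTM.inSym (y₁ ++ v :: y₂) (y₁.length + 1) = .bit v := by
  simp [DTM.inSym]

theorem inSym_end (y : List Bool) : DTM.inSym y (y.length + 1) = .rightEnd := by
  simp [DTM.inSym]

/-- Two letters are consumed per digit, hence the strong induction; a single last letter is ignored.
The bound on `u` keeps the head of the counter tape within the space bound. -/
theorem runs_load {S : ℕ} (hS : y.length + 1 ≤ S) {c : M.Cfg} (hc : Near S c) :
    ∀ (y₁ y₂ : List Bool) (u : List Digits), y₁ ++ y₂ = y → 2 * u.length ≤ y₁.length →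
    ∃ t ≤ y₂.length + 1, RunsNear O y S (bitDTM M) t
      (simCfg .loadFst (y₁.length + 1) c u.length (digitTape u))
      (simCfg (.back M.start (true, true, true)) (y.length + 1) c
        (((u ++ decode y₂).length : ℤ) - 1) (digitTape (u ++ decode y₂))) := by
  intro y₁ y₂
  induction h : y₂.length using Nat.strong_induction_on generalizing y₁ y₂ with
  | _ n ih =>
    intro u hy hu
    subst h
    match y₂ with
    | [] =>
      rw [List.append_nil] at hy
      subst hy
      refine ⟨1, le_rfl, runs_keep (x := none) (mi := .stay) (mv := .left) ?_ rfl ?_ ?_ hc ?_⟩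
      · simp [trans, inSym_end, digitTape_end]
      · simp [decode, Move.toInt]; ring
      · exact Function.update_eq_iff.mpr ⟨by simp [digitTape, decode], by simp [decode]⟩
      · simp [decode]; omega
    | [v] =>
      subst hy
      have h1 : RunsNear O (y₁ ++ [v]) S (bitDTM M) 1
          (simCfg .loadFst (y₁.length + 1) c u.length (digitTape u))
          (simCfg (.loadSnd v) (y₁.length + 2) c u.length (digitTape u)) := by
        refine runs_keep (x := none) (mi := .right) (mv := .stay) ?_ ?_ ?_ ?_ hc ?_
        · simp [trans, inSym_append, digitTape_end]
        · simp [DTM.moveIn]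
        · simp [Move.toInt]
        · exact Function.update_eq_iff.mpr ⟨by simp [digitTape], fun _ _ => rfl⟩
        · simp at hS ⊢; omega
      have h2 : RunsNear O (y₁ ++ [v]) S (bitDTM M) 1
          (simCfg (.loadSnd v) (y₁.length + 2) c u.length (digitTape u))
          (simCfg (.back M.start (true, true, true)) ((y₁ ++ [v]).length + 1) c
            (((u ++ decode [v]).length : ℤ) - 1) (digitTape (u ++ decode [v]))) := by
        refine runs_keep (x := none) (mi := .stay) (mv := .left) ?_ ?_ ?_ ?_ hc ?_
        · have := inSym_end (y₁ ++ [v])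
          rw [List.length_append, List.length_singleton] at this
          simp [trans, this, digitTape_end]
        · simp [DTM.moveIn]
        · simp [decode, Move.toInt]; ring
        · exact Function.update_eq_iff.mpr ⟨by simp [digitTape, decode], by simp [decode]⟩
        · simp [decode] at hS ⊢; omega
      exact ⟨2, by simp, h1.trans h2⟩
    | v :: v' :: y₂ =>
      subst hy
      have h1 : RunsNear O (y₁ ++ v :: v' :: y₂) S (bitDTM M) 1
          (simCfg .loadFst (y₁.length + 1) c u.length (digitTape u))
          (simCfg (.loadSnd v) (y₁.length + 2) c u.length (digitTape u)) := by
        refine runs_keep (x := none) (mi := .right) (mv := .stay) ?_ ?_ ?_ ?_ hc ?_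
        · simp [trans, inSym_append, digitTape_end]
        · simp [DTM.moveIn]
        · simp [Move.toInt]
        · exact Function.update_eq_iff.mpr ⟨by simp [digitTape], fun _ _ => rfl⟩
        · simp at hS ⊢; omega
      have h2 : RunsNear O (y₁ ++ v :: v' :: y₂) S (bitDTM M) 1
          (simCfg (.loadSnd v) (y₁.length + 2) c u.length (digitTape u))
          (simCfg .loadFst ((y₁ ++ [v, v']).length + 1) c (u ++ [(false, v', v)]).length
            (digitTape (u ++ [(false, v', v)]))) := by
        refine runs_keep (x := some (false, v', v)) (mi := .right) (mv := .right) ?_ ?_ ?_ ?_ hc ?_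
        · have := inSym_append (y₁ ++ [v]) y₂ v'
          rw [List.append_assoc, List.length_append, List.length_singleton] at this
          simp only [List.singleton_append] at this
          simp [trans, this]
        · simp [DTM.moveIn]
        · simp [Move.toInt]
        · exact update_digitTape_end _ _
        · simp at hS ⊢; omega
      obtain ⟨t, ht, h3⟩ := ih y₂.length (by simp) (y₁ ++ [v, v']) y₂ rfl
        (u ++ [(false, v', v)]) (by simp) (by simp; omega)
      refine ⟨1 + 1 + t, by simp; omega, (h1.trans h2).trans ?_⟩
      rw [List.append_assoc, List.singleton_append] at h3
      exact h3

/-! #### The values of the counters -/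

/-- The number with the given binary digits, the lowest first. -/
def binVal : List Bool → ℕ
  | [] => 0
  | d :: l => d.toNat + 2 * binVal l

theorem binVal_lt (l : List Bool) : binVal l < 2 ^ l.length := by
  induction l with
  | nil => simp [binVal]
  | cons d l ih =>
    rw [binVal, List.length_cons, pow_succ]
    have := d.toNat_le
    omega

/-- An exact balance, in which the outgoing carry has the weight of the next digit; overflow can
then be excluded by size alone. -/
theorem binVal_scan_inc (c : Bool) (l : List Bool) :
    binVal (scan (stepDigit false) c l).2 + 2 ^ l.length * (scan (stepDigit false) c l).1.toNat =
      binVal l + c.toNat := by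
  induction l generalizing c with
  | nil => simp [scan, binVal]
  | cons d l ih =>
    have := ih (stepDigit false c d).1
    simp only [scan, binVal, List.length_cons, pow_succ]
    cases c <;> cases d <;> simp [stepDigit] at this ⊢ <;> nlinarith

theorem binVal_scan_dec (c : Bool) (l : List Bool) :
    binVal (scan (stepDigit true) c l).2 + c.toNat =
      binVal l + 2 ^ l.length * (scan (stepDigit true) c l).1.toNat := by
  induction l generalizing c with
  | nil => simp [scan, binVal]
  | cons d l ih =>
    have := ih (stepDigit true c d).1
    simp only [scan, binVal, List.length_cons, pow_succ]
    cases c <;> cases d <;> simp [stepDigit] at this ⊢ <;> nlinarith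

theorem binVal_inc {c : Bool} {l : List Bool} (h : binVal l + c.toNat < 2 ^ l.length) :
    binVal (scan (stepDigit false) c l).2 = binVal l + c.toNat := by
  have h1 := binVal_scan_inc c l
  cases h2 : (scan (stepDigit false) c l).1
  · simpa [h2] using h1
  · rw [h2] at h1
    simp only [Bool.toNat_true, mul_one] at h1
    omega

/-- An outgoing borrow would push the new value to `2 ^ l.length` or beyond, which `l.length` digits
cannot represent. -/
theorem binVal_dec {c : Bool} {l : List Bool} (h : c.toNat ≤ binVal l) :
    binVal (scan (stepDigit true) c l).2 + c.toNat = binVal l := by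
  have h1 := binVal_scan_dec c l
  cases h2 : (scan (stepDigit true) c l).1
  · simpa [h2] using h1
  · rw [h2] at h1
    simp only [Bool.toNat_true, mul_one] at h1
    have h3 := binVal_lt (scan (stepDigit true) c l).2
    rw [scan_length] at h3
    omega

/-- The values of the three counters. -/
def val₁ (u : List Digits) : ℕ := binVal (u.map fun d => d.1)
def val₂ (u : List Digits) : ℕ := binVal (u.map fun d => d.2.1)
def val₃ (u : List Digits) : ℕ := binVal (u.map fun d => d.2.2)

theorem zeros_eq (u : List Digits) : zeros (true, true, true) u =
    (decide (val₁ u = 0), decide (val₂ u = 0), decide (val₃ u = 0)) := by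
  induction u with
  | nil => simp [zeros, val₁, val₂, val₃, binVal]
  | cons d u ih =>
    have : zeros (true, true, true) (d :: u) = zeroStep (zeros (true, true, true) u) d := rfl
    rw [this, ih]
    obtain ⟨p, q, i⟩ := d
    simp only [zeroStep, val₁, val₂, val₃, List.map_cons, binVal, Prod.mk.injEq]
    refine ⟨?_, ?_, ?_⟩
    · cases p
      · simp; rfl
      · simp
    · cases q
      · simp; rfl
      · simp
    · cases i
      · simp; rfl
      · simp

theorem scan_stepDigits (l : Bool) (c : Digits) (u : List Digits) :
    (scan (stepDigits l) c u).2.map (fun d => d.1) =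
      (scan (stepDigit l) c.1 (u.map fun d => d.1)).2 ∧
    (scan (stepDigits l) c u).2.map (fun d => d.2.1) =
      (scan (stepDigit !l) c.2.1 (u.map fun d => d.2.1)).2 ∧
    (scan (stepDigits l) c u).2.map (fun d => d.2.2) =
      (scan (stepDigit true) c.2.2 (u.map fun d => d.2.2)).2 := by
  induction u generalizing c with
  | nil => exact ⟨rfl, rfl, rfl⟩
  | cons d u ih =>
    obtain ⟨h1, h2, h3⟩ := ih (stepDigits l c d).1
    simp only [scan, List.map_cons, h1, h2, h3]
    exact ⟨rfl, rfl, rfl⟩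

/-! #### The simulation -/

/-- The digits `u` represent the configuration `c` of the simulated machine on the input
`1 ^ n`, where the bit with index `i` of the output is wanted. -/
structure Represents (n i : ℕ) (c : M.Cfg) (u : List Digits) : Prop where
  inHead : val₁ u = c.inHead
  sum : val₁ u + val₂ u = n + 1
  output : val₃ u + c.output.length = i

/-- On the input `1 ^ n` all cells between the markers look alike, so the scanned symbol is
determined by which distance to a marker vanishes. -/
theorem Represents.inSym_eq {n i : ℕ} {c : M.Cfg} {u : List Digits} (h : Represents n i c u) :
    DTM.inSym (unary n) c.inHead = simSym (zeros (true, true, true) u) := by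
  have h1 := h.inHead
  have h2 := h.sum
  rw [zeros_eq, ← h1]
  rcases Nat.eq_zero_or_pos (val₁ u) with h0 | h0
  · simp [h0, simSym, DTM.inSym]
  · obtain ⟨p, hp⟩ : ∃ p, val₁ u = p + 1 := ⟨val₁ u - 1, by omega⟩
    rcases Nat.eq_zero_or_pos (val₂ u) with h3 | h3
    · have : n ≤ p := by omega
      simp [hp, h3, simSym, DTM.inSym, unary, this]
    · have : p < n := by omega
      simp [hp, h3.ne', simSym, DTM.inSym, unary, this]

/-- The first two counters move in opposite directions and keep their sum. Overflow is excluded by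
`hn`, underflow of these two by suppressing moves beyond the markers, and underflow of the third by
`hout`. -/
theorem Represents.step {n i : ℕ} {c : M.Cfg} {u : List Digits} (h : Represents n i c u)
    (hn : n + 1 < 2 ^ u.length) {a : Act M.Q M.Γ M.k} (hout : a.out = none ∨ val₃ u ≠ 0) :
    Represents n i (M.apply O (unary n) c a) (scan (stepDigits (isLeft a.inMove))
      (moves (zeros (true, true, true) u) a.inMove, moves (zeros (true, true, true) u) a.inMove,
        a.out.isSome) u).2 := by
  have h1 := h.inHead
  have h2 := h.sum
  have h3 := h.output
  have hc : (M.apply O (unary n) c a).inHead = DTM.moveIn n c.inHead a.inMove := by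
    simp [DTM.apply, unary]
  have ho : (M.apply O (unary n) c a).output.length = c.output.length + a.out.isSome.toNat := by
    cases ha : a.out <;> simp [DTM.apply, ha]
  rw [zeros_eq]
  set mv := moves (decide (val₁ u = 0), decide (val₂ u = 0), decide (val₃ u = 0)) a.inMove
    with hmv
  obtain ⟨e1, e2, e3⟩ := scan_stepDigits (isLeft a.inMove) (mv, mv, a.out.isSome) u
  have f3 : val₃ (scan (stepDigits (isLeft a.inMove)) (mv, mv, a.out.isSome) u).2 +
      a.out.isSome.toNat = val₃ u := by
    unfold val₃ at hout ⊢
    rw [e3]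
    refine binVal_dec ?_
    rcases hout with h | h
    · simp [h]
    · exact (Bool.toNat_le _).trans (Nat.one_le_iff_ne_zero.mpr h)
  have key : val₁ (scan (stepDigits (isLeft a.inMove)) (mv, mv, a.out.isSome) u).2 =
        DTM.moveIn n c.inHead a.inMove ∧
      val₁ (scan (stepDigits (isLeft a.inMove)) (mv, mv, a.out.isSome) u).2 +
        val₂ (scan (stepDigits (isLeft a.inMove)) (mv, mv, a.out.isSome) u).2 = n + 1 := by
    rw [← h1]
    clear_value mv
    have hl : ∀ f : Digits → Bool, (u.map f).length = u.length := fun f => List.length_map _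
    unfold val₁ val₂ at *
    rw [e1, e2]
    have hle := mv.toNat_le
    cases hm : a.inMove with
    | left =>
      rw [hm] at hmv
      simp only [isLeft, Bool.not_true, DTM.moveIn, moves] at hmv ⊢
      -- The move is suppressed only on the left marker, in agreement with the truncated subtraction
      -- in `moveIn`.
      have hmv' : mv.toNat ≤ binVal (u.map fun d => d.1) ∧
          (mv.toNat = 0 → binVal (u.map fun d => d.1) = 0) := by
        rw [hmv]
        rcases Nat.eq_zero_or_pos (binVal (u.map fun d => d.1)) with h0 | h0
        · simp [h0]
        · simp [h0.ne']; omega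
      have g1 := binVal_dec hmv'.1
      have g2 := binVal_inc (c := mv) (l := u.map fun d => d.2.1) (by rw [hl]; omega)
      omega
    | stay =>
      rw [hm] at hmv
      simp only [isLeft, Bool.not_false, DTM.moveIn, moves] at hmv ⊢
      have g1 := binVal_inc (c := mv) (l := u.map fun d => d.1)
        (by rw [hl, hmv, Bool.toNat_false]; omega)
      have g2 := binVal_dec (c := mv) (l := u.map fun d => d.2.1) (by simp [hmv])
      rw [hmv, Bool.toNat_false] at g1 g2
      rw [hmv]
      omega
    | right =>
      rw [hm] at hmv
      simp only [isLeft, Bool.not_false, DTM.moveIn, moves] at hmv ⊢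
      have hmv' : mv.toNat ≤ binVal (u.map fun d => d.2.1) ∧
          (mv.toNat = 0 → binVal (u.map fun d => d.2.1) = 0) := by
        rw [hmv]
        rcases Nat.eq_zero_or_pos (binVal (u.map fun d => d.2.1)) with h0 | h0
        · simp [h0]
        · simp [h0.ne']; omega
      have g1 := binVal_inc (c := mv) (l := u.map fun d => d.1) (by rw [hl]; omega)
      have g2 := binVal_dec hmv'.1
      omega
  exact ⟨key.1.trans hc.symm, key.2, by rw [ho]; omega⟩

theorem trans_sim {n i : ℕ} {c : M.Cfg} {u : List Digits} (h : Represents n i c u)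
    {x : Option Digits} {s : InSym} :
    trans M (.sim c.state (zeros (true, true, true) u)) s x (fun j => c.tape j (c.head j))
        c.answer =
      match M.act (unary n) c with
      | none => none
      | some a => match a.out, decide (val₃ u = 0) with
        | some v, true => some (keep M (.done v) .stay (fun j => c.tape j (c.head j)) x .stay)
        | o, _ => some (mkAct M (.update a.next (isLeft a.inMove)
            (moves (zeros (true, true, true) u) a.inMove,
              moves (zeros (true, true, true) u) a.inMove, o.isSome)) .stay a.write a.workMove x
            .stay a.query) := by
  have h1 : ((zeros (true, true, true) u).1 && (zeros (true, true, true) u).2.1) = false := by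
    have := h.sum
    rw [zeros_eq, Bool.and_eq_false_iff, decide_eq_false_iff_not, decide_eq_false_iff_not]
    omega
  have h2 : (zeros (true, true, true) u).2.2 = decide (val₃ u = 0) := by rw [zeros_eq]
  simp only [trans, h1, Bool.false_eq_true, if_false, h2]
  rw [← h.inSym_eq]
  rfl

/-- The time is one step of `sim` plus an `update` sweep and a `back` sweep, of `u.length + 1` steps
each. -/
theorem runs_sim_step {n i S ih : ℕ} {c : M.Cfg} {u : List Digits} (h : Represents n i c u)
    (hn : n + 1 < 2 ^ u.length) {a : Act M.Q M.Γ M.k} (hout : a.out = none ∨ val₃ u ≠ 0)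
    (ha : M.act (unary n) c = some a) (hc : Near S (M.apply O (unary n) c a))
    (hS : u.length ≤ S) (hS1 : 1 ≤ S) :
    ∃ u' : List Digits, u'.length = u.length ∧ Represents n i (M.apply O (unary n) c a) u' ∧
      RunsNear O y S (bitDTM M) (2 * u.length + 3)
        (simCfg (.sim c.state (zeros (true, true, true) u)) ih c 0 (digitTape u))
        (simCfg (.sim (M.apply O (unary n) c a).state (zeros (true, true, true) u')) ih
          (M.apply O (unary n) c a) 0 (digitTape u')) := by
  have hr := h.step (O := O) hn hout
  set cc : Digits := (moves (zeros (true, true, true) u) a.inMove,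
    moves (zeros (true, true, true) u) a.inMove, a.out.isSome)
  refine ⟨_, scan_length _ _ _, hr, ?_⟩
  set c' := M.apply O (unary n) c a with hc'
  have h1 : RunsNear O y S (bitDTM M) 1
      (simCfg (.sim c.state (zeros (true, true, true) u)) ih c 0 (digitTape u))
      (simCfg (.update a.next (isLeft a.inMove) cc) ih c' 0 (digitTape u)) := by
    have hact : (bitDTM M).act y
        (simCfg (.sim c.state (zeros (true, true, true) u)) ih c 0 (digitTape u)) =
        some (mkAct M (.update a.next (isLeft a.inMove) cc) .stay a.write a.workMove
          (digitTape u 0) .stay a.query) := by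
      rw [act_simCfg, trans_sim h, ha]
      rcases hout with ho | ho
      · simp only [ho, cc]; rfl
      · cases ho' : a.out <;> simp only [ho', ho, decide_false, cc] <;> rfl
    refine .single (detStep_of_act hact ?_ (near_simCfg hc (by simp)))
    rw [apply_simCfg (c' := c') _ _ _ _ _ _ _ _ _ _ _ _ (fun _ => rfl) (fun _ => rfl) rfl rfl]
    simp [Move.toInt, DTM.moveIn]
  have h2 := runs_update (O := O) (y := y) a.next (isLeft a.inMove) ih hc u [] cc
    (by simpa using hS) hS1
  have h3 := runs_back (O := O) (y := y) a.next ih hc []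
    (scan (stepDigits (isLeft a.inMove)) cc u).2
    (true, true, true) (by rw [scan_length]; omega)
  simp only [List.nil_append, List.length_nil, Nat.cast_zero, zero_add, List.append_nil,
    scan_length] at h2 h3
  have h4 := (h1.trans h2).trans h3
  rw [show 1 + (u.length + 1) + (u.length + 1) = 2 * u.length + 3 by ring] at h4
  exact h4

theorem output_mono {M : DTM} {x : List Bool} {c d : M.Cfg} (h : M.Step O x c d) :
    c.output.length ≤ d.output.length := by
  obtain ⟨a, -, rfl⟩ := h
  simp [DTM.apply]

/-- As long as at most `i` bits have been printed, the wanted bit has not appeared and the third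
counter has not run out, so the simulation is faithful. -/
theorem runs_sim {n i S ih : ℕ} {u : List Digits} (hu : Represents n i M.init u)
    (hn : n + 1 < 2 ^ u.length) (hS : u.length ≤ S) (hS1 : 1 ≤ S)
    (hM : ∀ t c, StepsIn (M.Step O (unary n)) t M.init c → Near S c) {t : ℕ} {c : M.Cfg}
    (hc : StepsIn (M.Step O (unary n)) t M.init c) (hout : c.output.length ≤ i) :
    ∃ u' : List Digits, u'.length = u.length ∧ Represents n i c u' ∧
      RunsNear O y S (bitDTM M) (t * (2 * u.length + 3))
        (simCfg (.sim M.start (zeros (true, true, true) u)) ih M.init 0 (digitTape u))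
        (simCfg (.sim c.state (zeros (true, true, true) u')) ih c 0 (digitTape u')) := by
  induction t generalizing c with
  | zero =>
    cases hc
    exact ⟨u, rfl, hu, by rw [zero_mul]; exact .zero _⟩
  | succ t ih' =>
    have hc₀ := hc
    cases hc with
    | succ hb hs =>
      obtain ⟨u₁, hl, hr, hrun⟩ := ih' hb ((output_mono hs).trans hout)
      obtain ⟨a, ha, rfl⟩ := hs
      have ho : a.out = none ∨ val₃ u₁ ≠ 0 := by
        cases ha' : a.out with
        | none => exact .inl rfl
        | some v =>
          right
          have := hr.output
          simp [DTM.apply, ha'] at hout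
          omega
      obtain ⟨u', hl', hr', hrun'⟩ := runs_sim_step (O := O) (y := y) (ih := ih) (S := S) hr
        (by rwa [hl]) ho ha (hM _ _ hc₀) (by omega) hS1
      refine ⟨u', hl'.trans hl, hr', ?_⟩
      rw [hl] at hrun'
      rw [add_one_mul]
      exact hrun.trans hrun'

/-- A bit of the output has been printed at some point. -/
theorem exists_printing_step {M : DTM} {x : List Bool} {t : ℕ} {d : M.Cfg}
    (h : StepsIn (M.Step O x) t M.init d) {i : ℕ} (hi : i < d.output.length) :
    ∃ t₁ < t, ∃ c a v, StepsIn (M.Step O x) t₁ M.init c ∧ M.act x c = some a ∧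
      c.output.length = i ∧ a.out = some v ∧ d.output[i]? = some v := by
  induction t generalizing d with
  | zero =>
    cases h
    simp [DTM.init] at hi
  | succ t ih =>
    cases h with
    | @succ _ _ c _ hb hs =>
      obtain ⟨a, ha, rfl⟩ := hs
      rcases Nat.lt_or_ge i c.output.length with hlt | hge
      · obtain ⟨t₁, ht, c₁, a₁, v, h1, h2, h3, h4, h5⟩ := ih hb hlt
        refine ⟨t₁, by omega, c₁, a₁, v, h1, h2, h3, h4, ?_⟩
        rw [← h5]
        exact List.getElem?_append_left hlt
      · cases ho : a.out with
        | none => simp [DTM.apply, ho] at hi; omega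
        | some v =>
          have hi' : i = c.output.length := by simp [DTM.apply, ho] at hi; omega
          refine ⟨t, by omega, c, a, v, hb, ha, hi'.symm, ho, ?_⟩
          simp [DTM.apply, ho, hi']

theorem init_eq_simCfg : (bitDTM M).init = simCfg .start 0 M.init 0 (digitTape []) := by
  refine cfg_ext rfl rfl (fun j => ?_) (fun j => ?_) rfl rfl rfl
  · refine Fin.lastCases ?_ (fun j => ?_) j
    · simp [simCfg, DTM.init, Fin.snoc_last (n := M.k)]
    · simp [simCfg, DTM.init, Fin.snoc_castSucc (n := M.k)]
  · refine Fin.lastCases ?_ (fun j => ?_) j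
    · simp [simCfg, DTM.init, Fin.snoc_last (n := M.k), digitTape]
      rfl
    · simp [simCfg, DTM.init, Fin.snoc_castSucc (n := M.k)]
      rfl

theorem val₁_decode (y : List Bool) : val₁ (decode y) = 0 := by
  match y with
  | [] => simp [decode, val₁, binVal]
  | [v] => simp [decode, val₁, binVal]
  | v :: v' :: y =>
    have := val₁_decode y
    unfold val₁ at this ⊢
    simp [decode, binVal, this]

theorem near_init (S : ℕ) (M : DTM) : Near S M.init := fun _ => Nat.zero_le _

theorem runs_start {S : ℕ} (hS : y.length + 1 ≤ S) :
    ∃ t ≤ 2 * y.length + 3, RunsNear O y S (bitDTM M) t (bitDTM M).init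
      (simCfg (.sim M.start (zeros (true, true, true) (decode y))) (y.length + 1) M.init 0
        (digitTape (decode y))) := by
  have hl := two_mul_decode_length_le y
  have h1 : RunsNear O y S (bitDTM M) 1 (bitDTM M).init
      (simCfg .loadFst 1 M.init 0 (digitTape [])) := by
    rw [init_eq_simCfg]
    refine runs_keep (x := none) (mi := .right) (mv := .stay) ?_ ?_ rfl ?_ (near_init S M) (by simp)
    · simp [trans, digitTape]
    · simp [DTM.moveIn]
    · exact Function.update_eq_iff.mpr ⟨by simp [digitTape], fun _ _ => rfl⟩
  obtain ⟨t, ht, h2⟩ := runs_load (M := M) (O := O) hS (near_init S M) [] y [] rfl (by simp)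
  have h3 := runs_back (O := O) (y := y) M.start (y.length + 1) (near_init S M) [] (decode y)
    (true, true, true) (by omega)
  simp only [List.nil_append, List.append_nil] at h2 h3
  exact ⟨1 + t + ((decode y).length + 1), by omega, (h1.trans h2).trans h3⟩

/-- On the input `y`, the machine halts, and it accepts iff the wanted bit is `1`. -/
theorem runs_bitDTM (y : List Bool) {n S T : ℕ} {d : M.Cfg} (hS : y.length + 1 ≤ S)
    (hd : M.HaltsAt O (unary n) T d)
    (hM : ∀ t c, StepsIn (M.Step O (unary n)) t M.init c → Near S c)
    (hn : val₂ (decode y) = n + 1) :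
    ∃ t ≤ 2 * y.length + 4 + T * (y.length + 3), ∃ e : (bitDTM M).Cfg,
      RunsNear O y S (bitDTM M) t (bitDTM M).init e ∧ (bitDTM M).act y e = none ∧
      (e.state ∈ (bitDTM M).accept ↔ d.output[val₃ (decode y)]? = some true) := by
  obtain ⟨t, ht, h1⟩ := runs_start (M := M) (O := O) hS
  have hl := two_mul_decode_length_le y
  have hu : Represents n (val₃ (decode y)) M.init (decode y) :=
    ⟨val₁_decode y, by rw [val₁_decode, hn, zero_add], rfl⟩
  -- The counters cannot overflow, because `n + 1` was itself read off a track of this length.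
  have hlt : n + 1 < 2 ^ (decode y).length := by
    rw [← hn]
    simpa [val₂] using binVal_lt ((decode y).map fun d => d.2.1)
  rcases Nat.lt_or_ge (val₃ (decode y)) d.output.length with hi | hi
  -- The simulation is followed up to the step that prints the wanted bit; `bitDTM` answers instead
  -- of carrying out that step.
  · obtain ⟨t₁, ht₁, c, a, v, hc, ha, hci, hav, hdv⟩ := exists_printing_step hd.1 hi
    obtain ⟨u', hl', hr, hrun⟩ := runs_sim (y := y) (ih := y.length + 1) hu hlt (by omega)
      (by omega) hM hc hci.le
    have hz : val₃ u' = 0 := by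
      have := hr.output
      omega
    have h2 : RunsNear O y S (bitDTM M) 1
        (simCfg (.sim c.state (zeros (true, true, true) u')) (y.length + 1) c 0 (digitTape u'))
        (simCfg (.done v) (y.length + 1) c 0 (digitTape u')) := by
      refine runs_keep (x := digitTape u' 0) (mi := .stay) (mv := .stay) ?_ rfl rfl
        (Function.update_eq_self _ _) (hM _ _ hc) (by simp)
      rw [trans_sim hr, ha]
      simp [hav, hz]
    refine ⟨_, ?_, _, (h1.trans hrun).trans h2, ?_, ?_⟩
    · have : t₁ * (2 * (decode y).length + 3) ≤ T * (y.length + 3) :=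
        Nat.mul_le_mul ht₁.le (by omega)
      omega
    · rw [act_simCfg]; rfl
    · rw [hdv]
      change State.done v = State.done true ↔ _
      simp
  -- The output has no such bit: the simulation runs to its end and halts in a state `sim`, which
  -- rejects.
  · obtain ⟨u', hl', hr, hrun⟩ := runs_sim (y := y) (ih := y.length + 1) hu hlt (by omega)
      (by omega) hM hd.1 hi
    refine ⟨_, ?_, _, h1.trans hrun, ?_, ?_⟩
    · have : T * (2 * (decode y).length + 3) ≤ T * (y.length + 3) :=
        Nat.mul_le_mul le_rfl (by omega)
      omega
    · rw [act_simCfg, trans_sim hr, hd.2]; rfl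
    · rw [List.getElem?_eq_none hi]
      change State.sim _ _ = State.done true ↔ _
      simp

/-- Resource bounds are required on every word, including those that encode no `n`. -/
theorem runs_bitDTM_zero (y : List Bool) {S : ℕ} (hS : y.length + 1 ≤ S)
    (hn : val₂ (decode y) = 0) :
    ∃ t ≤ 2 * y.length + 4, ∃ e : (bitDTM M).Cfg,
      RunsNear O y S (bitDTM M) t (bitDTM M).init e ∧ (bitDTM M).act y e = none := by
  obtain ⟨t, ht, h1⟩ := runs_start (M := M) (O := O) hS
  refine ⟨t, by omega, _, h1, ?_⟩
  rw [act_simCfg, zeros_eq]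
  simp [trans, val₁_decode, hn]; rfl

/-- The language of the machine. -/
def bitLang (M : DTM) (O : Language Bool) : Language Bool :=
  {y | ∃ t d, (bitDTM M).HaltsAt O y t d ∧ d.state ∈ (bitDTM M).accept}

theorem mem_bitLang_iff {S t : ℕ} {e : (bitDTM M).Cfg}
    (h : RunsNear O y S (bitDTM M) t (bitDTM M).init e) (he : (bitDTM M).act y e = none) :
    e.state ∈ (bitDTM M).accept ↔ y ∈ bitLang M O := by
  constructor
  · exact fun ha => ⟨t, e, ⟨h.mono fun _ _ h => h.1, he⟩, ha⟩
  · rintro ⟨t', d, ⟨hd, hd'⟩, ha⟩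
    have := h.eq_of_detStep (fun _ => not_step_of_act he) hd fun _ => not_step_of_act hd'
    rwa [← this]

theorem val_decode_interleave (m k q : ℕ) (hk : k < 2 ^ m) (hq : q < 2 ^ m) :
    val₃ (decode (interleave m k q)) = k ∧ val₂ (decode (interleave m k q)) = q := by
  induction m generalizing k q with
  | zero =>
    simp only [pow_zero, Nat.lt_one_iff] at hk hq
    subst hk hq
    exact ⟨rfl, rfl⟩
  | succ m ih =>
    rw [pow_succ] at hk hq
    obtain ⟨h1, h2⟩ := ih (k / 2) (q / 2) (by omega) (by omega)
    unfold val₂ val₃ at *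
    simp only [interleave, decode, List.map_cons, binVal, h1, h2]
    constructor
    · rcases Nat.mod_two_eq_zero_or_one k with h | h <;> simp [h] <;> omega
    · rcases Nat.mod_two_eq_zero_or_one q with h | h <;> simp [h] <;> omega

/-! #### The complexity of the language of bits -/

theorem near_of_stepsIn {x : List Bool} {t : ℕ} {c : M.Cfg}
    (h : StepsIn (M.Step O x) t M.init c) : Near t c := by
  generalize hi : M.init = i at h
  induction h with
  | zero => subst hi; exact near_init _ _
  | succ _ hbc ih =>
    obtain ⟨a, -, rfl⟩ := hbc
    intro j
    have h1 := ih hi j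
    have h2 : ((a.workMove j).toInt).natAbs ≤ 1 := by cases a.workMove j <;> simp [Move.toInt]
    exact (Int.natAbs_add_le _ _).trans (Nat.add_le_add h1 h2)

theorem le_of_haltsAt {x : List Bool} {t T : ℕ} {c d : M.Cfg} (hd : M.HaltsAt O x T d)
    (h : StepsIn (M.Step O x) t M.init c) : t ≤ T := by
  refine (StepsIn.of_detStep (P := fun _ => True) (hd.1.mono fun a b hab => ?_)
    (fun _ => not_step_of_act hd.2) h).1
  obtain ⟨e, he, rfl⟩ := hab
  exact ⟨⟨e, he, rfl⟩, fun b ⟨e', he', hb⟩ => by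
    rw [he, Option.some.injEq] at he'
    rw [hb, he'], trivial⟩

theorem val₂_decode_lt (y : List Bool) : val₂ (decode y) < 2 ^ y.length := by
  refine (binVal_lt _).trans_le (Nat.pow_le_pow_right two_pos ?_)
  rw [List.length_map]
  have := two_mul_decode_length_le y
  omega

/-- The encoded `n` is below `2 ^ y.length`, so a polynomial in `n` is `2 ^ O(y.length)`; the
overhead of the counters is only a factor linear in `y.length`. -/
theorem exists_halt_of_poly {c : ℕ} (hM : ∀ n, ∃ t d, t ≤ c * n ^ c + c ∧
    M.HaltsAt O (unary n) t d) (y : List Bool) :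
    ∃ t e, t ≤ (8 * c + 4) * 2 ^ ((8 * c + 4) * y.length) ∧
      (bitDTM M).HaltsAt O y t e ∧ (e.state ∈ (bitDTM M).accept ↔ y ∈ bitLang M O) := by
  set N := y.length
  suffices h : ∃ t ≤ 2 * N + 4 + (2 * c * 2 ^ (c * N)) * (N + 3), ∃ S, ∃ e : (bitDTM M).Cfg,
      RunsNear O y S (bitDTM M) t (bitDTM M).init e ∧ (bitDTM M).act y e = none by
    obtain ⟨t, ht, S, e, h1, h2⟩ := h
    refine ⟨t, e, ht.trans ?_, ⟨h1.mono fun _ _ h => h.1, h2⟩, mem_bitLang_iff h1 h2⟩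
    have hN : N < 2 ^ N := Nat.lt_two_pow_self
    have h3 : 2 ^ N * 2 ^ (c * N) ≤ 2 ^ ((8 * c + 4) * N) := by
      rw [← pow_add]
      exact Nat.pow_le_pow_right two_pos (by nlinarith)
    have h4 : 1 ≤ 2 ^ (c * N) := Nat.one_le_two_pow
    generalize 2 ^ (c * N) = A at *
    calc 2 * N + 4 + 2 * c * A * (N + 3) ≤ 4 * 2 ^ N * A + 2 * c * A * (4 * 2 ^ N) := by
          refine Nat.add_le_add ?_ (Nat.mul_le_mul_left _ (by omega))
          exact (show 2 * N + 4 ≤ 4 * 2 ^ N by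
            rcases N with _ | N
            · simp
            · omega).trans (Nat.le_mul_of_pos_right _ h4)
      _ = (8 * c + 4) * (2 ^ N * A) := by ring
      _ ≤ _ := Nat.mul_le_mul_left _ h3
  rcases Nat.eq_zero_or_pos (val₂ (decode y)) with h0 | h0
  · obtain ⟨t, ht, e, h1, h2⟩ := runs_bitDTM_zero (M := M) (O := O) y le_rfl h0
    exact ⟨t, ht.trans (Nat.le_add_right _ _), _, e, h1, h2⟩
  · obtain ⟨n, hn⟩ : ∃ n, val₂ (decode y) = n + 1 := ⟨_, (Nat.sub_add_cancel h0).symm⟩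
    obtain ⟨T, d, hT, hd⟩ := hM n
    -- Space is irrelevant here, so `S` is taken beyond the halting time, which bounds the excursion
    -- of every head.
    obtain ⟨t, ht, e, h1, h2, -⟩ := runs_bitDTM y (le_max_right T _) hd
      (fun t c hc j => (near_of_stepsIn hc j).trans ((le_of_haltsAt hd hc).trans (le_max_left _ _)))
      hn
    refine ⟨t, ht.trans (Nat.add_le_add_left (Nat.mul_le_mul_right _ (hT.trans ?_)) _), _, e, h1,
      h2⟩
    have hlt : val₂ (decode y) < 2 ^ N := val₂_decode_lt y
    have h3 : n ^ c ≤ 2 ^ (c * N) := by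
      rw [mul_comm, pow_mul]
      exact Nat.pow_le_pow_left (by omega) _
    have h4 : 1 ≤ 2 ^ (c * N) := Nat.one_le_two_pow
    nlinarith

/-- The logarithm of the encoded `n` is at most `y.length`, so the simulated work tapes need linear
space, and so do the counters. -/
theorem bitLang_mem_PSPACE (hf : M.OracleFree) {c : ℕ}
    (hM : ∀ n, M.UsesSpace ⊥ (unary n) (c * Nat.log 2 n + c) ∧
      ∃ t d, M.HaltsAt ⊥ (unary n) t d) : bitLang M ⊥ ∈ PSPACE := by
  refine ⟨bitDTM M, c + 1, bitDTM_oracleFree hf, fun y => ?_⟩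
  suffices h : ∃ t, ∃ e : (bitDTM M).Cfg,
      RunsNear ⊥ y ((c + 1) * y.length + (c + 1)) (bitDTM M) t (bitDTM M).init e ∧
        (bitDTM M).act y e = none by
    obtain ⟨t, e, h1, h2⟩ := h
    refine ⟨fun t' c' hc' j => ?_, t, e, ⟨h1.mono fun _ _ h => h.1, h2⟩, mem_bitLang_iff h1 h2⟩
    have h3 : Near ((c + 1) * y.length + (c + 1)) c' := by
      rcases (h1.of_detStep (fun _ => not_step_of_act h2) hc').2.1 with rfl | h
      exacts [near_init _ _, h]
    refine (h3 j).trans (Nat.add_le_add_right (Nat.mul_le_mul_left _ ?_) _)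
    exact Nat.le_self_pow (by omega) _
  have hS : y.length + 1 ≤ (c + 1) * y.length + (c + 1) := by nlinarith
  rcases Nat.eq_zero_or_pos (val₂ (decode y)) with h0 | h0
  · obtain ⟨t, -, e, h1, h2⟩ := runs_bitDTM_zero (M := M) (O := ⊥) y hS h0
    exact ⟨t, e, h1, h2⟩
  · obtain ⟨n, hn⟩ : ∃ n, val₂ (decode y) = n + 1 := ⟨_, (Nat.sub_add_cancel h0).symm⟩
    obtain ⟨hs, T, d, hd⟩ := hM n
    have hlog : Nat.log 2 n ≤ y.length := by
      have hlt := val₂_decode_lt y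
      have := Nat.log_mono_right (b := 2) (show n ≤ 2 ^ y.length by omega)
      rwa [Nat.log_pow one_lt_two] at this
    obtain ⟨t, -, e, h1, h2, -⟩ := runs_bitDTM y hS hd
      (fun t c' hc' j => (hs t c' hc' j).trans (by nlinarith)) hn
    exact ⟨t, e, h1, h2⟩

theorem interleave_mem_bitLang_iff {m k n t : ℕ} {d : M.Cfg} (hd : M.HaltsAt O (unary n) t d)
    (hk : k < 2 ^ m) (hn : n + 1 < 2 ^ m) :
    interleave m k (n + 1) ∈ bitLang M O ↔ d.output[k]? = some true := by
  obtain ⟨h3, h2⟩ := val_decode_interleave m k (n + 1) hk hn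
  obtain ⟨_, -, e, h4, h5, h6⟩ := runs_bitDTM (interleave m k (n + 1)) (le_max_right t _) hd
    (fun t c hc j => (near_of_stepsIn hc j).trans ((le_of_haltsAt hd hc).trans (le_max_left _ _)))
    h2
  rw [← mem_bitLang_iff h4 h5, h6, h3]

end BitMachine

/-! ### Small circuits make the palindrome machine accept -/

/-- From `exp t ≥ t + 1` with `t = y * log 2`, as `log 2` exceeds `1 / 2`. -/
theorem le_two_mul_two_rpow (y : ℝ) : y ≤ 2 * (2 : ℝ) ^ y := by
  have h := Real.add_one_le_exp (Real.log 2 * y)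
  rw [← Real.rpow_def_of_pos two_pos] at h
  rcases le_total y 0 with h0 | h0
  · exact h0.trans (by positivity)
  · nlinarith [Real.log_two_gt_d9]

/-- With `2 ^ m` of order `n`, the bound on `s` is of order `n ^ (1/100)`, so the compiled width is
of order `n ^ (1/50)`, while the available width exceeds `n ^ (1/20) / 2`. -/
theorem eventually_exists_width (K : ℝ) : ∀ᶠ n : ℕ in atTop, ∀ m s : ℕ,
    n + 1 < 2 ^ m → 2 ^ m ≤ 2 * (n + 1) → (s : ℝ) ≤ K * (2 : ℝ) ^ ((1 / 200 : ℝ) * (2 * m : ℕ)) →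
    3 * (2 * m + s) * (s + 1) ≤ 2 ^ Nat.log (2 ^ 20) n := by
  obtain ⟨k, hkK⟩ : ∃ k : ℝ, k = |K| := ⟨_, rfl⟩
  have hk : 0 ≤ k := hkK ▸ abs_nonneg K
  obtain ⟨c, hcdef⟩ : ∃ c : ℝ, c = 3 * (400 + k) * (k + 1) := ⟨_, rfl⟩
  have hc : 0 < c := by rw [hcdef]; positivity
  obtain ⟨D, hDdef⟩ : ∃ D : ℝ, D = 4 * (2 * c) ^ 20 := ⟨_, rfl⟩
  filter_upwards [eventually_ge_atTop 1, tendsto_natCast_atTop_atTop.eventually_ge_atTop (D ^ 100)]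
    with n hn hD m s hlt hle hs
  obtain ⟨w, hw⟩ : ∃ w : ℕ, w = 2 ^ Nat.log (2 ^ 20) n := ⟨_, rfl⟩
  rw [← hw]
  -- All quantities are measured in `F`, whose hundredth power is `2 ^ m`: the width is `O(F ^ 2)`
  -- and `n` is of order `F ^ 100`.
  obtain ⟨F, hFdef⟩ : ∃ F : ℝ, F = (2 : ℝ) ^ ((m : ℝ) / 100) := ⟨_, rfl⟩
  have hF : 1 ≤ F := hFdef ▸ Real.one_le_rpow one_le_two (by positivity)
  have hF100 : F ^ 100 = 2 ^ m := by
    rw [hFdef, ← Real.rpow_mul_natCast two_pos.le,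
      show (m : ℝ) / 100 * (100 : ℕ) = m by push_cast; ring, Real.rpow_natCast]
  have hm : 2 * (m : ℝ) ≤ 400 * F := by
    have : (m : ℝ) / 100 ≤ 2 * F := hFdef ▸ le_two_mul_two_rpow _
    linarith
  have hs' : (s : ℝ) ≤ k * F := by
    refine hs.trans ?_
    rw [show (1 / 200 : ℝ) * (2 * m : ℕ) = (m : ℝ) / 100 by push_cast; ring, ← hFdef,
      hkK]
    exact mul_le_mul_of_nonneg_right (le_abs_self K) (by positivity)
  have hbound : 3 * (2 * (m : ℝ) + s) * (s + 1) ≤ c * F ^ 2 := by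
    calc 3 * (2 * (m : ℝ) + s) * (s + 1)
        ≤ 3 * (400 * F + k * F) * (k * F + F) := by gcongr
      _ = c * F ^ 2 := by rw [hcdef]; ring
  -- If the width did not fit, `n ≤ (2 * w) ^ 20` would be `O(F ^ 40)`, although `F ^ 100 ≤ 4 * n`.
  -- This bounds `F` by `D`, against `n ≥ D ^ 100`.
  by_contra! hlt'
  have hwc : (w : ℝ) < c * F ^ 2 := lt_of_lt_of_le (by exact_mod_cast hlt') hbound
  have hnw : (n : ℝ) ≤ (2 * w) ^ 20 := by
    have h1 := (Nat.lt_pow_succ_log_self (b := 2 ^ 20) (by norm_num) n).le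
    have h2 : (2 ^ 20) ^ (Nat.log (2 ^ 20) n + 1) = (2 * w) ^ 20 := by
      rw [hw, ← pow_succ', ← pow_mul, ← pow_mul, mul_comm]
    rw [Nat.succ_eq_add_one, h2] at h1
    exact_mod_cast h1
  have hn' : (1 : ℝ) ≤ n := by exact_mod_cast hn
  have hle' : F ^ 100 ≤ 2 * ((n : ℝ) + 1) := by rw [hF100]; exact_mod_cast hle
  have hlt100 : (n : ℝ) + 1 < F ^ 100 := by rw [hF100]; exact_mod_cast hlt
  have h60 : F ^ 60 * F ^ 40 ≤ D * F ^ 40 := by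
    have h3 : (2 * (w : ℝ)) ^ 20 ≤ (2 * (c * F ^ 2)) ^ 20 := by gcongr
    have h4 : (2 * (c * F ^ 2)) ^ 20 = (2 * c) ^ 20 * F ^ 40 := by
      rw [← mul_assoc, mul_pow, ← pow_mul]
    rw [← pow_add]
    calc F ^ (60 + 40) ≤ 4 * (n : ℝ) := by norm_num; linarith
      _ ≤ 4 * ((2 * c) ^ 20 * F ^ 40) := by rw [← h4]; linarith
      _ = D * F ^ 40 := by rw [hDdef]; ring
  have hFD : F ≤ D :=
    (le_self_pow₀ hF (by norm_num)).trans (le_of_mul_le_mul_right h60 (by positivity))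
  have : F ^ 100 ≤ D ^ 100 := by gcongr
  linarith

/-- A circuit for `L` on `2 * m` inputs, with `n + 1` hard-wired into the constants of the program,
prints `R n` as the counter runs through the positions. -/
theorem eventually_accepts {L : Language Bool} {R : ℕ → List Bool}
    (hL : L ∈ SIZE fun n => (2 : ℝ) ^ ((1 / 200 : ℝ) * n)) (hR : ∀ n, (R n).length = n)
    (h : ∀ m n k, k < 2 ^ m → n + 1 < 2 ^ m →
      (interleave m k (n + 1) ∈ L ↔ (R n)[k]? = some true)) :
    ∀ᶠ n in atTop, R n ∈ PAL → (palNTM (2 ^ 20 - 1)).Accepts (R n) := by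
  obtain ⟨K, hK⟩ := hL
  filter_upwards [eventually_exists_width K, eventually_ge_atTop 1] with n hw hn1 hpal
  -- The number of binary digits of `n + 1`: the least length that holds both numbers, which keeps
  -- `2 ^ m` within a factor two of `n + 1`.
  set m := Nat.log 2 (n + 1) + 1
  have hlt : n + 1 < 2 ^ m := Nat.lt_pow_succ_log_self one_lt_two _
  have hle : 2 ^ m ≤ 2 * (n + 1) := by
    rw [pow_succ, mul_comm]
    exact Nat.mul_le_mul_left _ (Nat.pow_log_le_self _ (by omega))
  obtain ⟨C, hC, hCL⟩ := hK (2 * m)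
  obtain ⟨S, hSl, hS, hres⟩ := PalMachine.exists_program C (n + 1) _ (hw m C.size hlt hle hC)
  have hpow : 2 ^ Nat.log (2 ^ 20) n ≤ n :=
    (Nat.pow_le_pow_left (by norm_num) _).trans (Nat.pow_log_le_self (2 ^ 20) (by omega))
  refine PalMachine.accepts_of_results (by norm_num) hpal S hS (by rw [hSl, hR]; exact hpow) ?_ ?_
  -- The chosen width is `2 ^ k` for `k + 1` digits, strictly below the cap `2 ^ (k + 1)`.
  · rw [hSl, hR, show 2 ^ 20 - 1 + 1 = 2 ^ 20 by norm_num,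
      Nat.length_digits _ _ (by norm_num) (by omega)]
    exact Nat.pow_lt_pow_right one_lt_two (Nat.lt_succ_self _)
  · rw [hR, hres]
    refine List.ext_getElem (by simp [hR]) fun k hk _ => ?_
    rw [List.length_map, List.length_range] at hk
    rw [List.getElem_map, List.getElem_range, Bool.eq_iff_iff,
      hCL _ (interleave_length _ _ _), h m n k (by omega) hlt,
      List.getElem?_eq_getElem (by rwa [hR]), Option.some.injEq]

/-- On non-palindromes the machine is right for every `n`, on palindromes `R n` for all large `n`;
so it errs on `R n` only finitely often. -/
theorem not_isRefuter {L : Language Bool} {R : ℕ → List Bool}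
    (hL : L ∈ SIZE fun n => (2 : ℝ) ^ ((1 / 200 : ℝ) * n))
    (h : ∀ m n k, k < 2 ^ m → n + 1 < 2 ^ m →
      (interleave m k (n + 1) ∈ L ↔ (R n)[k]? = some true)) :
    ¬ IsRefuter PAL (palNTM (2 ^ 20 - 1)) R := by
  rintro ⟨hR, hfreq⟩
  refine hfreq ((eventually_accepts hL hR h).mono fun n hn => ?_)
  exact not_not.mpr ⟨PalMachine.mem_PAL_of_accepts (by norm_num), hn⟩

end ConstructiveSeparation

/-! ### The three lower bounds -/

theorem mainTheorem6 :
    (ConstructiveSep algPNP PAL (NTM.timeOPow 1.1) →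
      ∃ δ : ℝ, 0 < δ ∧ ¬ (ENP ⊆ SIZE fun n => (2 : ℝ) ^ (δ * n))) ∧
    (ConstructiveSep algP PAL (NTM.timeOPow 1.1) →
      ∃ δ : ℝ, 0 < δ ∧ ¬ (classE ⊆ SIZE fun n => (2 : ℝ) ^ (δ * n))) ∧
    (ConstructiveSep algLOGSPACE PAL (NTM.timeOPow 1.1) →
      ∃ δ : ℝ, 0 < δ ∧ ¬ (PSPACE ⊆ SIZE fun n => (2 : ℝ) ^ (δ * n))) := by
  -- On inputs of length `2 * m` the exponent `1 / 200` allows `2 ^ (m / 100)` gates up to a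
  -- constant, about `n ^ (1/100)`, so that even the squared size fits under the cap.
  refine ⟨fun h => ⟨1 / 200, by norm_num, fun hsub => ?_⟩,
    fun h => ⟨1 / 200, by norm_num, fun hsub => ?_⟩,
    fun h => ⟨1 / 200, by norm_num, fun hsub => ?_⟩⟩
  · obtain ⟨R, ⟨O, hO, M, c, hM⟩, hR⟩ := h _ PalMachine.palNTM_mem_timeOPow
    refine not_isRefuter (hsub ⟨O, hO, bitDTM M, _, BitMachine.exists_halt_of_poly
      (c := c) fun n => ?_⟩) (fun m n k hk hn => ?_) hR
    · obtain ⟨t, d, ht, hd, -⟩ := hM n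
      exact ⟨t, d, ht, hd⟩
    · obtain ⟨t, d, -, hd, ho⟩ := hM n
      rw [← ho]
      exact BitMachine.interleave_mem_bitLang_iff hd hk hn
  · obtain ⟨R, ⟨M, c, hf, hM⟩, hR⟩ := h _ PalMachine.palNTM_mem_timeOPow
    refine not_isRefuter (hsub ⟨bitDTM M, _, BitMachine.bitDTM_oracleFree hf,
      BitMachine.exists_halt_of_poly (c := c) fun n => ?_⟩) (fun m n k hk hn => ?_) hR
    · obtain ⟨t, d, ht, hd, -⟩ := hM n
      exact ⟨t, d, ht, hd⟩
    · obtain ⟨t, d, -, hd, ho⟩ := hM n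
      rw [← ho]
      exact BitMachine.interleave_mem_bitLang_iff hd hk hn
  · obtain ⟨R, ⟨M, c, hf, hM⟩, hR⟩ := h _ PalMachine.palNTM_mem_timeOPow
    refine not_isRefuter (hsub (BitMachine.bitLang_mem_PSPACE hf (c := c) fun n => ?_))
      (fun m n k hk hn => ?_) hR
    · obtain ⟨hs, t, d, hd, -⟩ := hM n
      exact ⟨hs, t, d, hd⟩
    · obtain ⟨-, t, d, hd, ho⟩ := hM n
      rw [← ho]
      exact BitMachine.interleave_mem_bitLang_iff hd hk hn
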